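/- Let $1<q<1+\alpha$ with $\alpha\in(0,1)$, let $0\le u_0\in L^\infty(\mathbb R)\cap L^1(\mathbb R)$, $M=\int_{\mathbb R}u_0\,dx$, and let $u$ be the global mild solution of $$\partial_t u+|u|^{q-1}\partial_x u=\partial_x\mathcal D^\alpha[u(t,\cdot)](x)\quad(t>0,\ x\in\mathbb R),\qquad u(0,\cdot)=u_0,$$ where $\mathcal D^\alpha[g](x)=\frac1{\Gamma(-\alpha)}\int_{-\infty}^0\frac{g(x+z)-g(x)}{|z|^{\alpha+1}}\,dz$. That is, $u$ is bounded and continuous on $(0,\infty)\times\mathbb R$ and, for almost every $(t,x)\in(0,\infty)\times\mathbb R$, $$u(t,x)=(K(t,\cdot)*u_0)(x)-\int_0^t\Big(\partial_xK(t-s,\cdot)*\tfrac1q|u(s,\cdot)|^{q-1}u(s,\cdot)\Big)(x)\,ds,$$ where $K(t,x)=\frac1{2\pi}\int_{\mathbb R}e^{t(i\xi)^{\alpha+1}}e^{ix\xi}\,d\xi$ (principal branch) is the fundamental solution of $\partial_tU=\partial_x\mathcal D^\alpha[U]$. For $\lambda>1$ put $u_\lambda(s,y)=\lambda\,u(\lambda^qs,\lambda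 y)$, which solves $$\partial_su_\lambda+|u_\lambda|^{q-1}\partial_yu_\lambda=\lambda^{q-1-\alpha}\partial_y\mathcal D^\alpha[u_\lambda(s,\cdot)](y),\qquad u_\lambda(0,y)=\lambda u_0(\lambda y).$$ Then there is a constant $C(M,q)>0$, depending only on $M$ and $q$, such that for all $\lambda>1$, $R>0$ and $s>0$ the function $u_\lambda(s,\cdot)$ is integrable on $\{|y|>2R\}$ and $$\int_{|y|>2R}u_\lambda(s,y)\,dy\le\int_{|y|>R}u_0(y)\,dy+C(M,q)\left(\frac{s\,\lambda^{q-1-\alpha}}{R^{\alpha+1}}+\frac{s^{1/q}}{R}\right).$$ -/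

import Mathlib

open MeasureTheory Set

namespace NonlocalCL

/-- The flux `f(v) = |v|^(q-1) v / q`. -/
noncomputable def flux (q v : ℝ) : ℝ := |v| ^ (q - 1) * v / q

/-- The fundamental solution of the linear equation `∂ₜ U = ∂ₓ D^α[U]`, where `∂ₓ D^α` has Fourier
symbol `(iξ)^(α+1)` (principal branch):
`K(t,x) = (1/2π) ∫ exp(t (iξ)^(α+1)) exp(ixξ) dξ`.
The factor `1/2π` is the one for which `K(t,·)` has mass one. The integral is real, since the
integrand at `-ξ` is the complex conjugate of the integrand at `ξ`. -/
noncomputable def kernel (α t x : ℝ) : ℝ :=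
  ((1 / (2 * Real.pi) : ℝ) * ∫ ξ : ℝ,
    Complex.exp ((t : ℂ) * (Complex.I * (ξ : ℂ)) ^ ((α + 1 : ℝ) : ℂ)) *
      Complex.exp (Complex.I * (x : ℂ) * (ξ : ℂ)) : ℂ).re

/-- The right-hand side of the mild formulation,
`K(t,·) * u₀ (x) - ∫₀ᵗ ∂ₓK(t-s,·) * f(u(s,·)) (x) ds`. -/
noncomputable def mildRHS (α q : ℝ) (u₀ : ℝ → ℝ) (u : ℝ → ℝ → ℝ) (t x : ℝ) : ℝ :=
  (∫ y : ℝ, kernel α t (x - y) * u₀ y) -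
    ∫ s in (0 : ℝ)..t, ∫ y : ℝ, deriv (kernel α (t - s)) (x - y) * flux q (u s y)

/-- `u` is a (global) mild solution on `(0,∞) × ℝ` of
`∂ₜ u + |u|^(q-1) ∂ₓ u = ∂ₓ D^α[u]`, `u(0,·) = u₀`: a bounded continuous function on `(0,∞) × ℝ`
satisfying the mild formulation almost everywhere. Values of `u t x` for `t ≤ 0` are irrelevant. -/
structure IsMildSolution (α q : ℝ) (u₀ : ℝ → ℝ) (u : ℝ → ℝ → ℝ) : Prop where
  continuousOn : ContinuousOn (fun p : ℝ × ℝ => u p.1 p.2) (Ioi 0 ×ˢ univ)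
  bounded : ∃ B : ℝ, ∀ t > 0, ∀ x, |u t x| ≤ B
  mild : ∀ᵐ p ∂((volume : Measure (ℝ × ℝ)).restrict (Ioi 0 ×ˢ univ)),
    u p.1 p.2 = mildRHS α q u₀ u p.1 p.2

/-- The rescaled function `u_l(s,y) = l u(l^q s, l y)`. -/
noncomputable def rescale (q l : ℝ) (u : ℝ → ℝ → ℝ) (s y : ℝ) : ℝ :=
  l * u (l ^ q * s) (l * y)

end NonlocalCL

/-!
The proof works with the tail mass `∫_x^∞ u(t,·)` instead of `u` itself, and bounds it by explicit
barriers.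

**The linear semigroup.** The kernel has Fourier transform `exp (t (iξ)^(α+1))`, and it is the
scaled density of a spectrally one-sided stable law. Its positivity is the point that needs an
argument (`kernel_one_nonneg`): for `1 < b = α + 1 < 2` the Taylor coefficients of `(1 - z)^b` are
nonnegative except for the linear one, so `e^(ihξ) (1 - e^(-ihξ))^b` is a negative constant plus a
positive combination of modulations. The exponential of a positive multiple of it is therefore a
positive multiplier, and with the factor `h^(-b)` the limit `h → 0` is `exp ((iξ)^b)`. Hence the
linear flow `semi α t` is convolution with probability measures, and integrating by parts on the
Fourier side shows that the derivative of the kernel is integrable, so the flow smooths at the rate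
`t^(-1/(α+1))`, which is integrable at zero.

**The potential.** With `F = f(u)` and `Q₀ x = ∫_x^∞ u₀`, the function
`P t = semi t Q₀ + ∫₀ᵗ semi (t-s) (F s) ds` is defined without any integrability of `u(t,·)`. The
mild formulation says that `∂ₓ P = -u` for almost every time, and continuity in time extends this to
every positive time (`exists_isPotential`). It solves `∂ₜ P = L P + f(-∂ₓ P)` in the mild sense.

**Comparison.** Two such functions, or one of them and a barrier, differ by some `D` with
`D(t') ≤ semi (t'-t) (D t) + ∫ semi (t'-s) (G s) ds` and `|G| ≤ Λ |∂ₓ D|`. Near a maximum of `D` the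
slope is small since `∂ₓ D` is uniformly continuous, and for short times the semigroup only sees
nearby points, so the maximum grows by `o(h)` over a time step `h` (`comparison`).

**Barriers.** Comparing `P` with its translates gives `u ≥ 0`, and comparing it with constants gives
`0 ≤ P ≤ M`, so `u(t,·)` is integrable with mass at most `M`. A smooth step of height `M` and width
`r` satisfies `|L step| ≤ c r^(-(α+1))`, with `c` independent of `α` by scaling and by a Fourier
bound (`abs_semi_step_sub_le`), and its flux is at most `(M A / r)^q / q`, where `A` bounds the
slope of the profile. A constant minus the step, growing linearly in time, therefore dominates `P`,
which gives `P(t, 2r) ≤ Q₀ r + t (M c r^(-(α+1)) + (M A / r)^q / q)` and a matching lower bound at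
`-2r`; the difference bounds the mass of `u(t,·)` in `|x| > 2r`. If `t^(1/q) ≤ r`, then
`t / r^q ≤ t^(1/q) / r`, and otherwise the mass bound alone suffices. The estimate for the rescaled
function is the case `t = λ^q s`, `r = λ R`.
-/

namespace NonlocalCL

open Filter Topology

/-! ### The symbol and one-sided Fourier integrals -/

/-- The Fourier symbol `(iξ)^(α+1)` (principal branch) of `∂ₓ D^α`. -/
noncomputable def symb (α ξ : ℝ) : ℂ := (Complex.I * (ξ : ℂ)) ^ ((α + 1 : ℝ) : ℂ)

lemma norm_symb (α ξ : ℝ) : ‖symb α ξ‖ = |ξ| ^ (α + 1) := by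
  rw [symb, Complex.norm_cpow_real]
  simp

lemma symb_mul {c : ℝ} (hc : 0 < c) (α ξ : ℝ) :
    symb α (c * ξ) = ((c ^ (α + 1) : ℝ) : ℂ) * symb α ξ := by
  rcases eq_or_ne ξ 0 with rfl | hξ
  · rcases eq_or_ne (α + 1) 0 with h | h
    · simp [symb, h]
    · have h' := Complex.ofReal_ne_zero.2 h
      simp only [symb, mul_zero, Complex.ofReal_zero, Complex.zero_cpow h']
  · have h0 : Complex.I * (ξ : ℂ) ≠ 0 := by simp [hξ]
    have h1 : Complex.I * ((c * ξ : ℝ) : ℂ) = (c : ℂ) * (Complex.I * (ξ : ℂ)) := by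
      push_cast; ring
    have h2 : (c : ℂ) * (Complex.I * (ξ : ℂ)) ≠ 0 := by simp [hξ, hc.ne']
    rw [symb, symb, h1, Complex.cpow_def_of_ne_zero h2, Complex.cpow_def_of_ne_zero h0,
      Complex.log_ofReal_mul hc h0, add_mul, Complex.exp_add, Complex.ofReal_cpow hc.le,
      Complex.cpow_def_of_ne_zero (Complex.ofReal_ne_zero.2 hc.ne'), Complex.ofReal_log hc.le]

lemma symb_neg {α : ℝ} (hα : 0 < α) (ξ : ℝ) :
    symb α (-ξ) = (starRingEnd ℂ) (symb α ξ) := by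
  rcases eq_or_ne ξ 0 with rfl | hξ
  · have : ((α + 1 : ℝ) : ℂ) ≠ 0 := Complex.ofReal_ne_zero.2 (by linarith)
    simp only [symb, neg_zero, Complex.ofReal_zero, mul_zero, Complex.zero_cpow this, map_zero]
  · have h1 : Complex.I * ((-ξ : ℝ) : ℂ) = (starRingEnd ℂ) (Complex.I * (ξ : ℂ)) := by
      simp
    have harg : (Complex.I * (ξ : ℂ)).arg ≠ Real.pi := by
      intro h
      rw [Complex.arg_eq_pi_iff] at h
      simp at h
    rw [symb, symb, h1, Complex.conj_cpow _ _ harg, Complex.conj_ofReal]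

lemma symb_of_pos (α : ℝ) {ξ : ℝ} (hξ : 0 < ξ) :
    symb α ξ = ((ξ ^ (α + 1) : ℝ) : ℂ) * symb α 1 := by
  simpa using symb_mul hξ α 1

lemma symb_one_re (α : ℝ) : (symb α 1).re = Real.cos (Real.pi / 2 * (α + 1)) := by
  rw [symb, Complex.cpow_def_of_ne_zero (by simp)]
  simp only [Complex.ofReal_one, mul_one, Complex.log_I]
  rw [show (Real.pi : ℂ) / 2 * Complex.I * ((α + 1 : ℝ) : ℂ)
    = ((Real.pi / 2 * (α + 1) : ℝ) : ℂ) * Complex.I by push_cast; ring]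
  rw [Complex.exp_ofReal_mul_I_re]

lemma symb_one_re_neg {α : ℝ} (hα : 0 < α) (hα1 : α < 1) : (symb α 1).re < 0 := by
  rw [symb_one_re]
  apply Real.cos_neg_of_pi_div_two_lt_of_lt <;> nlinarith [Real.pi_pos]

lemma symb_re {α : ℝ} (hα : 0 < α) (ξ : ℝ) :
    (symb α ξ).re = |ξ| ^ (α + 1) * (symb α 1).re := by
  rcases lt_trichotomy ξ 0 with h | rfl | h
  · have := symb_of_pos α (neg_pos.2 h)
    rw [abs_of_neg h, ← neg_neg ξ, symb_neg hα, this]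
    simp
  · have : ((α + 1 : ℝ) : ℂ) ≠ 0 := Complex.ofReal_ne_zero.2 (by linarith)
    simp only [symb, Complex.ofReal_zero, mul_zero, Complex.zero_cpow this, Complex.zero_re,
      abs_zero, Real.zero_rpow (show α + 1 ≠ 0 by linarith), zero_mul]
  · rw [abs_of_pos h, symb_of_pos α h]
    simp

lemma symb_re_nonpos {α : ℝ} (hα : 0 < α) (hα1 : α < 1) (ξ : ℝ) : (symb α ξ).re ≤ 0 := by
  rw [symb_re hα]
  exact mul_nonpos_of_nonneg_of_nonpos (by positivity) (symb_one_re_neg hα hα1).le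

@[fun_prop]
lemma measurable_symb (α : ℝ) : Measurable (symb α) := by
  unfold symb
  fun_prop

lemma continuous_symb {α : ℝ} (hα : 0 < α) : Continuous (symb α) := by
  have h : (fun ξ : ℝ => symb α ξ) = fun ξ : ℝ =>
      (|ξ| ^ (α + 1) : ℝ) * (symb α 1).re + ((ξ * |ξ| ^ α : ℝ) : ℂ) * ((symb α 1).im : ℂ)
        * Complex.I := by
    ext ξ
    have hsp : ∀ {η : ℝ}, 0 < η → η ^ (α + 1) = η * η ^ α := fun {η} h => by
      rw [Real.rpow_add h, Real.rpow_one, mul_comm]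
    rcases lt_trichotomy ξ 0 with h | rfl | h
    · have := symb_of_pos α (neg_pos.2 h)
      rw [← neg_neg ξ, symb_neg hα, this, abs_neg, abs_of_pos (neg_pos.2 h), hsp (neg_pos.2 h)]
      apply Complex.ext <;> simp
    · have : ((α + 1 : ℝ) : ℂ) ≠ 0 := Complex.ofReal_ne_zero.2 (by linarith)
      simp only [symb, Complex.ofReal_zero, mul_zero, Complex.zero_cpow this,
        abs_zero, Real.zero_rpow (show α + 1 ≠ 0 by linarith), zero_mul, add_zero]
    · rw [abs_of_pos h, symb_of_pos α h, hsp h]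
      apply Complex.ext <;> simp
  rw [show symb α = fun ξ : ℝ => symb α ξ from rfl, h]
  have h1 : Continuous fun ξ : ℝ => |ξ| ^ (α + 1) :=
    continuous_abs.rpow_const (fun _ => Or.inr (by linarith))
  have h2 : Continuous fun ξ : ℝ => |ξ| ^ α :=
    continuous_abs.rpow_const (fun _ => Or.inr hα.le)
  fun_prop

lemma symb_zero {α : ℝ} (hα : 0 < α) : symb α 0 = 0 := by
  have : ((α + 1 : ℝ) : ℂ) ≠ 0 := Complex.ofReal_ne_zero.2 (by linarith)
  simp only [symb, Complex.ofReal_zero, mul_zero, Complex.zero_cpow this]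

/-- The functions `ξ ↦ ξ^s exp(a ξ^b)` on the half line; their span is stable under
differentiation. -/
noncomputable def powExp (a : ℂ) (b s ξ : ℝ) : ℂ :=
  ((ξ ^ s : ℝ) : ℂ) * Complex.exp (a * ((ξ ^ b : ℝ) : ℂ))

lemma hasDerivAt_powExp (a : ℂ) (b s : ℝ) {ξ : ℝ} (hξ : 0 < ξ) :
    HasDerivAt (powExp a b s)
      (s * powExp a b (s - 1) ξ + a * b * powExp a b (s + b - 1) ξ) ξ := by
  have h1 : HasDerivAt (fun ξ : ℝ => ((ξ ^ s : ℝ) : ℂ)) ((s * ξ ^ (s - 1) : ℝ) : ℂ) ξ :=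
    (Real.hasDerivAt_rpow_const (Or.inl hξ.ne')).ofReal_comp
  have h2 : HasDerivAt (fun ξ : ℝ => ((ξ ^ b : ℝ) : ℂ)) ((b * ξ ^ (b - 1) : ℝ) : ℂ) ξ :=
    (Real.hasDerivAt_rpow_const (Or.inl hξ.ne')).ofReal_comp
  have h3 := h1.mul ((h2.const_mul a).cexp)
  refine h3.congr_deriv ?_
  have h4 : ξ ^ (s + b - 1) = ξ ^ s * ξ ^ (b - 1) := by
    rw [← Real.rpow_add hξ]; ring_nf
  simp only [powExp, h4]
  push_cast
  ring

lemma norm_powExp (a : ℂ) (b s : ℝ) {ξ : ℝ} (hξ : 0 ≤ ξ) :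
    ‖powExp a b s ξ‖ = ξ ^ s * Real.exp (a.re * ξ ^ b) := by
  rw [powExp, norm_mul, Complex.norm_real, Complex.norm_exp, Real.norm_of_nonneg (by positivity)]
  simp

lemma integrableOn_powExp {a : ℂ} (ha : a.re < 0) {b s : ℝ} (hb : 0 < b) (hs : -1 < s) :
    IntegrableOn (powExp a b s) (Ioi 0) := by
  have h := integrableOn_rpow_mul_exp_neg_mul_rpow hs hb (neg_pos.2 ha)
  refine h.mono' ?_ ?_
  · apply Measurable.aestronglyMeasurable
    unfold powExp
    fun_prop
  · filter_upwards [ae_restrict_mem measurableSet_Ioi] with ξ hξ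
    rw [norm_powExp a b s (le_of_lt hξ), neg_neg]

lemma tendsto_powExp_atTop {a : ℂ} (ha : a.re < 0) {b s : ℝ} (hb : 0 < b) (hs : 0 < s) :
    Tendsto (powExp a b s) atTop (𝓝 0) :=
  tendsto_zero_of_hasDerivAt_of_integrableOn_Ioi (fun _ hξ => hasDerivAt_powExp a b s hξ)
    (((integrableOn_powExp ha hb (by linarith)).const_mul _).add
      ((integrableOn_powExp ha hb (by linarith)).const_mul _))
    (integrableOn_powExp ha hb (by linarith))

lemma tendsto_powExp_zero_atTop {a : ℂ} (ha : a.re < 0) {b : ℝ} (hb : 0 < b) :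
    Tendsto (powExp a b 0) atTop (𝓝 0) := by
  refine tendsto_zero_of_hasDerivAt_of_integrableOn_Ioi
    (fun _ hξ => hasDerivAt_powExp a b 0 hξ) ?_ (integrableOn_powExp ha hb (by linarith))
  simp only [Complex.ofReal_zero, zero_mul, zero_add]
  exact (integrableOn_powExp ha hb (by linarith)).const_mul _

lemma continuous_powExp (a : ℂ) {b s : ℝ} (hb : 0 < b) (hs : 0 ≤ s) :
    Continuous (powExp a b s) := by
  have h1 : Continuous fun ξ : ℝ => ξ ^ s := Real.continuous_rpow_const hs
  have h2 : Continuous fun ξ : ℝ => ξ ^ b := Real.continuous_rpow_const hb.le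
  unfold powExp
  fun_prop

lemma tendsto_powExp_nhdsGT (a : ℂ) {b s : ℝ} (hb : 0 < b) (hs : 0 < s) :
    Tendsto (powExp a b s) (𝓝[>] 0) (𝓝 0) := by
  have h := ((continuous_powExp a hb hs.le).tendsto 0).mono_left
    (nhdsWithin_le_nhds (s := Ioi 0))
  simpa [powExp, Real.zero_rpow hs.ne'] using h

lemma tendsto_powExp_zero_nhdsGT (a : ℂ) {b : ℝ} (hb : 0 < b) :
    Tendsto (powExp a b 0) (𝓝[>] 0) (𝓝 1) := by
  have h := ((continuous_powExp a hb le_rfl).tendsto 0).mono_left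
    (nhdsWithin_le_nhds (s := Ioi 0))
  simpa [powExp, Real.zero_rpow hb.ne'] using h

lemma norm_cexp_I (x ξ : ℝ) : ‖Complex.exp (Complex.I * (x : ℂ) * (ξ : ℂ))‖ = 1 := by
  rw [Complex.norm_exp]
  simp

lemma integrableOn_mul_cexp {s : Set ℝ} {p : ℝ → ℂ} (hp : IntegrableOn p s) (x : ℝ) :
    IntegrableOn (fun ξ : ℝ => p ξ * Complex.exp (Complex.I * (x : ℂ) * (ξ : ℂ))) s := by
  refine Integrable.mono hp (hp.aestronglyMeasurable.mul
    (by fun_prop : Measurable fun ξ : ℝ =>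
      Complex.exp (Complex.I * (x : ℂ) * (ξ : ℂ))).aestronglyMeasurable) ?_
  filter_upwards with ξ
  rw [norm_mul, norm_cexp_I, mul_one]

/-- Integration by parts in a one-sided Fourier integral. -/
lemma mul_integral_Ioi_cexp {p p' : ℝ → ℂ} {p₀ : ℂ}
    (hd : ∀ ξ ∈ Ioi (0 : ℝ), HasDerivAt p (p' ξ) ξ) (hp : IntegrableOn p (Ioi 0))
    (hp' : IntegrableOn p' (Ioi 0)) (h0 : Tendsto p (𝓝[>] 0) (𝓝 p₀))
    (htop : Tendsto p atTop (𝓝 0)) (x : ℝ) :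
    Complex.I * x * ∫ ξ in Ioi (0 : ℝ), p ξ * Complex.exp (Complex.I * (x : ℂ) * (ξ : ℂ)) =
      -p₀ - ∫ ξ in Ioi (0 : ℝ), p' ξ * Complex.exp (Complex.I * (x : ℂ) * (ξ : ℂ)) := by
  have hv : ∀ ξ ∈ Ioi (0 : ℝ), HasDerivAt
      (fun ξ : ℝ => Complex.exp (Complex.I * (x : ℂ) * (ξ : ℂ)))
      (Complex.exp (Complex.I * (x : ℂ) * (ξ : ℂ)) * (Complex.I * x)) ξ := fun ξ _ => by
    have h := ((Complex.ofRealCLM.hasDerivAt (x := ξ)).const_mul (Complex.I * (x : ℂ))).cexp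
    simpa using! h
  have hc : Continuous fun ξ : ℝ => Complex.exp (Complex.I * (x : ℂ) * (ξ : ℂ)) := by fun_prop
  have key := integral_Ioi_mul_deriv_eq_deriv_mul (a := (0 : ℝ)) (a' := p₀) (b' := 0) hd hv
    ?_ (integrableOn_mul_cexp hp' x) ?_ ?_
  · rw [zero_sub] at key
    rw [← integral_const_mul, ← key]
    congr 1
    ext ξ
    ring
  · have := (integrableOn_mul_cexp hp x).mul_const (Complex.I * (x : ℂ))
    refine this.congr (ae_of_all _ fun ξ => ?_)
    simp only [Pi.mul_apply]
    ring
  · have h1 := (hc.tendsto 0).mono_left (nhdsWithin_le_nhds (s := Ioi 0))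
    simpa using! h0.mul h1
  · rw [tendsto_zero_iff_norm_tendsto_zero] at htop ⊢
    refine htop.congr fun ξ => ?_
    rw [Pi.mul_apply, norm_mul, norm_cexp_I, mul_one]

/-! ### Decay and scaling of the fundamental solution -/

lemma integrable_of_conj_symm {f : ℝ → ℂ} (hf : IntegrableOn f (Ioi 0))
    (hs : ∀ ξ, f (-ξ) = (starRingEnd ℂ) (f ξ)) :
    Integrable f ∧ ∫ ξ, f ξ = ((2 * (∫ ξ in Ioi (0 : ℝ), f ξ).re : ℝ) : ℂ) := by
  have hconj : IntegrableOn (fun ξ => (starRingEnd ℂ) (f ξ)) (Ioi 0) :=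
    (Complex.conjCLE.toContinuousLinearMap).integrable_comp hf
  have hneg : IntegrableOn (fun ξ => f (-ξ)) (Ioi 0) := by
    simpa only [hs] using hconj
  have hIio : IntegrableOn f (Iio 0) := by
    have h := (Measure.measurePreserving_neg (volume : Measure ℝ)).integrableOn_comp_preimage
      (Homeomorph.neg ℝ).measurableEmbedding (f := f) (s := Iio 0)
    apply h.1
    simpa [Function.comp_def] using hneg
  have hIic : IntegrableOn f (Iic 0) := (integrableOn_Iic_iff_integrableOn_Iio (by finiteness)).2 hIio
  refine ⟨?_, ?_⟩
  · rw [← integrableOn_univ, ← Iic_union_Ioi (a := (0 : ℝ))]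
    exact hIic.union hf
  · rw [← intervalIntegral.integral_Iic_add_Ioi hIic hf]
    have h := integral_comp_neg_Iic (0 : ℝ) (fun ξ => f (-ξ))
    simp only [neg_neg, neg_zero, hs] at h
    rw [h, integral_conj]
    apply Complex.ext <;> simp
    ring

lemma exp_symb_eq_powExp {α : ℝ} (t : ℝ) {ξ : ℝ} (hξ : 0 < ξ) :
    Complex.exp (t * symb α ξ) = powExp (t * symb α 1) (α + 1) 0 ξ := by
  rw [powExp, Real.rpow_zero, symb_of_pos α hξ]
  push_cast
  ring_nf

lemma exp_symb_neg {α : ℝ} (hα : 0 < α) (t ξ : ℝ) :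
    Complex.exp (t * symb α (-ξ)) = (starRingEnd ℂ) (Complex.exp (t * symb α ξ)) := by
  rw [symb_neg hα, ← Complex.exp_conj, map_mul, Complex.conj_ofReal]

lemma cexp_I_neg (x ξ : ℝ) : Complex.exp (Complex.I * (x : ℂ) * ((-ξ : ℝ) : ℂ)) =
    (starRingEnd ℂ) (Complex.exp (Complex.I * (x : ℂ) * (ξ : ℂ))) := by
  rw [← Complex.exp_conj]
  simp

section

variable {α : ℝ} (hα : 0 < α) (hα1 : α < 1)
include hα hα1

lemma norm_exp_symb_le_one {t : ℝ} (ht : 0 ≤ t) (ξ : ℝ) :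
    ‖Complex.exp (t * symb α ξ)‖ ≤ 1 := by
  rw [Complex.norm_exp]
  simpa using mul_nonpos_of_nonneg_of_nonpos ht (symb_re_nonpos hα hα1 ξ)

lemma integrableOn_exp_symb {t : ℝ} (ht : 0 < t) :
    IntegrableOn (fun ξ => Complex.exp (t * symb α ξ)) (Ioi 0) := by
  have ha : ((t : ℂ) * symb α 1).re < 0 := by
    simpa using mul_neg_of_pos_of_neg ht (symb_one_re_neg hα hα1)
  exact (integrableOn_powExp ha (b := α + 1) (by linarith) (s := 0) (by norm_num)).congr_fun
    (fun ξ hξ => (exp_symb_eq_powExp t hξ).symm) measurableSet_Ioi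

lemma integrable_exp_symb {t : ℝ} (ht : 0 < t) :
    Integrable (fun ξ => Complex.exp (t * symb α ξ)) :=
  (integrable_of_conj_symm (integrableOn_exp_symb hα hα1 ht) (exp_symb_neg hα t)).1

lemma ofReal_kernel {t : ℝ} (ht : 0 < t) (x : ℝ) :
    (kernel α t x : ℂ) = (1 / (2 * Real.pi) : ℝ) *
      ∫ ξ : ℝ, Complex.exp (t * symb α ξ) * Complex.exp (Complex.I * (x : ℂ) * (ξ : ℂ)) := by
  have h := (integrable_of_conj_symm
    (integrableOn_mul_cexp (integrableOn_exp_symb hα hα1 ht) x) (fun ξ => by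
      rw [exp_symb_neg hα, cexp_I_neg, map_mul])).2
  change (((_ * ∫ ξ : ℝ, Complex.exp (t * symb α ξ) *
    Complex.exp (Complex.I * (x : ℂ) * (ξ : ℂ)) : ℂ).re : ℝ) : ℂ) = _
  rw [h, ← Complex.ofReal_mul, Complex.ofReal_re]

lemma kernel_eq_integral_Ioi {t : ℝ} (ht : 0 < t) (x : ℝ) :
    kernel α t x = 1 / Real.pi * (∫ ξ in Ioi (0 : ℝ), powExp (t * symb α 1) (α + 1) 0 ξ *
      Complex.exp (Complex.I * (x : ℂ) * (ξ : ℂ))).re := by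
  have h := (integrable_of_conj_symm
    (integrableOn_mul_cexp (integrableOn_exp_symb hα hα1 ht) x) (fun ξ => by
      rw [exp_symb_neg hα, cexp_I_neg, map_mul])).2
  have h2 := ofReal_kernel hα hα1 ht x
  rw [h, ← Complex.ofReal_mul, Complex.ofReal_inj] at h2
  rw [h2, setIntegral_congr_fun measurableSet_Ioi (fun ξ hξ => by
    rw [exp_symb_eq_powExp t hξ])]
  field_simp

lemma kernel_scaling {t : ℝ} (ht : 0 < t) (x : ℝ) :
    kernel α t x = t ^ (-(1 / (α + 1))) * kernel α 1 (t ^ (-(1 / (α + 1))) * x) := by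
  set c := t ^ (-(1 / (α + 1))) with hc
  have hc0 : 0 < c := Real.rpow_pos_of_pos ht _
  have hcb : t * c ^ (α + 1) = 1 := by
    rw [hc, ← Real.rpow_mul ht.le, neg_mul, one_div, inv_mul_cancel₀ (by linarith),
      Real.rpow_neg_one, mul_inv_cancel₀ ht.ne']
  have h := Measure.integral_comp_mul_left (fun ξ : ℝ => Complex.exp (t * symb α ξ) *
    Complex.exp (Complex.I * (x : ℂ) * (ξ : ℂ))) c
  rw [← Complex.ofReal_inj, Complex.ofReal_mul, ofReal_kernel hα hα1 ht,
    ofReal_kernel hα hα1 one_pos, mul_left_comm]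
  congr 1
  have h2 : ∀ ξ : ℝ, Complex.exp (t * symb α (c * ξ)) *
      Complex.exp (Complex.I * (x : ℂ) * ((c * ξ : ℝ) : ℂ)) = Complex.exp ((1 : ℝ) * symb α ξ) *
      Complex.exp (Complex.I * ((c * x : ℝ) : ℂ) * (ξ : ℂ)) := fun ξ => by
    rw [symb_mul hc0, ← mul_assoc, ← Complex.ofReal_mul, hcb]
    push_cast
    ring_nf
  simp only [h2] at h
  rw [h, abs_of_pos (inv_pos.2 hc0), Complex.real_smul, ← mul_assoc, ← Complex.ofReal_mul,
    mul_inv_cancel₀ hc0.ne', Complex.ofReal_one, one_mul]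

/-- The derivative of the fundamental solution at time one, as a one-sided Fourier integral. -/
lemma hasDerivAt_kernel_one (x : ℝ) :
    HasDerivAt (kernel α 1) (1 / Real.pi * (Complex.I * ∫ ξ in Ioi (0 : ℝ),
      powExp (symb α 1) (α + 1) 1 ξ * Complex.exp (Complex.I * (x : ℂ) * (ξ : ℂ))).re) x := by
  have ha := symb_one_re_neg hα hα1
  have hb : 0 < α + 1 := by linarith
  have hI0 : IntegrableOn (powExp (symb α 1) (α + 1) 0) (Ioi 0) :=
    integrableOn_powExp ha hb (by norm_num)
  have hI1 : IntegrableOn (powExp (symb α 1) (α + 1) 1) (Ioi 0) :=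
    integrableOn_powExp ha hb (by norm_num)
  have h1 := (hasDerivAt_integral_of_dominated_loc_of_deriv_le (𝕜 := ℝ) (x₀ := x)
    (μ := volume.restrict (Ioi (0 : ℝ))) (s := univ) (E := ℂ)
    (F := fun x ξ => powExp (symb α 1) (α + 1) 0 ξ * Complex.exp (Complex.I * (x : ℂ) * (ξ : ℂ)))
    (F' := fun x ξ => Complex.I * (powExp (symb α 1) (α + 1) 1 ξ *
      Complex.exp (Complex.I * (x : ℂ) * (ξ : ℂ))))
    (bound := fun ξ => ‖powExp (symb α 1) (α + 1) 1 ξ‖) univ_mem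
    (Eventually.of_forall fun y => (integrableOn_mul_cexp hI0 y).aestronglyMeasurable)
    (integrableOn_mul_cexp hI0 x) ((integrableOn_mul_cexp hI1 x).const_mul _).aestronglyMeasurable
    (ae_of_all _ fun ξ y _ => by rw [norm_mul, norm_mul, norm_cexp_I]; simp) hI1.norm
    (ae_of_all _ fun ξ y _ => ?_)).2
  · rw [integral_const_mul] at h1
    have h2 := (Complex.reCLM.hasFDerivAt.comp_hasDerivAt x h1).const_mul (1 / Real.pi)
    refine (h2.congr_of_eventuallyEq (Eventually.of_forall fun y => ?_)).congr_deriv ?_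
    · rw [kernel_eq_integral_Ioi hα hα1 one_pos]
      simp
    · simp
  · have h := (((Complex.ofRealCLM.hasDerivAt (x := y)).const_mul Complex.I).mul_const
      (ξ : ℂ)).cexp.const_mul (powExp (symb α 1) (α + 1) 0 ξ)
    refine h.congr_deriv ?_
    simp only [powExp, Real.rpow_zero, Real.rpow_one, Complex.ofRealCLM_apply]
    push_cast
    ring

lemma continuous_kernel_one : Continuous (kernel α 1) :=
  continuous_iff_continuousAt.2 fun x => (hasDerivAt_kernel_one hα hα1 x).continuousAt

end

lemma integrable_of_abs_le_of_sq_mul_abs_le {f : ℝ → ℝ} (hf : AEStronglyMeasurable f) {A B : ℝ}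
    (hA : ∀ x, |f x| ≤ A) (hB : ∀ x, x ^ 2 * |f x| ≤ B) : Integrable f := by
  refine (integrable_inv_one_add_sq.const_mul (A + B)).mono' hf (ae_of_all _ fun x => ?_)
  rw [Real.norm_eq_abs, ← div_eq_mul_inv, le_div_iff₀ (by positivity)]
  linarith [hA x, hB x]

lemma norm_integral_mul_cexp_le {p : ℝ → ℂ} (x : ℝ) :
    ‖∫ ξ in Ioi (0 : ℝ), p ξ * Complex.exp (Complex.I * (x : ℂ) * (ξ : ℂ))‖ ≤
      ∫ ξ in Ioi (0 : ℝ), ‖p ξ‖ := by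
  refine (norm_integral_le_integral_norm _).trans (le_of_eq ?_)
  simp only [norm_mul, norm_cexp_I, mul_one]

section

variable {α : ℝ} (hα : 0 < α) (hα1 : α < 1)
include hα hα1

lemma integrable_kernel_one : Integrable (kernel α 1) := by
  have ha := symb_one_re_neg hα hα1
  have hb : 0 < α + 1 := by linarith
  set a := symb α 1 with ha_def
  have hint : ∀ {s : ℝ}, -1 < s → IntegrableOn (powExp a (α + 1) s) (Ioi 0) :=
    fun hs => integrableOn_powExp ha hb hs
  have hker : ∀ x, kernel α 1 x = 1 / Real.pi * (∫ ξ in Ioi (0 : ℝ), powExp a (α + 1) 0 ξ *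
      Complex.exp (Complex.I * (x : ℂ) * (ξ : ℂ))).re := fun x => by
    simpa using kernel_eq_integral_Ioi hα hα1 one_pos x
  -- first and second derivative of `exp (a ξ^(α+1))`
  set p1 : ℝ → ℂ := fun ξ => a * (α + 1) * powExp a (α + 1) α ξ with hp1
  set p2 : ℝ → ℂ := fun ξ => a * (α + 1) *
    (α * powExp a (α + 1) (α - 1) ξ + a * (α + 1) * powExp a (α + 1) (2 * α) ξ) with hp2
  have hd0 : ∀ ξ ∈ Ioi (0 : ℝ), HasDerivAt (powExp a (α + 1) 0) (p1 ξ) ξ := fun ξ hξ => by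
    refine (hasDerivAt_powExp a (α + 1) 0 hξ).congr_deriv ?_
    rw [hp1, show 0 + (α + 1) - 1 = α by ring]
    push_cast
    ring
  have hd1 : ∀ ξ ∈ Ioi (0 : ℝ), HasDerivAt p1 (p2 ξ) ξ := fun ξ hξ => by
    refine ((hasDerivAt_powExp a (α + 1) α hξ).const_mul (a * (α + 1))).congr_deriv ?_
    rw [hp2, show α + (α + 1) - 1 = 2 * α by ring]
    push_cast
    ring
  have hi1 : IntegrableOn p1 (Ioi 0) := (hint (by linarith)).const_mul _
  have hi2 : IntegrableOn p2 (Ioi 0) :=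
    (((hint (by linarith)).const_mul _).add ((hint (by linarith)).const_mul _)).const_mul _
  refine integrable_of_abs_le_of_sq_mul_abs_le
    (continuous_kernel_one hα hα1).aestronglyMeasurable
    (A := 1 / Real.pi * ∫ ξ in Ioi (0 : ℝ), ‖powExp a (α + 1) 0 ξ‖)
    (B := 1 / Real.pi * ∫ ξ in Ioi (0 : ℝ), ‖p2 ξ‖) (fun x => ?_) (fun x => ?_)
  · rw [hker, abs_mul, abs_of_pos (by positivity : 0 < 1 / Real.pi)]
    gcongr
    exact (Complex.abs_re_le_norm _).trans (norm_integral_mul_cexp_le x)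
  · have e0 := mul_integral_Ioi_cexp hd0 (hint (by norm_num)) hi1
      (tendsto_powExp_zero_nhdsGT a hb) (tendsto_powExp_zero_atTop ha hb) x
    have e1 := mul_integral_Ioi_cexp (p₀ := 0) hd1 hi1 hi2
      (by simpa using (tendsto_powExp_nhdsGT a hb hα).const_mul (a * (α + 1)))
      (by simpa using (tendsto_powExp_atTop ha hb hα).const_mul (a * (α + 1))) x
    set J0 := ∫ ξ in Ioi (0 : ℝ), powExp a (α + 1) 0 ξ *
      Complex.exp (Complex.I * (x : ℂ) * (ξ : ℂ)) with hJ0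
    set J1 := ∫ ξ in Ioi (0 : ℝ), p1 ξ * Complex.exp (Complex.I * (x : ℂ) * (ξ : ℂ)) with hJ1
    set J2 := ∫ ξ in Ioi (0 : ℝ), p2 ξ * Complex.exp (Complex.I * (x : ℂ) * (ξ : ℂ)) with hJ2
    -- the boundary term is imaginary
    have e : ((x ^ 2 : ℝ) : ℂ) * J0 = Complex.I * x - J2 := by
      have : Complex.I * x * (Complex.I * x * J0) = Complex.I * x * (-1 - J1) := by rw [e0]
      rw [mul_sub, e1, ← mul_assoc] at this
      rw [show Complex.I * (x : ℂ) * (Complex.I * x) = -((x ^ 2 : ℝ) : ℂ) by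
        push_cast; linear_combination (x : ℂ) ^ 2 * Complex.I_sq] at this
      linear_combination -this
    have e' : x ^ 2 * J0.re = -J2.re := by
      have := congrArg Complex.re e
      simpa only [Complex.re_ofReal_mul, Complex.sub_re, Complex.mul_re, Complex.I_re,
        Complex.ofReal_re, Complex.I_im, Complex.ofReal_im, zero_mul, mul_zero, sub_zero,
        zero_sub] using this
    rw [hker, abs_mul, abs_of_pos (by positivity : 0 < 1 / Real.pi), mul_left_comm,
      ← abs_of_nonneg (sq_nonneg x), ← abs_mul, e', abs_neg]
    gcongr
    exact (Complex.abs_re_le_norm _).trans (norm_integral_mul_cexp_le x)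

lemma integrable_deriv_kernel_one : Integrable (deriv (kernel α 1)) := by
  have ha := symb_one_re_neg hα hα1
  have hb : 0 < α + 1 := by linarith
  set a := symb α 1 with ha_def
  have hint : ∀ {s : ℝ}, -1 < s → IntegrableOn (powExp a (α + 1) s) (Ioi 0) :=
    fun hs => integrableOn_powExp ha hb hs
  have hker : ∀ x, deriv (kernel α 1) x = 1 / Real.pi * (Complex.I * ∫ ξ in Ioi (0 : ℝ),
      powExp a (α + 1) 1 ξ * Complex.exp (Complex.I * (x : ℂ) * (ξ : ℂ))).re :=
    fun x => (hasDerivAt_kernel_one hα hα1 x).deriv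
  -- first and second derivative of `ξ exp (a ξ^(α+1))`
  set p1 : ℝ → ℂ := fun ξ => powExp a (α + 1) 0 ξ + a * (α + 1) * powExp a (α + 1) (α + 1) ξ
    with hp1
  set p2 : ℝ → ℂ := fun ξ => a * (α + 1) * powExp a (α + 1) α ξ + a * (α + 1) *
    ((α + 1) * powExp a (α + 1) α ξ + a * (α + 1) * powExp a (α + 1) (2 * α + 1) ξ) with hp2
  have hd0 : ∀ ξ ∈ Ioi (0 : ℝ), HasDerivAt (powExp a (α + 1) 1) (p1 ξ) ξ := fun ξ hξ => by
    refine (hasDerivAt_powExp a (α + 1) 1 hξ).congr_deriv ?_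
    rw [hp1, show 1 + (α + 1) - 1 = α + 1 by ring, sub_self]
    push_cast
    ring
  have hd1 : ∀ ξ ∈ Ioi (0 : ℝ), HasDerivAt p1 (p2 ξ) ξ := fun ξ hξ => by
    refine ((hasDerivAt_powExp a (α + 1) 0 hξ).add
      ((hasDerivAt_powExp a (α + 1) (α + 1) hξ).const_mul (a * (α + 1)))).congr_deriv ?_
    rw [hp2, show 0 + (α + 1) - 1 = α by ring, show α + 1 - 1 = α by ring,
      show α + 1 + (α + 1) - 1 = 2 * α + 1 by ring]
    push_cast
    ring
  have hi1 : IntegrableOn p1 (Ioi 0) :=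
    (hint (by norm_num)).add ((hint (by linarith)).const_mul _)
  have hi2 : IntegrableOn p2 (Ioi 0) :=
    ((hint (by linarith)).const_mul _).add
      ((((hint (by linarith)).const_mul _).add ((hint (by linarith)).const_mul _)).const_mul _)
  refine integrable_of_abs_le_of_sq_mul_abs_le
    (measurable_deriv _).aestronglyMeasurable
    (A := 1 / Real.pi * ∫ ξ in Ioi (0 : ℝ), ‖powExp a (α + 1) 1 ξ‖)
    (B := 1 / Real.pi * (1 + ∫ ξ in Ioi (0 : ℝ), ‖p2 ξ‖)) (fun x => ?_) (fun x => ?_)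
  · rw [hker, abs_mul, abs_of_pos (by positivity : 0 < 1 / Real.pi)]
    gcongr
    refine (Complex.abs_re_le_norm _).trans ?_
    rw [norm_mul, Complex.norm_I, one_mul]
    exact norm_integral_mul_cexp_le x
  · have e0 := mul_integral_Ioi_cexp (p₀ := 0) hd0 (hint (by norm_num)) hi1
      (tendsto_powExp_nhdsGT a hb one_pos) (tendsto_powExp_atTop ha hb one_pos) x
    have e1 := mul_integral_Ioi_cexp (p₀ := 1) hd1 hi1 hi2
      (by simpa using (tendsto_powExp_zero_nhdsGT a hb).add
            ((tendsto_powExp_nhdsGT a hb hb).const_mul (a * (α + 1))))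
      (by simpa using (tendsto_powExp_zero_atTop ha hb).add
            ((tendsto_powExp_atTop ha hb hb).const_mul (a * (α + 1)))) x
    set J0 := ∫ ξ in Ioi (0 : ℝ), powExp a (α + 1) 1 ξ *
      Complex.exp (Complex.I * (x : ℂ) * (ξ : ℂ)) with hJ0
    set J1 := ∫ ξ in Ioi (0 : ℝ), p1 ξ * Complex.exp (Complex.I * (x : ℂ) * (ξ : ℂ)) with hJ1
    set J2 := ∫ ξ in Ioi (0 : ℝ), p2 ξ * Complex.exp (Complex.I * (x : ℂ) * (ξ : ℂ)) with hJ2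
    have e : ((x ^ 2 : ℝ) : ℂ) * J0 = -1 - J2 := by
      have : Complex.I * x * (Complex.I * x * J0) = Complex.I * x * (-0 - J1) := by rw [e0]
      rw [neg_zero, zero_sub, mul_neg, e1, ← mul_assoc] at this
      rw [show Complex.I * (x : ℂ) * (Complex.I * x) = -((x ^ 2 : ℝ) : ℂ) by
        push_cast; linear_combination (x : ℂ) ^ 2 * Complex.I_sq] at this
      linear_combination -this
    have e' : x ^ 2 * ‖J0‖ ≤ 1 + ∫ ξ in Ioi (0 : ℝ), ‖p2 ξ‖ := by
      have h1 : x ^ 2 * ‖J0‖ = ‖((x ^ 2 : ℝ) : ℂ) * J0‖ := by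
        rw [norm_mul, Complex.norm_real, Real.norm_of_nonneg (sq_nonneg x)]
      rw [h1, e]
      refine (norm_sub_le _ _).trans ?_
      rw [norm_neg, norm_one]
      gcongr
      exact norm_integral_mul_cexp_le x
    rw [hker, abs_mul, abs_of_pos (by positivity : 0 < 1 / Real.pi), mul_left_comm]
    refine mul_le_mul_of_nonneg_left (le_trans ?_ e') (by positivity)
    gcongr
    refine (Complex.abs_re_le_norm _).trans ?_
    rw [norm_mul, Complex.norm_I, one_mul]

/-- The Fourier transform of the fundamental solution at time one, by Fourier inversion. -/
lemma integral_kernel_one_mul_cexp (ξ : ℝ) :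
    ∫ x : ℝ, (kernel α 1 x : ℂ) * Complex.exp (Complex.I * (ξ : ℂ) * (x : ℂ)) =
      Complex.exp (symb α (-ξ)) := by
  set g : ℝ → ℂ := fun v => Complex.exp (symb α (2 * Real.pi * v)) with hg
  have h2pi : 0 < 2 * Real.pi := by positivity
  have hgc : Continuous g := by
    have := continuous_symb hα
    fun_prop
  have hgi : Integrable g := by
    have h := (integrable_exp_symb hα hα1 one_pos).comp_mul_left' h2pi.ne'
    simpa using h
  have hK : ∀ x : ℝ, FourierTransformInv.fourierInv g x = (kernel α 1 x : ℂ) := fun x => by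
    rw [Real.fourierInv_eq', ofReal_kernel hα hα1 one_pos]
    have h := Measure.integral_comp_mul_left (fun ξ : ℝ => Complex.exp ((1 : ℝ) * symb α ξ) *
      Complex.exp (Complex.I * (x : ℂ) * (ξ : ℂ))) (2 * Real.pi)
    rw [abs_of_pos (inv_pos.2 h2pi), Complex.real_smul, ← one_div] at h
    rw [← h]
    congr 1
    ext v
    simp only [hg, RCLike.inner_apply, conj_trivial, smul_eq_mul]
    rw [mul_comm]
    push_cast
    ring_nf
  have hKi : Integrable (FourierTransformInv.fourierInv g) := by
    rw [show FourierTransformInv.fourierInv g = fun x => (kernel α 1 x : ℂ) from funext hK]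
    exact (integrable_kernel_one hα hα1).ofReal
  have hFi : Integrable (FourierTransform.fourier g) := by
    rw [show FourierTransform.fourier g = fun x => FourierTransformInv.fourierInv g (-x) from
      funext fun x => (by rw [Real.fourierInv_eq_fourier_neg, neg_neg])]
    exact hKi.comp_neg
  have := congrFun (hgc.fourier_fourierInv_eq hgi hFi) (-(ξ / (2 * Real.pi)))
  rw [Real.fourier_eq', hg] at this
  simp only at this
  rw [show 2 * Real.pi * -(ξ / (2 * Real.pi)) = -ξ by field_simp] at this
  rw [← this]
  congr 1
  ext x
  rw [hK, smul_eq_mul, mul_comm]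
  congr 2
  simp only [RCLike.inner_apply, conj_trivial]
  have : (Real.pi : ℂ) ≠ 0 := Complex.ofReal_ne_zero.2 Real.pi_ne_zero
  push_cast
  field_simp

lemma integral_kernel_one : ∫ x, kernel α 1 x = 1 := by
  have h := integral_kernel_one_mul_cexp hα hα1 0
  simp only [Complex.ofReal_zero, mul_zero, zero_mul, Complex.exp_zero, mul_one, neg_zero,
    symb_zero hα] at h
  rw [integral_complex_ofReal] at h
  exact_mod_cast h

end

/-! ### Positivity of the fundamental solution -/

/-- A bounded multiplier whose product with the Gaussian `exp (-δ ξ²)` has an inverse Fourier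
transform with nonnegative real part. This replaces positive definiteness: the class contains the
constants and is stable under modulation, positive combinations, and bounded limits. -/
structure IsPosMultiplier (δ : ℝ) (F : ℝ → ℂ) : Prop where
  measurable : Measurable F
  bounded : ∃ C, ∀ ξ, ‖F ξ‖ ≤ C
  nonneg : ∀ x : ℝ, 0 ≤ (∫ ξ : ℝ, F ξ * Complex.exp (-(δ : ℂ) * (ξ : ℂ) ^ 2) *
    Complex.exp (Complex.I * (x : ℂ) * (ξ : ℂ))).re

lemma norm_mul_gaussian_mul_cexp (δ x ξ : ℝ) (z : ℂ) :
    ‖z * Complex.exp (-(δ : ℂ) * (ξ : ℂ) ^ 2) * Complex.exp (Complex.I * (x : ℂ) * (ξ : ℂ))‖ =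
      ‖z‖ * Real.exp (-δ * ξ ^ 2) := by
  rw [norm_mul, norm_mul, norm_cexp_I, mul_one,
    show -(δ : ℂ) * (ξ : ℂ) ^ 2 = ((-δ * ξ ^ 2 : ℝ) : ℂ) by push_cast; ring,
    Complex.norm_exp_ofReal]

lemma isPosMultiplier_one {δ : ℝ} (hδ : 0 < δ) : IsPosMultiplier δ (fun _ => 1) where
  measurable := measurable_const
  bounded := ⟨1, fun _ => by simp⟩
  nonneg x := by
    have h := fourierIntegral_gaussian (b := (δ : ℂ)) (by simpa using hδ) (x : ℂ)
    have h1 : ((Real.pi : ℂ) / δ) ^ (1 / 2 : ℂ) * Complex.exp (-(x : ℂ) ^ 2 / (4 * δ)) =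
        (((Real.pi / δ) ^ (1 / 2 : ℝ) * Real.exp (-x ^ 2 / (4 * δ)) : ℝ) : ℂ) := by
      push_cast
      rw [Complex.ofReal_cpow (by positivity)]
      push_cast
      rfl
    simp only [one_mul]
    simp_rw [mul_comm (Complex.exp (-(δ : ℂ) * _))]
    rw [h, h1, Complex.ofReal_re]
    positivity

namespace IsPosMultiplier

variable {δ : ℝ} {F : ℝ → ℂ}

lemma integrable (hδ : 0 < δ) (hF : IsPosMultiplier δ F) (x : ℝ) :
    Integrable fun ξ : ℝ => F ξ * Complex.exp (-(δ : ℂ) * (ξ : ℂ) ^ 2) *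
      Complex.exp (Complex.I * (x : ℂ) * (ξ : ℂ)) := by
  obtain ⟨C, hC⟩ := hF.bounded
  have := hF.measurable
  refine ((integrable_exp_neg_mul_sq hδ).const_mul C).mono'
    (by fun_prop : Measurable _).aestronglyMeasurable (ae_of_all _ fun ξ => ?_)
  rw [norm_mul_gaussian_mul_cexp]
  gcongr
  exact hC ξ

lemma modulate (hF : IsPosMultiplier δ F) (d : ℝ) :
    IsPosMultiplier δ fun ξ => Complex.exp (Complex.I * (d : ℂ) * (ξ : ℂ)) * F ξ where
  measurable := by
    have := hF.measurable
    fun_prop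
  bounded := by
    obtain ⟨C, hC⟩ := hF.bounded
    exact ⟨C, fun ξ => by rw [norm_mul, norm_cexp_I, one_mul]; exact hC ξ⟩
  nonneg x := by
    have h := hF.nonneg (d + x)
    convert h using 4 with ξ
    rw [Complex.ofReal_add, mul_add, add_mul, Complex.exp_add]
    ring

lemma const_mul (hF : IsPosMultiplier δ F) {c : ℝ} (hc : 0 ≤ c) :
    IsPosMultiplier δ fun ξ => (c : ℂ) * F ξ where
  measurable := hF.measurable.const_mul _
  bounded := by
    obtain ⟨C, hC⟩ := hF.bounded
    exact ⟨‖(c : ℂ)‖ * C, fun ξ => by rw [norm_mul]; gcongr; exact hC ξ⟩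
  nonneg x := by
    simp only [mul_assoc]
    rw [integral_const_mul, Complex.re_ofReal_mul]
    have h := hF.nonneg x
    simp only [mul_assoc] at h
    exact mul_nonneg hc h

lemma tsum (hδ : 0 < δ) {F : ℕ → ℝ → ℂ} {b : ℕ → ℝ} (hb : Summable b)
    (hFb : ∀ n ξ, ‖F n ξ‖ ≤ b n) (hF : ∀ n, IsPosMultiplier δ (F n)) :
    IsPosMultiplier δ fun ξ => ∑' n, F n ξ where
  measurable := by
    have hs : ∀ ξ, HasSum (fun n => F n ξ) (∑' n, F n ξ) := fun ξ =>
      (Summable.of_norm_bounded hb fun n => hFb n ξ).hasSum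
    refine measurable_of_tendsto_metrizable (f := fun N ξ => ∑ n ∈ Finset.range N, F n ξ)
      (fun N => Finset.measurable_fun_sum _ fun n _ => (hF n).measurable) ?_
    exact tendsto_pi_nhds.2 fun ξ => (hs ξ).tendsto_sum_nat
  bounded := ⟨∑' n, b n, fun ξ => tsum_of_norm_bounded hb.hasSum fun n => hFb n ξ⟩
  nonneg x := by
    have h := hasSum_integral_of_summable_integral_norm (μ := (volume : Measure ℝ))
      (fun n => (hF n).integrable hδ x) ?_
    · have h2 : ∀ ξ : ℝ, ∑' n, F n ξ * Complex.exp (-(δ : ℂ) * (ξ : ℂ) ^ 2) *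
          Complex.exp (Complex.I * (x : ℂ) * (ξ : ℂ)) = (∑' n, F n ξ) *
          Complex.exp (-(δ : ℂ) * (ξ : ℂ) ^ 2) *
          Complex.exp (Complex.I * (x : ℂ) * (ξ : ℂ)) := fun ξ => by
        rw [tsum_mul_right, tsum_mul_right]
      simp only [h2] at h
      exact (Complex.hasSum_re h).nonneg fun n => (hF n).nonneg x
    · refine Summable.of_nonneg_of_le (fun n => by positivity) (fun n => ?_)
        (hb.mul_right (∫ ξ : ℝ, Real.exp (-δ * ξ ^ 2)))
      rw [← integral_const_mul]
      refine integral_mono ((hF n).integrable hδ x).norm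
        ((integrable_exp_neg_mul_sq hδ).const_mul _) fun ξ => ?_
      simp only [norm_mul_gaussian_mul_cexp]
      gcongr
      exact hFb n ξ

/-- The exponential of an absolutely convergent trigonometric series with nonnegative
coefficients. -/
lemma exp_tsum (hδ : 0 < δ) {a : ℕ → ℝ} (ha : ∀ k, 0 ≤ a k) (hs : Summable a) (d : ℕ → ℝ) :
    IsPosMultiplier δ fun ξ : ℝ => Complex.exp
      (∑' k, (a k : ℂ) * Complex.exp (Complex.I * (d k : ℂ) * (ξ : ℂ))) := by
  set S : ℝ → ℂ := fun ξ => ∑' k, (a k : ℂ) * Complex.exp (Complex.I * (d k : ℂ) * (ξ : ℂ))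
    with hS
  have hterm : ∀ k (ξ : ℝ), ‖(a k : ℂ) * Complex.exp (Complex.I * (d k : ℂ) * (ξ : ℂ))‖ = a k :=
    fun k ξ => by rw [norm_mul, norm_cexp_I, Complex.norm_real, Real.norm_of_nonneg (ha k), mul_one]
  have hSb : ∀ ξ, ‖S ξ‖ ≤ ∑' k, a k := fun ξ =>
    tsum_of_norm_bounded hs.hasSum fun k => (hterm k ξ).le
  have hpow : ∀ n : ℕ, IsPosMultiplier δ fun ξ => S ξ ^ n := fun n => by
    induction n with
    | zero => simpa using isPosMultiplier_one hδ
    | succ n ih =>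
      obtain ⟨C, hC⟩ := ih.bounded
      have h := tsum hδ (F := fun k ξ => (a k : ℂ) *
        (Complex.exp (Complex.I * (d k : ℂ) * (ξ : ℂ)) * S ξ ^ n)) (hs.mul_right C)
        (fun k ξ => ?_) (fun k => (ih.modulate (d k)).const_mul (ha k))
      · convert h using 2 with ξ
        simp only [← mul_assoc]
        rw [tsum_mul_right, pow_succ, mul_comm]
      · rw [← mul_assoc, norm_mul, hterm]
        exact mul_le_mul_of_nonneg_left (hC ξ) (ha k)
  have h := tsum hδ (F := fun n ξ => (((n.factorial : ℝ)⁻¹ : ℝ) : ℂ) * S ξ ^ n)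
    (Real.summable_pow_div_factorial (∑' k, a k)) (fun n ξ => ?_)
    (fun n => (hpow n).const_mul (by positivity))
  · convert h using 2 with ξ
    change Complex.exp (S ξ) = _
    rw [Complex.exp_eq_exp_ℂ, congrFun (NormedSpace.exp_eq_tsum_div (𝔸 := ℂ)) _]
    refine tsum_congr fun n => ?_
    push_cast
    rw [div_eq_mul_inv, mul_comm]
  · rw [norm_mul, Complex.norm_real, Real.norm_of_nonneg (by positivity), norm_pow, div_eq_mul_inv,
      mul_comm]
    gcongr
    exact hSb ξ

lemma of_tendsto (hδ : 0 < δ) {F : ℕ → ℝ → ℂ} {G : ℝ → ℂ} {C : ℝ} (hFb : ∀ n ξ, ‖F n ξ‖ ≤ C)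
    (hF : ∀ n, IsPosMultiplier δ (F n))
    (hlim : ∀ᵐ ξ, Tendsto (fun n => F n ξ) atTop (𝓝 (G ξ))) (x : ℝ) :
    0 ≤ (∫ ξ : ℝ, G ξ * Complex.exp (-(δ : ℂ) * (ξ : ℂ) ^ 2) *
      Complex.exp (Complex.I * (x : ℂ) * (ξ : ℂ))).re := by
  have h := tendsto_integral_of_dominated_convergence
    (fun ξ => C * Real.exp (-δ * ξ ^ 2)) (fun n => ((hF n).integrable hδ x).aestronglyMeasurable)
    ((integrable_exp_neg_mul_sq hδ).const_mul C) (fun n => ae_of_all _ fun ξ => ?_)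
    (hlim.mono fun ξ hξ => (hξ.mul_const (Complex.exp (-(δ : ℂ) * (ξ : ℂ) ^ 2))).mul_const
      (Complex.exp (Complex.I * (x : ℂ) * (ξ : ℂ))))
  · exact ge_of_tendsto' ((Complex.continuous_re.tendsto _).comp h) fun n => (hF n).nonneg x
  · rw [norm_mul_gaussian_mul_cexp]
    gcongr
    exact hFb n ξ

end IsPosMultiplier

/-- The Grünwald–Letnikov coefficients: the Taylor coefficients of `(1 - z)^b`. -/
noncomputable def glCoeff (b : ℝ) (k : ℕ) : ℝ := (-1) ^ k * Ring.choose b k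

lemma glCoeff_zero (b : ℝ) : glCoeff b 0 = 1 := by simp [glCoeff]

lemma glCoeff_succ (b : ℝ) (k : ℕ) :
    glCoeff b (k + 1) = glCoeff b k * ((k - b) / (k + 1)) := by
  have h : Ring.choose b (k + 1) = Ring.choose b k * ((b - k) / (k + 1)) := by
    rw [Ring.choose_eq_smul, Ring.choose_eq_smul, descPochhammer_succ_right,
      Polynomial.smeval_mul, Polynomial.smeval_sub, Polynomial.smeval_X,
      Polynomial.smeval_natCast, Nat.factorial_succ]
    simp only [smul_eq_mul, pow_one, pow_zero, nsmul_eq_mul, mul_one]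
    push_cast
    field_simp
  rw [glCoeff, glCoeff, h, pow_succ]
  ring

lemma glCoeff_one (b : ℝ) : glCoeff b 1 = -b := by
  have := glCoeff_succ b 0
  simpa [glCoeff_zero] using this

/-- For `1 < b < 2` the only negative coefficient is the one of index one. -/
lemma glCoeff_nonneg {b : ℝ} (hb : 1 < b) (hb2 : b < 2) {k : ℕ} (hk : k ≠ 1) :
    0 ≤ glCoeff b k := by
  have h2 : ∀ n : ℕ, 0 ≤ glCoeff b (n + 2) := fun n => by
    induction n with
    | zero =>
      rw [glCoeff_succ, glCoeff_one]
      norm_num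
      nlinarith
    | succ n ih =>
      rw [show n + 1 + 2 = (n + 2) + 1 by ring, glCoeff_succ]
      refine mul_nonneg ih (div_nonneg ?_ (by positivity))
      push_cast
      linarith [(Nat.cast_nonneg n : (0 : ℝ) ≤ n)]
  match k with
  | 0 => simp [glCoeff_zero]
  | 1 => exact absurd rfl hk
  | n + 2 => exact h2 n

lemma hasSum_glCoeff (b : ℝ) {z : ℂ} (hz : ‖z‖ < 1) :
    HasSum (fun k => (glCoeff b k : ℂ) * z ^ k) ((1 - z) ^ (b : ℂ)) := by
  have h := (Complex.one_add_cpow_hasFPowerSeriesOnBall_zero (a := (b : ℂ))).hasSum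
    (y := -z) (by simpa [← ofReal_norm, enorm_eq_nnnorm] using hz)
  simp only [binomialSeries_apply, zero_add, List.ofFn_const,
    List.prod_replicate, smul_eq_mul] at h
  rw [← sub_eq_add_neg] at h
  have e : (fun k => (glCoeff b k : ℂ) * z ^ k) = fun k => Ring.choose (b : ℂ) k * (-z) ^ k := by
    funext k
    simp only [glCoeff]
    rw [neg_pow]
    push_cast
    ring
  rw [e]
  exact h

lemma hasSum_glCoeff_mul_pow (b : ℝ) {r : ℝ} (hr0 : 0 ≤ r) (hr : r < 1) :
    HasSum (fun k => glCoeff b k * r ^ k) ((1 - r) ^ b) := by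
  have h := hasSum_glCoeff b (z := (r : ℂ))
    (by rwa [Complex.norm_real, Real.norm_of_nonneg hr0])
  rw [← Complex.ofReal_one, ← Complex.ofReal_sub, ← Complex.ofReal_cpow (by linarith)] at h
  exact_mod_cast h

/-- The exponential of the shifted Grünwald–Letnikov symbol with mesh size `h`. The factor `r < 1`
keeps the argument inside the disc of convergence of the binomial series. -/
lemma isPosMultiplier_exp_gl {δ : ℝ} (hδ : 0 < δ) {b : ℝ} (hb : 1 < b) (hb2 : b < 2) {c : ℝ}
    (hc : 0 ≤ c) {r : ℝ} (hr0 : 0 ≤ r) (hr : r < 1) (h : ℝ) :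
    IsPosMultiplier δ (fun ξ : ℝ => Complex.exp (c * (Complex.exp (Complex.I * (h : ℂ) * (ξ : ℂ)) *
      (1 - r * Complex.exp (Complex.I * ((-h : ℝ) : ℂ) * (ξ : ℂ))) ^ (b : ℂ)))) ∧
    ∀ ξ : ℝ, ‖Complex.exp (c * (Complex.exp (Complex.I * (h : ℂ) * (ξ : ℂ)) *
      (1 - r * Complex.exp (Complex.I * ((-h : ℝ) : ℂ) * (ξ : ℂ))) ^ (b : ℂ)))‖ ≤
        Real.exp (c * (1 - r) ^ b) := by
  set a : ℕ → ℝ := fun k => if k = 1 then 0 else c * (glCoeff b k * r ^ k) with ha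
  set d : ℕ → ℝ := fun k => h - k * h with hd
  have ha0 : ∀ k, 0 ≤ a k := fun k => by
    by_cases hk : k = 1
    · simp [ha, hk]
    · simp only [ha, hk, if_false]
      have := glCoeff_nonneg hb hb2 hk
      positivity
  have hsum := (hasSum_glCoeff_mul_pow b hr0 hr).mul_left c
  -- removing the negative term of index one, whose contribution is a constant factor
  have hsa : HasSum a (c * (1 - r) ^ b + c * b * r) := by
    have h1 := hsum.add (hasSum_ite_eq (1 : ℕ) (c * b * r))
    have e : a = fun k => c * (glCoeff b k * r ^ k) + if k = 1 then c * b * r else 0 := by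
      funext k
      by_cases hk : k = 1
      · simp only [ha, hk, if_true, glCoeff_one, pow_one]
        ring
      · simp [ha, hk]
    rw [e]
    exact h1
  have key : ∀ ξ : ℝ, c * (Complex.exp (Complex.I * (h : ℂ) * (ξ : ℂ)) *
      (1 - r * Complex.exp (Complex.I * ((-h : ℝ) : ℂ) * (ξ : ℂ))) ^ (b : ℂ)) =
      ((-(c * b * r) : ℝ) : ℂ) +
        ∑' k, (a k : ℂ) * Complex.exp (Complex.I * (d k : ℂ) * (ξ : ℂ)) := fun ξ => by
    have hz : ‖(r : ℂ) * Complex.exp (Complex.I * ((-h : ℝ) : ℂ) * (ξ : ℂ))‖ < 1 := by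
      rwa [norm_mul, norm_cexp_I, mul_one, Complex.norm_real, Real.norm_of_nonneg hr0]
    have h1 := ((hasSum_glCoeff b hz).mul_left
      (Complex.exp (Complex.I * (h : ℂ) * (ξ : ℂ)))).mul_left (c : ℂ)
    have h2 := h1.add (hasSum_ite_eq (1 : ℕ) ((c * b * r : ℝ) : ℂ))
    have h3 : ∑' k, (a k : ℂ) * Complex.exp (Complex.I * (d k : ℂ) * (ξ : ℂ)) = _ :=
      Eq.trans ?_ h2.tsum_eq
    · rw [h3]
      push_cast
      ring
    · refine tsum_congr fun k => ?_
      have e : Complex.exp (Complex.I * (h : ℂ) * (ξ : ℂ)) *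
          (Complex.exp (Complex.I * ((-h : ℝ) : ℂ) * (ξ : ℂ))) ^ k =
          Complex.exp (Complex.I * (d k : ℂ) * (ξ : ℂ)) := by
        rw [← Complex.exp_nat_mul, ← Complex.exp_add, hd]
        congr 1
        push_cast
        ring
      rw [mul_pow, ← e]
      by_cases hk : k = 1
      · simp only [ha, hk, if_true, glCoeff_one, pow_one]
        rw [mul_left_comm (Complex.exp (Complex.I * (h : ℂ) * (ξ : ℂ))), mul_left_comm
          (Complex.exp (Complex.I * (h : ℂ) * (ξ : ℂ))), ← Complex.exp_add]
        simp
        ring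
      · simp only [ha, hk, if_false]
        push_cast
        ring
  constructor
  · have h1 := (IsPosMultiplier.exp_tsum hδ ha0 hsa.summable d).const_mul
      (Real.exp_pos (-(c * b * r))).le
    convert h1 using 2 with ξ
    rw [key, Complex.exp_add, Complex.ofReal_exp]
  · intro ξ
    rw [key, Complex.exp_add, norm_mul, ← Complex.ofReal_exp, Complex.norm_real,
      Real.norm_of_nonneg (Real.exp_pos _).le, show c * (1 - r) ^ b =
      -(c * b * r) + (c * (1 - r) ^ b + c * b * r) by ring, Real.exp_add]
    gcongr
    refine (Complex.norm_exp_le_exp_norm _).trans (Real.exp_le_exp.2 ?_)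
    refine tsum_of_norm_bounded hsa fun k => ?_
    rw [norm_mul, norm_cexp_I, Complex.norm_real, Real.norm_of_nonneg (ha0 k), mul_one]

lemma ofReal_mul_cpow {c : ℝ} (hc : 0 < c) {z : ℂ} (hz : z ≠ 0) (b : ℝ) :
    ((c : ℂ) * z) ^ (b : ℂ) = ((c ^ b : ℝ) : ℂ) * z ^ (b : ℂ) := by
  have hcz : (c : ℂ) * z ≠ 0 := mul_ne_zero (Complex.ofReal_ne_zero.2 hc.ne') hz
  rw [Complex.cpow_def_of_ne_zero hcz, Complex.cpow_def_of_ne_zero hz,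
    Complex.log_ofReal_mul hc hz, add_mul, Complex.exp_add, Complex.ofReal_cpow hc.le,
    Complex.cpow_def_of_ne_zero (Complex.ofReal_ne_zero.2 hc.ne'), Complex.ofReal_log hc.le]

/-- The shifted Grünwald–Letnikov symbols converge to the symbol of `∂ₓ D^α`. The damping factor
`1 - h ^ 2` tends to one fast enough not to contribute to the limit. -/
lemma tendsto_gl_symb {α ξ : ℝ} (hξ : ξ ≠ 0) :
    Tendsto (fun h : ℝ => (((h⁻¹) ^ (α + 1) : ℝ) : ℂ) *
      (Complex.exp (Complex.I * (h : ℂ) * (ξ : ℂ)) *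
      (1 - ((1 - h ^ 2 : ℝ) : ℂ) * Complex.exp (Complex.I * ((-h : ℝ) : ℂ) * (ξ : ℂ))) ^
        ((α + 1 : ℝ) : ℂ))) (𝓝[>] 0) (𝓝 (symb α ξ)) := by
  have hc1 : Continuous fun h : ℝ => Complex.exp (Complex.I * (h : ℂ) * (ξ : ℂ)) := by fun_prop
  have hc2 : Continuous fun h : ℝ =>
      (h : ℂ) * Complex.exp (Complex.I * ((-h : ℝ) : ℂ) * (ξ : ℂ)) := by fun_prop
  have hd : HasDerivAt (fun h : ℝ => Complex.exp (Complex.I * ((-h : ℝ) : ℂ) * (ξ : ℂ)))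
      (-(Complex.I * ξ)) 0 := by
    have h := (((Complex.ofRealCLM.hasDerivAt (x := (0 : ℝ))).neg.const_mul Complex.I).mul_const
      (ξ : ℂ)).cexp
    simpa using! h
  have h1 : Tendsto (fun h : ℝ => ((h⁻¹ : ℝ) : ℂ) * (1 - ((1 - h ^ 2 : ℝ) : ℂ) *
      Complex.exp (Complex.I * ((-h : ℝ) : ℂ) * (ξ : ℂ)))) (𝓝[>] 0) (𝓝 (Complex.I * ξ)) := by
    have h2 := ((hasDerivAt_iff_tendsto_slope.1 hd).mono_left
      (nhdsWithin_mono 0 fun x hx => ne_of_gt hx : 𝓝[>] (0 : ℝ) ≤ _)).neg.add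
      ((hc2.tendsto 0).mono_left (nhdsWithin_le_nhds (s := Ioi 0)))
    rw [neg_neg, Complex.ofReal_zero, zero_mul, add_zero] at h2
    refine h2.congr' ?_
    filter_upwards [self_mem_nhdsWithin] with h hh
    have hh0 : (h : ℂ) ≠ 0 := Complex.ofReal_ne_zero.2 (ne_of_gt hh)
    simp only [slope, vsub_eq_sub, sub_zero, Complex.real_smul, neg_zero, Complex.ofReal_zero,
      mul_zero, zero_mul, Complex.exp_zero]
    push_cast
    field_simp
    ring
  have hslit : Complex.I * (ξ : ℂ) ∈ Complex.slitPlane := by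
    rw [Complex.mem_slitPlane_iff]
    right
    simpa using hξ
  have h3 := ((hc1.tendsto 0).mono_left (nhdsWithin_le_nhds (s := Ioi 0))).mul
    ((continuousAt_cpow_const (b := ((α + 1 : ℝ) : ℂ)) hslit).tendsto.comp h1)
  simp only [Complex.ofReal_zero, mul_zero, zero_mul, Complex.exp_zero, one_mul] at h3
  refine h3.congr' ?_
  have hev : ∀ᶠ h : ℝ in 𝓝[>] 0, h < 1 :=
    nhdsWithin_le_nhds (Iio_mem_nhds one_pos)
  filter_upwards [self_mem_nhdsWithin, hev] with h hh hh1
  have hh : 0 < h := hh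
  have hne : 1 - ((1 - h ^ 2 : ℝ) : ℂ) *
      Complex.exp (Complex.I * ((-h : ℝ) : ℂ) * (ξ : ℂ)) ≠ 0 := by
    intro h0
    have := congrArg norm (sub_eq_zero.1 h0)
    rw [norm_mul, norm_cexp_I, Complex.norm_real, Real.norm_of_nonneg (by nlinarith), norm_one]
      at this
    nlinarith
  simp only [Function.comp_apply]
  rw [ofReal_mul_cpow (inv_pos.2 hh) hne]
  ring

/-- The fundamental solution is nonnegative: its multiplier is the limit of the positive multipliers
of `isPosMultiplier_exp_gl`, and the Gaussian factor is removed at the end. -/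
lemma kernel_one_nonneg {α : ℝ} (hα : 0 < α) (hα1 : α < 1) (x : ℝ) : 0 ≤ kernel α 1 x := by
  set h : ℕ → ℝ := fun n => 1 / ((n : ℝ) + 2) with hh
  have hpos : ∀ n, 0 < h n := fun n => by positivity
  have hlt : ∀ n, h n < 1 := fun n => by
    rw [hh, div_lt_one (by positivity)]
    linarith [(Nat.cast_nonneg n : (0 : ℝ) ≤ n)]
  have hlim : Tendsto h atTop (𝓝[>] 0) := by
    refine tendsto_nhdsWithin_iff.2 ⟨?_, Eventually.of_forall hpos⟩
    have := (tendsto_one_div_add_atTop_nhds_zero_nat (𝕜 := ℝ)).comp (tendsto_add_atTop_nat 1)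
    refine this.congr fun n => ?_
    simp only [Function.comp_apply, hh]
    push_cast
    ring
  have hgauss : ∀ δ : ℝ, 0 < δ → 0 ≤ (∫ ξ : ℝ, Complex.exp (symb α ξ) *
      Complex.exp (-(δ : ℂ) * (ξ : ℂ) ^ 2) * Complex.exp (Complex.I * (x : ℂ) * (ξ : ℂ))).re := by
    intro δ hδ
    have hF := fun n => isPosMultiplier_exp_gl hδ (b := α + 1) (by linarith) (by linarith)
      (c := (h n)⁻¹ ^ (α + 1)) (by have := hpos n; positivity) (r := 1 - h n ^ 2)
      (by nlinarith [hpos n, hlt n]) (by nlinarith [hpos n]) (h n)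
    refine IsPosMultiplier.of_tendsto hδ (C := Real.exp 1) (fun n ξ => ((hF n).2 ξ).trans ?_)
      (fun n => (hF n).1) ?_ x
    · rw [Real.exp_le_exp, sub_sub_cancel, ← Real.mul_rpow (inv_nonneg.2 (hpos n).le) (by positivity)]
      refine Real.rpow_le_one (by have := hpos n; positivity) ?_ (by linarith)
      rw [pow_two, inv_mul_cancel_left₀ (hpos n).ne']
      exact (hlt n).le
    · have : ∀ᵐ ξ : ℝ, ξ ≠ 0 := by simp [ae_iff]
      filter_upwards [this] with ξ hξ
      exact (Complex.continuous_exp.tendsto _).comp ((tendsto_gl_symb hξ).comp hlim)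
  have hlim2 := tendsto_integral_of_dominated_convergence (μ := (volume : Measure ℝ))
    (F := fun n ξ => Complex.exp (symb α ξ) * Complex.exp (-((h n : ℝ) : ℂ) * (ξ : ℂ) ^ 2) *
      Complex.exp (Complex.I * (x : ℂ) * (ξ : ℂ)))
    (f := fun ξ => Complex.exp (symb α ξ) * Complex.exp (Complex.I * (x : ℂ) * (ξ : ℂ)))
    (fun ξ => ‖Complex.exp (symb α ξ)‖)
    (fun n => (by fun_prop : Measurable _).aestronglyMeasurable)
    (by simpa using (integrable_exp_symb hα hα1 one_pos).norm)
    (fun n => ae_of_all _ fun ξ => ?_) (ae_of_all _ fun ξ => ?_)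
  · have h1 : 0 ≤ (∫ ξ : ℝ, Complex.exp (symb α ξ) *
        Complex.exp (Complex.I * (x : ℂ) * (ξ : ℂ))).re :=
      ge_of_tendsto' ((Complex.continuous_re.tendsto _).comp hlim2) fun n => hgauss _ (hpos n)
    have h2 := congrArg Complex.re (ofReal_kernel hα hα1 one_pos x)
    rw [Complex.re_ofReal_mul, Complex.ofReal_re] at h2
    rw [h2]
    simp only [Complex.ofReal_one, one_mul]
    positivity
  · rw [norm_mul_gaussian_mul_cexp]
    refine mul_le_of_le_one_right (norm_nonneg _) (Real.exp_le_one_iff.2 ?_)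
    have := hpos n
    nlinarith [mul_nonneg this.le (sq_nonneg ξ)]
  · have hc : Continuous fun s : ℝ => Complex.exp (symb α ξ) *
        Complex.exp (-(s : ℂ) * (ξ : ℂ) ^ 2) * Complex.exp (Complex.I * (x : ℂ) * (ξ : ℂ)) := by
      fun_prop
    have h1 := (hc.tendsto 0).comp (hlim.mono_right nhdsWithin_le_nhds)
    simpa using! h1

/-! ### The stable semigroup -/

/-- The probability measure with density `kernel α 1`. -/
noncomputable def stableOne (α : ℝ) : Measure ℝ :=
  volume.withDensity fun x => ENNReal.ofReal (kernel α 1 x)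

/-- The stable law at time `t ≥ 0`: it has density `kernel α t` for `t > 0`, and it is the Dirac
mass at the origin for `t = 0`. Defining it by dilation makes the dependence on `t` explicit. -/
noncomputable def stable (α t : ℝ) : Measure ℝ :=
  (stableOne α).map fun x => t ^ (1 / (α + 1)) * x

/-- The stable semigroup, acting on bounded measurable functions. -/
noncomputable def semi (α t : ℝ) (g : ℝ → ℝ) (x : ℝ) : ℝ := ∫ y, g (x - y) ∂(stable α t)

section

variable {α : ℝ} (hα : 0 < α) (hα1 : α < 1)
include hα hα1

lemma measurable_kernel_one : Measurable (kernel α 1) :=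
  (continuous_kernel_one hα hα1).measurable

lemma isProbabilityMeasure_stableOne : IsProbabilityMeasure (stableOne α) := by
  refine ⟨?_⟩
  rw [stableOne, withDensity_apply _ MeasurableSet.univ, Measure.restrict_univ,
    ← ofReal_integral_eq_lintegral_ofReal (integrable_kernel_one hα hα1)
      (ae_of_all _ (kernel_one_nonneg hα hα1)), integral_kernel_one hα hα1, ENNReal.ofReal_one]

lemma isProbabilityMeasure_stable (t : ℝ) : IsProbabilityMeasure (stable α t) := by
  have := isProbabilityMeasure_stableOne hα hα1
  exact Measure.isProbabilityMeasure_map (by fun_prop)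

lemma integral_stableOne {E : Type*} [NormedAddCommGroup E] [NormedSpace ℝ E] (g : ℝ → E) :
    ∫ z, g z ∂(stableOne α) = ∫ z, kernel α 1 z • g z := by
  rw [stableOne, integral_withDensity_eq_integral_toReal_smul
    (measurable_kernel_one hα hα1).ennreal_ofReal (ae_of_all _ fun _ => ENNReal.ofReal_lt_top)]
  simp only [ENNReal.toReal_ofReal (kernel_one_nonneg hα hα1 _)]

lemma charFun_stable {t : ℝ} (ht : 0 ≤ t) (ξ : ℝ) :
    charFun (stable α t) ξ = Complex.exp (t * symb α (-ξ)) := by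
  rw [stable, charFun_map_mul, charFun_apply_real, integral_stableOne hα hα1]
  have h := integral_kernel_one_mul_cexp hα hα1 (t ^ (1 / (α + 1)) * ξ)
  simp only [Complex.real_smul]
  rw [show -(t ^ (1 / (α + 1)) * ξ) = t ^ (1 / (α + 1)) * (-ξ) by ring] at h
  have e : symb α (t ^ (1 / (α + 1)) * (-ξ)) = t * symb α (-ξ) := by
    have hb : α + 1 ≠ 0 := by linarith
    rcases ht.eq_or_lt with rfl | ht
    · rw [Real.zero_rpow (one_div_ne_zero hb)]
      simp [symb_zero hα]
    · rw [symb_mul (Real.rpow_pos_of_pos ht _), ← Real.rpow_mul ht.le, one_div,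
        inv_mul_cancel₀ hb, Real.rpow_one]
  rw [← e, ← h]
  congr 1
  ext z
  congr 2
  ring

lemma stable_conv {s t : ℝ} (hs : 0 ≤ s) (ht : 0 ≤ t) :
    Measure.conv (stable α s) (stable α t) = stable α (s + t) := by
  have := isProbabilityMeasure_stable hα hα1 s
  have := isProbabilityMeasure_stable hα hα1 t
  have := isProbabilityMeasure_stable hα hα1 (s + t)
  refine Measure.ext_of_charFun (funext fun ξ => ?_)
  rw [charFun_conv, charFun_stable hα hα1 hs, charFun_stable hα hα1 ht,
    charFun_stable hα hα1 (add_nonneg hs ht), ← Complex.exp_add]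
  push_cast
  ring_nf

omit hα hα1 in
lemma semi_eq_integral_stableOne {g : ℝ → ℝ} (hg : Measurable g) (t x : ℝ) :
    semi α t g x = ∫ z, g (x - t ^ (1 / (α + 1)) * z) ∂(stableOne α) := by
  rw [semi, stable, integral_map (by fun_prop)
    (by fun_prop : Measurable fun y => g (x - y)).aestronglyMeasurable]

lemma semi_zero {g : ℝ → ℝ} (hg : Measurable g) (x : ℝ) : semi α 0 g x = g x := by
  have := isProbabilityMeasure_stableOne hα hα1
  rw [semi_eq_integral_stableOne hg, Real.zero_rpow (one_div_ne_zero (by linarith))]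
  simp

lemma integrable_semi {g : ℝ → ℝ} (hg : Measurable g) {C : ℝ} (hC : ∀ x, |g x| ≤ C) (t x : ℝ) :
    Integrable (fun y => g (x - y)) (stable α t) := by
  have := isProbabilityMeasure_stable hα hα1 t
  exact Integrable.of_bound (by fun_prop : Measurable fun y => g (x - y)).aestronglyMeasurable C
    (ae_of_all _ fun y => hC _)

lemma abs_semi_le {g : ℝ → ℝ} {C : ℝ} (hC : ∀ x, |g x| ≤ C) (t x : ℝ) :
    |semi α t g x| ≤ C := by
  have := isProbabilityMeasure_stable hα hα1 t
  have h := norm_integral_le_of_norm_le_const (μ := stable α t) (f := fun y => g (x - y))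
    (ae_of_all _ fun y => hC (x - y))
  simpa [semi] using h

lemma semi_mono {f g : ℝ → ℝ} (hf : Measurable f) (hg : Measurable g) {C D : ℝ}
    (hC : ∀ x, |f x| ≤ C) (hD : ∀ x, |g x| ≤ D) (h : ∀ x, f x ≤ g x) (t x : ℝ) :
    semi α t f x ≤ semi α t g x :=
  integral_mono (integrable_semi hα hα1 hf hC t x) (integrable_semi hα hα1 hg hD t x)
    fun y => h (x - y)

lemma semi_const (c t x : ℝ) : semi α t (fun _ => c) x = c := by
  have := isProbabilityMeasure_stable hα hα1 t
  simp [semi]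

lemma semi_sub {f g : ℝ → ℝ} (hf : Measurable f) (hg : Measurable g) {C D : ℝ}
    (hC : ∀ x, |f x| ≤ C) (hD : ∀ x, |g x| ≤ D) (t x : ℝ) :
    semi α t (fun y => f y - g y) x = semi α t f x - semi α t g x :=
  integral_sub (integrable_semi hα hα1 hf hC t x) (integrable_semi hα hα1 hg hD t x)

lemma semi_add {f g : ℝ → ℝ} (hf : Measurable f) (hg : Measurable g) {C D : ℝ}
    (hC : ∀ x, |f x| ≤ C) (hD : ∀ x, |g x| ≤ D) (t x : ℝ) :
    semi α t (fun y => f y + g y) x = semi α t f x + semi α t g x :=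
  integral_add (integrable_semi hα hα1 hf hC t x) (integrable_semi hα hα1 hg hD t x)

omit hα hα1 in
lemma semi_const_mul (c : ℝ) (g : ℝ → ℝ) (t x : ℝ) :
    semi α t (fun y => c * g y) x = c * semi α t g x :=
  integral_const_mul _ _

omit hα hα1 in
lemma semi_translate (g : ℝ → ℝ) (a t x : ℝ) :
    semi α t (fun y => g (y + a)) x = semi α t g (x + a) := by
  simp only [semi, sub_add_eq_add_sub]

lemma semi_semi {g : ℝ → ℝ} (hg : Measurable g) {C : ℝ} (hC : ∀ x, |g x| ≤ C) {s t : ℝ}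
    (hs : 0 ≤ s) (ht : 0 ≤ t) (x : ℝ) :
    semi α s (semi α t g) x = semi α (s + t) g x := by
  have := isProbabilityMeasure_stable hα hα1 s
  have := isProbabilityMeasure_stable hα hα1 t
  simp only [semi]
  rw [← stable_conv hα hα1 hs ht, integral_conv]
  · simp only [sub_sub]
  · rw [stable_conv hα hα1 hs ht]
    exact integrable_semi hα hα1 hg hC _ _

/-- Joint measurability of the semigroup in time and space. -/
lemma measurable_semi {F : ℝ → ℝ → ℝ} (hF : Measurable (Function.uncurry F)) {τ : ℝ → ℝ}
    (hτ : Measurable τ) :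
    Measurable (Function.uncurry fun s x => semi α (τ s) (F s) x) := by
  have := isProbabilityMeasure_stableOne hα hα1
  have e : (Function.uncurry fun s x => semi α (τ s) (F s) x) = fun p : ℝ × ℝ =>
      ∫ z, F p.1 (p.2 - τ p.1 ^ (1 / (α + 1)) * z) ∂(stableOne α) := by
    ext p
    exact semi_eq_integral_stableOne (hF.comp (by fun_prop : Measurable fun y => (p.1, y))) _ _
  rw [e]
  have hm : Measurable fun q : (ℝ × ℝ) × ℝ =>
      F q.1.1 (q.1.2 - τ q.1.1 ^ (1 / (α + 1)) * q.2) :=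
    hF.comp (by fun_prop : Measurable fun q : (ℝ × ℝ) × ℝ =>
      (q.1.1, q.1.2 - τ q.1.1 ^ (1 / (α + 1)) * q.2))
  exact (StronglyMeasurable.integral_prod_right' hm.stronglyMeasurable).measurable

lemma measurable_semi_apply {g : ℝ → ℝ} (hg : Measurable g) (t : ℝ) :
    Measurable (semi α t g) := by
  have h := measurable_semi hα hα1 (F := fun _ => g) (τ := fun _ => t)
    (by exact hg.comp measurable_snd) measurable_const
  exact h.comp (by fun_prop : Measurable fun x : ℝ => ((0 : ℝ), x))

lemma continuous_semi {g : ℝ → ℝ} (hg : Continuous g) {C : ℝ} (hC : ∀ x, |g x| ≤ C) (t : ℝ) :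
    Continuous (semi α t g) := by
  have := isProbabilityMeasure_stable hα hα1 t
  exact continuous_of_dominated (bound := fun _ => C)
    (fun x => (by fun_prop : Continuous fun y => g (x - y)).aestronglyMeasurable)
    (fun x => ae_of_all _ fun y => hC _) (integrable_const C) (ae_of_all _ fun y => by fun_prop)

/-- For small times the semigroup only sees the values near the base point. -/
lemma exists_abs_semi_le_of_near {δ η : ℝ} (hδ : 0 < δ) (hη : 0 < η) :
    ∃ h₀ > 0, ∀ h, 0 ≤ h → h ≤ h₀ → ∀ (g : ℝ → ℝ) (C ε x : ℝ), Measurable g → 0 ≤ ε →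
      (∀ y, |g y| ≤ C) → (∀ y, |y| < δ → |g (x - y)| ≤ ε) → |semi α h g x| ≤ ε + C * η := by
  have := isProbabilityMeasure_stableOne hα hα1
  have htight := tendsto_measure_compl_closedBall_of_isTightMeasureSet
    (isTightMeasureSet_singleton (μ := stableOne α)) 0
  simp only [mem_singleton_iff, iSup_iSup_eq_left] at htight
  obtain ⟨N, hN, hN0⟩ := (((tendsto_order.1 htight).2 (ENNReal.ofReal η)
    (ENNReal.ofReal_pos.2 hη)).and (eventually_gt_atTop 0)).exists
  have hb : 0 < α + 1 := by linarith
  refine ⟨(δ / (2 * N)) ^ (α + 1), by positivity, fun h hh0 hh g C ε x hg hε hC hloc => ?_⟩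
  have hC0 : 0 ≤ C := (abs_nonneg _).trans (hC 0)
  have hhp : h ^ (1 / (α + 1)) ≤ δ / (2 * N) := by
    have := Real.rpow_le_rpow hh0 hh (by positivity : 0 ≤ 1 / (α + 1))
    rwa [← Real.rpow_mul (by positivity), mul_one_div_cancel hb.ne', Real.rpow_one] at this
  have hh1 : 0 ≤ h ^ (1 / (α + 1)) := Real.rpow_nonneg hh0 _
  rw [semi_eq_integral_stableOne hg]
  have hmeas : MeasurableSet (Metric.closedBall (0 : ℝ) N)ᶜ := measurableSet_closedBall.compl
  have hbound : ∀ z, ‖g (x - h ^ (1 / (α + 1)) * z)‖ ≤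
      ε + (Metric.closedBall (0 : ℝ) N)ᶜ.indicator (fun _ => C) z := fun z => by
    by_cases hz : z ∈ (Metric.closedBall (0 : ℝ) N)ᶜ
    · rw [indicator_of_mem hz]
      exact (hC _).trans (by linarith)
    · rw [indicator_of_notMem hz, add_zero]
      refine hloc _ ?_
      simp only [mem_compl_iff, not_not, mem_closedBall_zero_iff, Real.norm_eq_abs] at hz
      rw [abs_mul, abs_of_nonneg hh1]
      calc h ^ (1 / (α + 1)) * |z| ≤ δ / (2 * N) * N := by gcongr
        _ = δ / 2 := by field_simp
        _ < δ := by linarith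
  have hi : Integrable ((Metric.closedBall (0 : ℝ) N)ᶜ.indicator fun _ => C) (stableOne α) :=
    (integrable_const C).indicator hmeas
  refine (norm_integral_le_of_norm_le ((integrable_const ε).add hi)
    (ae_of_all _ hbound)).trans ?_
  simp only [Pi.add_apply]
  rw [integral_add (integrable_const ε) hi, integral_const, integral_indicator_const _ hmeas,
    probReal_univ, one_smul, smul_eq_mul, mul_comm]
  gcongr
  exact ENNReal.toReal_le_of_le_ofReal hη.le hN.le

lemma semi_eq_integral_kernel {t : ℝ} (ht : 0 < t) {g : ℝ → ℝ} (hg : Measurable g) (x : ℝ) :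
    semi α t g x = ∫ y, kernel α t (x - y) * g y := by
  have hc : 0 < t ^ (-(1 / (α + 1))) := Real.rpow_pos_of_pos ht _
  rw [semi_eq_integral_stableOne hg, integral_stableOne hα hα1]
  have h1 := integral_sub_left_eq_self (fun y => kernel α t y * g (x - y)) volume x
  simp only [sub_sub_cancel] at h1
  rw [h1]
  have h2 := Measure.integral_comp_mul_left
    (fun z => kernel α 1 z * g (x - t ^ (1 / (α + 1)) * z)) (t ^ (-(1 / (α + 1))))
  rw [abs_of_pos (inv_pos.2 hc), smul_eq_mul] at h2
  have h3 : ∫ z, kernel α 1 z * g (x - t ^ (1 / (α + 1)) * z) = t ^ (-(1 / (α + 1))) *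
      ∫ y, kernel α 1 (t ^ (-(1 / (α + 1))) * y) *
        g (x - t ^ (1 / (α + 1)) * (t ^ (-(1 / (α + 1))) * y)) := by
    rw [h2, mul_inv_cancel_left₀ hc.ne']
  simp only [smul_eq_mul]
  rw [h3, ← integral_const_mul]
  congr 1
  ext y
  rw [kernel_scaling hα hα1 ht, ← mul_assoc (t ^ (1 / (α + 1))), ← Real.rpow_add ht,
    add_neg_cancel, Real.rpow_zero, one_mul, mul_assoc]

lemma hasDerivAt_kernel {t : ℝ} (ht : 0 < t) (x : ℝ) :
    HasDerivAt (kernel α t) (t ^ (-(1 / (α + 1))) * (t ^ (-(1 / (α + 1))) *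
      deriv (kernel α 1) (t ^ (-(1 / (α + 1))) * x))) x := by
  set c := t ^ (-(1 / (α + 1)))
  have h1 : HasDerivAt (fun y => c * y) c x := by simpa using (hasDerivAt_id x).const_mul c
  have h2 := ((hasDerivAt_kernel_one hα hα1 (c * x)).differentiableAt.hasDerivAt.comp x
    h1).const_mul c
  refine (h2.congr_of_eventuallyEq (Eventually.of_forall fun y => ?_)).congr_deriv (by ring)
  exact kernel_scaling hα hα1 ht y

lemma deriv_kernel {t : ℝ} (ht : 0 < t) (x : ℝ) :
    deriv (kernel α t) x = t ^ (-(1 / (α + 1))) * (t ^ (-(1 / (α + 1))) *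
      deriv (kernel α 1) (t ^ (-(1 / (α + 1))) * x)) :=
  (hasDerivAt_kernel hα hα1 ht x).deriv

lemma integrable_kernel {t : ℝ} (ht : 0 < t) : Integrable (kernel α t) := by
  have hc : 0 < t ^ (-(1 / (α + 1))) := Real.rpow_pos_of_pos ht _
  rw [show kernel α t = fun x => _ from funext (kernel_scaling hα hα1 ht)]
  exact ((integrable_kernel_one hα hα1).comp_mul_left' hc.ne').const_mul _

lemma integrable_deriv_kernel {t : ℝ} (ht : 0 < t) : Integrable (deriv (kernel α t)) := by
  have hc : 0 < t ^ (-(1 / (α + 1))) := Real.rpow_pos_of_pos ht _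
  rw [show deriv (kernel α t) = fun x => _ from funext (deriv_kernel hα hα1 ht)]
  exact (((integrable_deriv_kernel_one hα hα1).comp_mul_left' hc.ne').const_mul _).const_mul _

lemma integral_abs_deriv_kernel {t : ℝ} (ht : 0 < t) :
    ∫ x, |deriv (kernel α t) x| = t ^ (-(1 / (α + 1))) * ∫ x, |deriv (kernel α 1) x| := by
  have hc : 0 < t ^ (-(1 / (α + 1))) := Real.rpow_pos_of_pos ht _
  simp only [deriv_kernel hα hα1 ht, abs_mul, abs_of_pos hc]
  rw [integral_const_mul, integral_const_mul,
    Measure.integral_comp_mul_left (fun z => |deriv (kernel α 1) z|), abs_of_pos (inv_pos.2 hc),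
    smul_eq_mul, mul_inv_cancel_left₀ hc.ne']

end

/-- Convolution with the spatial derivative of the fundamental solution. -/
noncomputable def dsemi (α t : ℝ) (g : ℝ → ℝ) (x : ℝ) : ℝ :=
  ∫ y, deriv (kernel α t) (x - y) * g y

section

variable {α : ℝ} (hα : 0 < α) (hα1 : α < 1)
include hα hα1

lemma integrable_deriv_kernel_mul {t : ℝ} (ht : 0 < t) {g : ℝ → ℝ} (hg : Measurable g) {C : ℝ}
    (hC : ∀ x, |g x| ≤ C) (x : ℝ) : Integrable fun y => deriv (kernel α t) (x - y) * g y :=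
  ((integrable_deriv_kernel hα hα1 ht).comp_sub_left x).mul_bdd (c := C) hg.aestronglyMeasurable
    (ae_of_all _ hC)

lemma integral_abs_deriv_kernel_mul_le {t : ℝ} (ht : 0 < t) {g : ℝ → ℝ} (hg : Measurable g)
    {C : ℝ} (hC : ∀ x, |g x| ≤ C) (x : ℝ) :
    ∫ y, |deriv (kernel α t) (x - y) * g y| ≤
      C * (∫ x, |deriv (kernel α 1) x|) * t ^ (-(1 / (α + 1))) := by
  have h1 := (integrable_deriv_kernel hα hα1 ht).comp_sub_left x
  calc ∫ y, |deriv (kernel α t) (x - y) * g y| ≤ ∫ y, C * |deriv (kernel α t) (x - y)| := by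
        refine integral_mono (integrable_deriv_kernel_mul hα hα1 ht hg hC x).abs
          (h1.abs.const_mul C) fun y => ?_
        simp only [abs_mul]
        rw [mul_comm]
        gcongr
        exact hC y
    _ = _ := by
        rw [integral_const_mul, integral_sub_left_eq_self (fun y => |deriv (kernel α t) y|),
          integral_abs_deriv_kernel hα hα1 ht]
        ring

lemma abs_dsemi_le {t : ℝ} (ht : 0 < t) {g : ℝ → ℝ} (hg : Measurable g) {C : ℝ}
    (hC : ∀ x, |g x| ≤ C) (x : ℝ) :
    |dsemi α t g x| ≤ C * (∫ x, |deriv (kernel α 1) x|) * t ^ (-(1 / (α + 1))) := by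
  rw [dsemi]
  exact (abs_integral_le_integral_abs).trans (integral_abs_deriv_kernel_mul_le hα hα1 ht hg hC x)

lemma semi_sub_semi_eq_integral_dsemi {t : ℝ} (ht : 0 < t) {g : ℝ → ℝ} (hg : Measurable g)
    {C : ℝ} (hC : ∀ x, |g x| ≤ C) (a b : ℝ) :
    semi α t g b - semi α t g a = ∫ x in a..b, dsemi α t g x := by
  have hint : Integrable (Function.uncurry fun x y => deriv (kernel α t) (x - y) * g y)
      ((volume.restrict (uIoc a b)).prod volume) := by
    have hm : Measurable (Function.uncurry fun x y => deriv (kernel α t) (x - y) * g y) :=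
      ((measurable_deriv (kernel α t)).comp (measurable_fst.sub measurable_snd)).mul
        (hg.comp measurable_snd)
    have : IsFiniteMeasure (volume.restrict (uIoc a b)) := ⟨by simp [uIoc]⟩
    rw [integrable_prod_iff hm.aestronglyMeasurable]
    refine ⟨ae_of_all _ fun x => integrable_deriv_kernel_mul hα hα1 ht hg hC x, ?_⟩
    refine Integrable.of_bound hm.stronglyMeasurable.norm.integral_prod_right'.aestronglyMeasurable
      (C * (∫ x, |deriv (kernel α 1) x|) * t ^ (-(1 / (α + 1)))) (ae_of_all _ fun x => ?_)
    refine (Real.norm_of_nonneg (integral_nonneg fun y => norm_nonneg _)).trans_le ?_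
    exact integral_abs_deriv_kernel_mul_le hα hα1 ht hg hC x
  have hK : ∀ x, Integrable fun y => kernel α t (x - y) * g y := fun x =>
    ((integrable_kernel hα hα1 ht).comp_sub_left x).mul_bdd (c := C) hg.aestronglyMeasurable
      (ae_of_all _ hC)
  simp only [dsemi]
  rw [intervalIntegral_integral_swap hint, semi_eq_integral_kernel hα hα1 ht hg,
    semi_eq_integral_kernel hα hα1 ht hg, ← integral_sub (hK b) (hK a)]
  congr 1
  ext y
  rw [intervalIntegral.integral_mul_const, ← sub_mul]
  congr 1
  have hd : ∀ x ∈ uIcc a b, HasDerivAt (fun x => kernel α t (x - y))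
      (deriv (kernel α t) (x - y)) x := fun x _ => by
    have h := (hasDerivAt_kernel hα hα1 ht (x - y)).differentiableAt.hasDerivAt
    exact h.comp_sub_const x y
  exact (intervalIntegral.integral_eq_sub_of_hasDerivAt hd
    ((integrable_deriv_kernel hα hα1 ht).comp_sub_right y).intervalIntegrable).symm

lemma abs_semi_sub_semi_le {t : ℝ} (ht : 0 < t) {g : ℝ → ℝ} (hg : Measurable g) {C : ℝ}
    (hC : ∀ x, |g x| ≤ C) (a b : ℝ) :
    |semi α t g b - semi α t g a| ≤
      C * (∫ x, |deriv (kernel α 1) x|) * t ^ (-(1 / (α + 1))) * |b - a| := by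
  rw [semi_sub_semi_eq_integral_dsemi hα hα1 ht hg hC]
  rw [← Real.norm_eq_abs]
  exact intervalIntegral.norm_integral_le_of_norm_le_const fun x _ =>
    (Real.norm_eq_abs _).trans_le (abs_dsemi_le hα hα1 ht hg hC x)

end

/-! ### The semigroup acting on smooth steps -/

lemma norm_cexp_sub_one_le_of_re_nonpos {z : ℂ} (hz : z.re ≤ 0) : ‖Complex.exp z - 1‖ ≤ ‖z‖ := by
  have h := (convex_halfSpace_re_le 0).norm_image_sub_le_of_norm_hasDerivWithin_le
    (f := Complex.exp) (f' := Complex.exp) (C := 1) (x := 0) (y := z)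
    (fun w _ => (Complex.hasDerivAt_exp w).hasDerivWithinAt)
    (fun w hw => by rw [Complex.norm_exp]; exact Real.exp_le_one_iff.2 hw) (by simp)
    (by simpa using hz)
  simpa using h

/-- Comparison of the semigroup with the identity through the Fourier transform. -/
lemma abs_semi_sub_le_integral_fourier {α : ℝ} (hα : 0 < α) (hα1 : α < 1) {h : ℝ} (hh : 0 ≤ h)
    {g : ℝ → ℝ} {S : SchwartzMap ℝ ℂ} (hS : ∀ x, S x = (g x : ℂ)) {w : ℝ → ℝ}
    (hw : Integrable w)
    (hSw : ∀ v : ℝ, ‖FourierTransform.fourier (S : ℝ → ℂ) v‖ * (2 * Real.pi * |v|) ^ (α + 1) ≤ w v)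
    (x : ℝ) :
    |semi α h g x - g x| ≤ h * ∫ v, w v := by
  have := isProbabilityMeasure_stable hα hα1 h
  set G : ℝ → ℂ := FourierTransform.fourier (S : ℝ → ℂ) with hG
  have hGi : Integrable G := (FourierTransform.fourier S).integrable
  have hinv : ∀ y : ℝ, (g y : ℂ) =
      ∫ v : ℝ, Complex.exp (Complex.I * (y : ℂ) * ((2 * Real.pi * v : ℝ) : ℂ)) * G v := fun y => by
    have h1 := congrFun (S.continuous.fourierInv_fourier_eq S.integrable hGi) y
    rw [← hS, ← h1, Real.fourierInv_eq']
    congr 1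
    ext v
    simp only [RCLike.inner_apply, conj_trivial, smul_eq_mul, hG]
    push_cast
    ring_nf
  have hcont : Continuous G := (FourierTransform.fourier S).continuous
  have hint : Integrable (Function.uncurry fun y v : ℝ =>
      Complex.exp (Complex.I * ((x - y : ℝ) : ℂ) * ((2 * Real.pi * v : ℝ) : ℂ)) * G v)
      ((stable α h).prod volume) := by
    have h1 : Integrable (fun p : ℝ × ℝ => G p.2) ((stable α h).prod volume) := hGi.comp_snd _
    refine h1.mono (by fun_prop : Continuous _).aestronglyMeasurable (ae_of_all _ fun p => ?_)
    simp only [Function.uncurry]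
    rw [norm_mul, norm_cexp_I, one_mul]
  have hsemi : (semi α h g x : ℂ) = ∫ v : ℝ, Complex.exp (h * symb α (2 * Real.pi * v)) *
      (Complex.exp (Complex.I * (x : ℂ) * ((2 * Real.pi * v : ℝ) : ℂ)) * G v) := by
    rw [semi, ← integral_complex_ofReal]
    simp only [hinv]
    rw [integral_integral_swap hint]
    congr 1
    ext v
    have h2 := charFun_stable hα hα1 hh (-(2 * Real.pi * v))
    rw [charFun_apply_real, neg_neg] at h2
    rw [← h2, ← integral_mul_const]
    congr 1
    ext y
    rw [← mul_assoc, ← Complex.exp_add]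
    congr 2
    push_cast
    ring
  have hGi' : Integrable fun v : ℝ =>
      Complex.exp (Complex.I * (x : ℂ) * ((2 * Real.pi * v : ℝ) : ℂ)) * G v :=
    hGi.mono (by fun_prop : Continuous _).aestronglyMeasurable
      (ae_of_all _ fun v => by rw [norm_mul, norm_cexp_I, one_mul])
  have hsc := continuous_symb hα
  have hGi'' : Integrable fun v : ℝ => Complex.exp (h * symb α (2 * Real.pi * v)) *
      (Complex.exp (Complex.I * (x : ℂ) * ((2 * Real.pi * v : ℝ) : ℂ)) * G v) :=
    hGi'.mono (by fun_prop : Continuous _).aestronglyMeasurable (ae_of_all _ fun v => by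
      rw [norm_mul]
      exact mul_le_of_le_one_left (norm_nonneg _) (norm_exp_symb_le_one hα hα1 hh _))
  have hdiff : ((semi α h g x - g x : ℝ) : ℂ) = ∫ v : ℝ,
      (Complex.exp (h * symb α (2 * Real.pi * v)) - 1) *
      (Complex.exp (Complex.I * (x : ℂ) * ((2 * Real.pi * v : ℝ) : ℂ)) * G v) := by
    rw [Complex.ofReal_sub, hsemi, hinv x, ← integral_sub hGi'' hGi']
    simp only [sub_mul, one_mul]
  rw [← Real.norm_eq_abs, ← Complex.norm_real, hdiff, ← integral_const_mul]
  refine norm_integral_le_of_norm_le (hw.const_mul h) (ae_of_all _ fun v => ?_)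
  rw [norm_mul, norm_mul, norm_cexp_I, one_mul]
  have h3 : ‖Complex.exp (h * symb α (2 * Real.pi * v)) - 1‖ ≤
      h * (2 * Real.pi * |v|) ^ (α + 1) := by
    refine (norm_cexp_sub_one_le_of_re_nonpos ?_).trans (le_of_eq ?_)
    · rw [Complex.re_ofReal_mul]
      exact mul_nonpos_of_nonneg_of_nonpos hh (symb_re_nonpos hα hα1 _)
    · rw [norm_mul, norm_symb, Complex.norm_real, Real.norm_of_nonneg hh, abs_mul,
        abs_of_pos (by positivity : 0 < 2 * Real.pi)]
  calc _ ≤ h * (2 * Real.pi * |v|) ^ (α + 1) * ‖G v‖ := by gcongr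
    _ = h * (‖G v‖ * (2 * Real.pi * |v|) ^ (α + 1)) := by ring
    _ ≤ h * w v := by gcongr; exact hSw v

lemma deriv_smoothTransition_eq_zero {x : ℝ} (hx : x ∉ Icc (0 : ℝ) 1) :
    deriv Real.smoothTransition x = 0 := by
  rw [mem_Icc, not_and_or, not_le, not_le] at hx
  have : Real.smoothTransition =ᶠ[𝓝 x] fun _ => Real.smoothTransition x := by
    rcases hx with hx | hx
    · filter_upwards [Iio_mem_nhds hx] with y hy
      rw [Real.smoothTransition.zero_of_nonpos (le_of_lt hy),
        Real.smoothTransition.zero_of_nonpos hx.le]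
    · filter_upwards [Ioi_mem_nhds hx] with y hy
      rw [Real.smoothTransition.one_of_one_le (le_of_lt hy),
        Real.smoothTransition.one_of_one_le hx.le]
  rw [this.deriv_eq, deriv_const]

lemma contDiff_deriv_smoothTransition : ContDiff ℝ (⊤ : ℕ∞) (deriv Real.smoothTransition) :=
  ((contDiff_infty_iff_deriv (𝕜 := ℝ)).1 Real.smoothTransition.contDiff).2

lemma hasDerivAt_smoothTransition (x : ℝ) :
    HasDerivAt Real.smoothTransition (deriv Real.smoothTransition x) x :=
  ((Real.smoothTransition.contDiff (n := 1)).differentiable (by norm_num) x).hasDerivAt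

lemma deriv_smoothTransition_nonneg (x : ℝ) : 0 ≤ deriv Real.smoothTransition x :=
  Real.smoothTransition.monotone.deriv_nonneg

/-- The derivative of `Real.smoothTransition` as a complex-valued Schwartz function. -/
noncomputable def stepDeriv : SchwartzMap ℝ ℂ :=
  HasCompactSupport.toSchwartzMap (f := fun x => ((deriv Real.smoothTransition x : ℝ) : ℂ))
    (HasCompactSupport.intro isCompact_Icc fun x hx => by
      rw [deriv_smoothTransition_eq_zero hx, Complex.ofReal_zero])
    (Complex.ofRealCLM.contDiff.comp contDiff_deriv_smoothTransition)

/-- The constant in the bound of `T_h σ - σ` for the smooth step `σ`; it serves for all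
`0 < α < 1`. -/
noncomputable def stepConst : ℝ :=
  ∫ v : ℝ, 2 * (‖FourierTransform.fourier stepDeriv v‖ * (1 + 2 * Real.pi * |v|))

lemma stepConst_nonneg : 0 ≤ stepConst := integral_nonneg fun v => by positivity

lemma abs_smoothTransition_le (x : ℝ) : |Real.smoothTransition x| ≤ 1 := by
  rw [abs_of_nonneg (Real.smoothTransition.nonneg x)]
  exact Real.smoothTransition.le_one x

lemma abs_semi_smoothTransition_sub_le {α : ℝ} (hα : 0 < α) (hα1 : α < 1) {h : ℝ} (hh : 0 ≤ h)
    (x : ℝ) :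
    |semi α h Real.smoothTransition x - Real.smoothTransition x| ≤ h * stepConst := by
  have := isProbabilityMeasure_stable hα hα1 h
  -- the step is the limit of plateaus of growing length
  set p : ℕ → ℝ → ℝ := fun N y => Real.smoothTransition (y + N) - Real.smoothTransition y with hp
  have hsm : Measurable Real.smoothTransition := Real.smoothTransition.continuous.measurable
  have hplateau : ∀ N : ℕ, |semi α h (p N) x - p N x| ≤ h * stepConst := by
    intro N
    have hsupp : HasCompactSupport fun y => ((p N y : ℝ) : ℂ) := by
      refine HasCompactSupport.intro (isCompact_Icc (a := (-N : ℝ)) (b := 1)) fun y hy => ?_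
      rw [mem_Icc, not_and_or, not_le, not_le] at hy
      have hN : (0 : ℝ) ≤ N := Nat.cast_nonneg N
      rcases hy with hy | hy
      · simp only [hp, Real.smoothTransition.zero_of_nonpos (show y + N ≤ 0 by linarith),
          Real.smoothTransition.zero_of_nonpos (show y ≤ 0 by linarith), sub_self,
          Complex.ofReal_zero]
      · simp only [hp, Real.smoothTransition.one_of_one_le (show 1 ≤ y + N by linarith),
          Real.smoothTransition.one_of_one_le hy.le, sub_self, Complex.ofReal_zero]
    have hsmooth : ContDiff ℝ (⊤ : ℕ∞) fun y => ((p N y : ℝ) : ℂ) := by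
      refine Complex.ofRealCLM.contDiff.comp ?_
      exact (Real.smoothTransition.contDiff.comp (contDiff_id.add contDiff_const)).sub
        Real.smoothTransition.contDiff
    set S := hsupp.toSchwartzMap hsmooth with hS
    have hSd : deriv (S : ℝ → ℂ) = fun y => stepDeriv (y + N) - stepDeriv y := by
      ext y
      have h1 : HasDerivAt (fun y => Real.smoothTransition (y + N))
          (deriv Real.smoothTransition (y + N)) y :=
        (hasDerivAt_smoothTransition (y + N)).comp_add_const y N
      have h2 := (h1.sub (hasDerivAt_smoothTransition y)).ofReal_comp
      rw [Complex.ofReal_sub] at h2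
      exact h2.deriv
    have hFd : ∀ v : ℝ, ‖FourierTransform.fourier (S : ℝ → ℂ) v‖ * (2 * Real.pi * |v|) ≤
        2 * ‖FourierTransform.fourier stepDeriv v‖ := by
      intro v
      have h1 := congrFun (Real.fourier_deriv S.integrable S.differentiable
        (by rw [hSd]; exact (stepDeriv.integrable.comp_add_right _).sub stepDeriv.integrable)) v
      have h2 : FourierTransform.fourier (deriv (S : ℝ → ℂ)) v =
          Complex.exp (Complex.I * (N : ℝ) * ((2 * Real.pi * v : ℝ) : ℂ)) *
            FourierTransform.fourier stepDeriv v - FourierTransform.fourier stepDeriv v := by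
        have hI : ∀ f : ℝ → ℂ, Integrable f → Integrable fun y : ℝ =>
            Complex.exp (↑(-2 * Real.pi * inner ℝ y v) * Complex.I) • f y := fun f hf => by
          refine hf.mono ((by fun_prop : Continuous fun y : ℝ =>
            Complex.exp (↑(-2 * Real.pi * inner ℝ y v) * Complex.I)).aestronglyMeasurable.smul
            hf.aestronglyMeasurable) (ae_of_all _ fun y => ?_)
          rw [norm_smul, Complex.norm_exp_ofReal_mul_I, one_mul]
        rw [hSd, SchwartzMap.fourier_coe, Real.fourier_eq', Real.fourier_eq']
        simp only [smul_sub]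
        rw [integral_sub (hI _ (stepDeriv.integrable.comp_add_right _))
          (hI _ stepDeriv.integrable), ← integral_const_mul]
        congr 1
        rw [← integral_add_right_eq_self (fun y : ℝ => Complex.exp (Complex.I * (N : ℝ) *
          ((2 * Real.pi * v : ℝ) : ℂ)) * Complex.exp (↑(-2 * Real.pi * inner ℝ y v) * Complex.I) •
          stepDeriv y) (N : ℝ)]
        congr 1
        ext y
        simp only [smul_eq_mul, RCLike.inner_apply, conj_trivial]
        conv_rhs => rw [← mul_assoc, ← Complex.exp_add]
        congr 2
        push_cast
        ring
      have h3 : ‖FourierTransform.fourier (S : ℝ → ℂ) v‖ * (2 * Real.pi * |v|) =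
          ‖FourierTransform.fourier (deriv (S : ℝ → ℂ)) v‖ := by
        rw [h1, norm_smul, mul_comm]
        congr 1
        simp [abs_of_pos Real.pi_pos]
      rw [h3, h2]
      refine (norm_sub_le _ _).trans (le_of_eq ?_)
      rw [norm_mul, norm_cexp_I]
      ring
    have hwi : Integrable fun v : ℝ =>
        2 * (‖FourierTransform.fourier stepDeriv v‖ * (1 + 2 * Real.pi * |v|)) := by
      have h1 := (FourierTransform.fourier stepDeriv).integrable.norm (μ := volume)
      have h2 := (FourierTransform.fourier stepDeriv).integrable_pow_mul volume 1
      refine ((h1.add (h2.const_mul (2 * Real.pi))).const_mul 2).congr (ae_of_all _ fun v => ?_)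
      simp only [Pi.add_apply, pow_one, Real.norm_eq_abs]
      ring
    refine abs_semi_sub_le_integral_fourier hα hα1 hh (S := S) (fun y => rfl) hwi (fun v => ?_) x
    have hv : 0 ≤ 2 * Real.pi * |v| := by positivity
    have h4 : (2 * Real.pi * |v|) ^ (α + 1) ≤ (2 * Real.pi * |v|) * (1 + 2 * Real.pi * |v|) := by
      rw [Real.rpow_add_one' hv (by linarith), mul_comm]
      gcongr
      rcases le_total (2 * Real.pi * |v|) 1 with h | h
      · exact (Real.rpow_le_one hv h hα.le).trans (by linarith)
      · calc (2 * Real.pi * |v|) ^ α ≤ (2 * Real.pi * |v|) ^ (1 : ℝ) :=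
              Real.rpow_le_rpow_of_exponent_le h hα1.le
          _ ≤ _ := by rw [Real.rpow_one]; linarith
    calc _ ≤ ‖FourierTransform.fourier (S : ℝ → ℂ) v‖ *
          ((2 * Real.pi * |v|) * (1 + 2 * Real.pi * |v|)) := by gcongr
      _ = (‖FourierTransform.fourier (S : ℝ → ℂ) v‖ * (2 * Real.pi * |v|)) *
          (1 + 2 * Real.pi * |v|) := by ring
      _ ≤ 2 * ‖FourierTransform.fourier stepDeriv v‖ * (1 + 2 * Real.pi * |v|) := by
          exact mul_le_mul_of_nonneg_right (hFd v) (by positivity)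
      _ = _ := by ring
  have htend : ∀ y : ℝ, Tendsto (fun N : ℕ => Real.smoothTransition (y + N)) atTop (𝓝 1) := by
    intro y
    refine tendsto_const_nhds.congr' ?_
    filter_upwards [eventually_ge_atTop (⌈1 - y⌉₊)] with N hN
    have : 1 - y ≤ N := (Nat.le_ceil _).trans (by exact_mod_cast hN)
    rw [Real.smoothTransition.one_of_one_le (by linarith)]
  have hlim : Tendsto (fun N : ℕ => semi α h (fun y => Real.smoothTransition (y + N)) x) atTop
      (𝓝 1) := by
    have h1 := tendsto_integral_of_dominated_convergence (μ := stable α h) (fun _ => (1 : ℝ))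
      (F := fun (N : ℕ) y => Real.smoothTransition (x - y + N)) (f := fun _ => 1)
      (fun N => (hsm.comp (by fun_prop)).aestronglyMeasurable) (integrable_const _)
      (fun N => ae_of_all _ fun y => abs_smoothTransition_le _)
      (ae_of_all _ fun y => htend (x - y))
    simpa [semi] using h1
  have hlim2 := ((hlim.sub_const (semi α h Real.smoothTransition x)).sub
    ((htend x).sub_const (Real.smoothTransition x))).abs
  have h5 : ∀ N : ℕ, |semi α h (fun y => Real.smoothTransition (y + N)) x -
      semi α h Real.smoothTransition x -
      (Real.smoothTransition (x + N) - Real.smoothTransition x)| ≤ h * stepConst := fun N => by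
    have hm : Measurable fun y : ℝ => Real.smoothTransition (y + N) := hsm.comp (by fun_prop)
    rw [← semi_sub hα hα1 hm hsm (fun y => abs_smoothTransition_le _) abs_smoothTransition_le]
    exact hplateau N
  have h6 := le_of_tendsto' hlim2 h5
  have e : Real.smoothTransition x - semi α h Real.smoothTransition x =
      1 - semi α h Real.smoothTransition x - (1 - Real.smoothTransition x) := by ring
  rw [abs_sub_comm, e]
  exact h6

/-- The smooth step from `0` to `1` on the interval `[a, a + r]`. -/
noncomputable def step (a r x : ℝ) : ℝ := Real.smoothTransition ((x - a) / r)

lemma continuous_step (a r : ℝ) : Continuous (step a r) := by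
  have := Real.smoothTransition.continuous
  unfold step
  fun_prop

/-- The nonlocal operator applied to a step of width `r` is of size `r^(-(α+1))`, by scaling. -/
lemma abs_semi_step_sub_le {α : ℝ} (hα : 0 < α) (hα1 : α < 1) {h : ℝ} (hh : 0 ≤ h) (a : ℝ) {r : ℝ}
    (hr : 0 < r) (x : ℝ) :
    |semi α h (step a r) x - step a r x| ≤ h / r ^ (α + 1) * stepConst := by
  have hb : α + 1 ≠ 0 := by linarith
  have h0 : 0 ≤ h / r ^ (α + 1) := by positivity
  have h1 := abs_semi_smoothTransition_sub_le hα hα1 h0 ((x - a) / r)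
  convert h1 using 2
  congr 1
  rw [semi_eq_integral_stableOne (continuous_step a r).measurable,
    semi_eq_integral_stableOne Real.smoothTransition.continuous.measurable,
    Real.div_rpow hh (by positivity), ← Real.rpow_mul hr.le, mul_one_div_cancel hb, Real.rpow_one]
  congr 1
  ext z
  rw [step]
  congr 1
  field_simp
  ring

lemma hasDerivAt_step (a r x : ℝ) :
    HasDerivAt (step a r) (deriv Real.smoothTransition ((x - a) / r) / r) x := by
  have h1 : HasDerivAt (fun x : ℝ => (x - a) / r) (1 / r) x :=
    ((hasDerivAt_id x).sub_const a).div_const r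
  have h2 := (hasDerivAt_smoothTransition ((x - a) / r)).comp x h1
  exact h2.congr_deriv (by ring)

/-- A bound of the derivative of `Real.smoothTransition`. -/
lemma exists_deriv_smoothTransition_le : ∃ A, 0 ≤ A ∧ ∀ x, deriv Real.smoothTransition x ≤ A := by
  obtain ⟨A, hA⟩ := contDiff_deriv_smoothTransition.continuous.bounded_above_of_compact_support
    (HasCompactSupport.intro isCompact_Icc fun x hx => deriv_smoothTransition_eq_zero hx)
  exact ⟨A, (norm_nonneg _).trans (hA 0), fun x => (le_abs_self _).trans (hA x)⟩

/-! ### A comparison principle for the mild inequality -/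

/-- At a point where a function is within `h` of its supremum, its derivative is small, provided
the derivative varies little at the scale `δ`. -/
lemma abs_deriv_le_of_near_max {f f' : ℝ → ℝ} (hf : ∀ x, HasDerivAt f (f' x) x) {x h δ ε : ℝ}
    (hδ : 0 < δ) (hh : h ≤ ε * δ) (hmax : ∀ y, f y ≤ f x + h)
    (hosc : ∀ y, |y - x| ≤ δ → |f' y - f' x| ≤ ε) : |f' x| ≤ 2 * ε := by
  have hc : Continuous f := continuous_iff_continuousAt.2 fun y => (hf y).continuousAt
  obtain ⟨y, hy, hy'⟩ := exists_hasDerivAt_eq_slope f f' (show x < x + δ by linarith)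
    hc.continuousOn fun y _ => hf y
  obtain ⟨z, hz, hz'⟩ := exists_hasDerivAt_eq_slope f f' (show x - δ < x by linarith)
    hc.continuousOn fun y _ => hf y
  have h1 : f' y ≤ ε := by
    rw [hy', add_sub_cancel_left, div_le_iff₀ hδ]
    linarith [hmax (x + δ)]
  have h2 : -ε ≤ f' z := by
    rw [hz', sub_sub_cancel, le_div_iff₀ hδ]
    linarith [hmax (x - δ)]
  have h3 := abs_le.1 (hosc y (by rw [abs_le]; constructor <;> linarith [hy.1, hy.2]))
  have h4 := abs_le.1 (hosc z (by rw [abs_le]; constructor <;> linarith [hz.1, hz.2]))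
  rw [abs_le]
  constructor <;> linarith [h3.1, h4.2]

section

variable {α : ℝ} (hα : 0 < α) (hα1 : α < 1)
include hα hα1

/-- The supremum of a mild subsolution grows by `o(h)` over a short time step `h`: near a maximum
the gradient, and with it the drift term `G`, is small. -/
lemma exists_comparison_step {D w G : ℝ → ℝ → ℝ} {Λ Cg : ℝ} (hΛ : 0 ≤ Λ) (hCg : 0 ≤ Cg)
    (hDm : ∀ t, 0 ≤ t → Measurable (D t)) (hDb : ∀ t, 0 ≤ t → ∃ C, ∀ x, |D t x| ≤ C)
    (hD : ∀ t, 0 < t → ∀ x, HasDerivAt (D t) (w t x) x)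
    (hw : ∀ τ, 0 < τ → UniformContinuousOn (fun p : ℝ × ℝ => w p.1 p.2) (Ici τ ×ˢ univ))
    (hGm : ∀ t, 0 < t → Measurable (G t)) (hGb : ∀ t, 0 < t → ∀ x, |G t x| ≤ Cg)
    (hGw : ∀ t, 0 < t → ∀ x, |G t x| ≤ Λ * |w t x|)
    (hrestart : ∀ t t', 0 ≤ t → t < t' → ∀ x,
      D t' x ≤ semi α (t' - t) (D t) x + ∫ s in t..t', semi α (t' - s) (G s) x)
    {τ : ℝ} (hτ : 0 < τ) {ε : ℝ} (hε : 0 < ε) :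
    ∃ h₀ > 0, ∀ t, τ ≤ t → ∀ h, 0 < h → h ≤ h₀ → ∀ m, (∀ x, D t x ≤ m) →
      ∀ x, D (t + h) x ≤ m + ε * h := by
  set ε₁ := ε / (6 * (Λ + 1)) with hε₁
  have hε₁0 : 0 < ε₁ := by positivity
  set η := ε / (2 * (Cg + 1)) with hη
  have hη0 : 0 < η := by positivity
  obtain ⟨δ, hδ, hosc⟩ := Metric.uniformContinuousOn_iff.1 (hw τ hτ) ε₁ hε₁0
  have hosc' : ∀ t t' x y, τ ≤ t → τ ≤ t' → |t - t'| < δ → |x - y| < δ →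
      |w t x - w t' y| < ε₁ := fun t t' x y ht ht' h1 h2 =>
    hosc (t, x) ⟨ht, mem_univ _⟩ (t', y) ⟨ht', mem_univ _⟩ (by
      rw [Prod.dist_eq, max_lt_iff, Real.dist_eq, Real.dist_eq]
      exact ⟨h1, h2⟩)
  obtain ⟨h₁, hh₁, hloc⟩ := exists_abs_semi_le_of_near hα hα1 hδ hη0
  refine ⟨min (min h₁ (δ / 2)) (ε₁ * (δ / 2)), by positivity, ?_⟩
  intro t ht h hh hle m hm
  have hle1 : h ≤ h₁ := hle.trans ((min_le_left _ _).trans (min_le_left _ _))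
  have hle2 : h ≤ δ / 2 := hle.trans ((min_le_left _ _).trans (min_le_right _ _))
  have hle3 : h ≤ ε₁ * (δ / 2) := hle.trans (min_le_right _ _)
  have ht0 : 0 < t := hτ.trans_le ht
  have ht'0 : 0 < t + h := by linarith
  by_contra! hcon
  obtain ⟨x₀, hx₀⟩ := hcon
  -- the supremum may not be attained, so `x` is only a maximum point up to `h`
  obtain ⟨C, hC⟩ := hDb (t + h) ht'0.le
  obtain ⟨C', hC'⟩ := hDb t ht0.le
  have hbdd : BddAbove (range (D (t + h))) :=
    ⟨C, by rintro _ ⟨y, rfl⟩; exact (le_abs_self _).trans (hC y)⟩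
  have hS : max (sSup (range (D (t + h))) - h) (m + ε * h) < sSup (range (D (t + h))) :=
    max_lt (by linarith) (hx₀.trans_le (le_csSup hbdd (mem_range_self x₀)))
  obtain ⟨_, ⟨x, rfl⟩, hx⟩ := exists_lt_of_lt_csSup (range_nonempty _) hS
  have hmax : ∀ y, D (t + h) y ≤ D (t + h) x + h := fun y => by
    have h1 := le_csSup hbdd (mem_range_self y)
    have h2 := (le_max_left _ _).trans_lt hx
    linarith
  have hwx : |w (t + h) x| ≤ 2 * ε₁ := by
    refine abs_deriv_le_of_near_max (hD _ ht'0) (δ := δ / 2) (by positivity) hle3 hmax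
      fun y hy => ?_
    exact (hosc' _ _ _ _ (by linarith) (by linarith) (by simpa using hδ) (by linarith)).le
  have hint : ‖∫ s in t..(t + h), semi α (t + h - s) (G s) x‖ ≤ ε * |t + h - t| := by
    refine intervalIntegral.norm_integral_le_of_norm_le_const fun s hs => ?_
    rw [uIoc_of_le (by linarith)] at hs
    have hs0 : 0 < s := ht0.trans hs.1
    have h1 := hloc (t + h - s) (by linarith [hs.2]) (by linarith [hs.1]) (G s) Cg
      (Λ * (3 * ε₁)) x (hGm s hs0) (by positivity) (hGb s hs0) (fun y hy => by
        refine (hGw s hs0 _).trans ?_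
        gcongr
        have h2 := hosc' s (t + h) (x - y) x (by linarith [hs.1]) (by linarith)
          (by rw [abs_lt]; constructor <;> linarith [hs.1, hs.2])
          (by rwa [sub_sub_cancel_left, abs_neg])
        have h3 := abs_sub_abs_le_abs_sub (w s (x - y)) (w (t + h) x)
        linarith)
    rw [Real.norm_eq_abs]
    refine h1.trans ?_
    have h4 : Λ * (3 * ε₁) ≤ ε / 2 := by
      rw [hε₁, show Λ * (3 * (ε / (6 * (Λ + 1)))) = (ε / 2) * (Λ / (Λ + 1)) by field_simp; ring]
      exact mul_le_of_le_one_right (by positivity) ((div_le_one (by positivity)).2 (by linarith))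
    have h5 : Cg * η ≤ ε / 2 := by
      rw [hη, show Cg * (ε / (2 * (Cg + 1))) = (ε / 2) * (Cg / (Cg + 1)) by field_simp]
      exact mul_le_of_le_one_right (by positivity) ((div_le_one (by positivity)).2 (by linarith))
    linarith
  have h6 := hrestart t (t + h) ht0.le (by linarith) x
  have h7 : semi α (t + h - t) (D t) x ≤ m := by
    have := semi_mono hα hα1 (hDm t ht0.le) measurable_const hC' (D := |m|) (fun _ => le_rfl) hm
      (t + h - t) x
    rwa [semi_const hα hα1] at this
  rw [add_sub_cancel_left, abs_of_pos hh] at hint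
  have h8 := (le_abs_self _).trans hint
  have h9 := (le_max_right _ _).trans_lt hx
  linarith

/-- **Comparison principle.** A mild subsolution of a linear equation whose drift term vanishes
with the gradient stays below its initial upper bounds. -/
lemma comparison {D w G : ℝ → ℝ → ℝ} {Λ Cg : ℝ} (hΛ : 0 ≤ Λ) (hCg : 0 ≤ Cg)
    (hDm : ∀ t, 0 ≤ t → Measurable (D t)) (hDb : ∀ t, 0 ≤ t → ∃ C, ∀ x, |D t x| ≤ C)
    (hD : ∀ t, 0 < t → ∀ x, HasDerivAt (D t) (w t x) x)
    (hw : ∀ τ, 0 < τ → UniformContinuousOn (fun p : ℝ × ℝ => w p.1 p.2) (Ici τ ×ˢ univ))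
    (hGm : ∀ t, 0 < t → Measurable (G t)) (hGb : ∀ t, 0 < t → ∀ x, |G t x| ≤ Cg)
    (hGw : ∀ t, 0 < t → ∀ x, |G t x| ≤ Λ * |w t x|)
    (hrestart : ∀ t t', 0 ≤ t → t < t' → ∀ x,
      D t' x ≤ semi α (t' - t) (D t) x + ∫ s in t..t', semi α (t' - s) (G s) x)
    {m : ℝ} (h0 : ∀ x, D 0 x ≤ m) {T : ℝ} (hT : 0 < T) (x : ℝ) : D T x ≤ m := by
  have hpos : ∀ τ, 0 < τ → τ < T → ∀ m, (∀ x, D τ x ≤ m) → ∀ x, D T x ≤ m := by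
    intro τ hτ hτT m hm x
    refine le_of_forall_pos_le_add fun ε' hε' => ?_
    obtain ⟨ε, hε, hεε'⟩ : ∃ ε > 0, ε * (T - τ) = ε' :=
      ⟨ε' / (T - τ), div_pos hε' (by linarith), div_mul_cancel₀ _ (by linarith)⟩
    obtain ⟨h₀, hh₀, hstep⟩ := exists_comparison_step hα hα1 hΛ hCg hDm hDb hD hw hGm hGb hGw
      hrestart hτ hε
    obtain ⟨n, hn⟩ := exists_nat_gt ((T - τ) / h₀)
    have hn0 : (0 : ℝ) < n := (div_pos (by linarith) hh₀).trans hn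
    set h := (T - τ) / n with hh
    have hhpos : 0 < h := div_pos (by linarith) hn0
    have hhle : h ≤ h₀ := by
      rw [hh, div_le_iff₀ hn0]
      rw [div_lt_iff₀ hh₀] at hn
      linarith
    have hind : ∀ k : ℕ, ∀ x, D (τ + k * h) x ≤ m + ε * (k * h) := fun k => by
      induction k with
      | zero => simpa using hm
      | succ k ih =>
        intro x
        have h1 := hstep (τ + k * h) (by have : 0 ≤ k * h := by positivity
                                         linarith) h hhpos hhle _ ih x
        rw [show τ + ((k + 1 : ℕ) : ℝ) * h = τ + k * h + h by push_cast; ring]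
        refine h1.trans (le_of_eq ?_)
        push_cast
        ring
    have h2 := hind n x
    rwa [hh, mul_div_cancel₀ _ hn0.ne', add_sub_cancel, hεε'] at h2
  -- nothing is known about `w` near time zero, but there the drift contributes at most `Cg * τ`
  refine le_of_forall_pos_le_add fun ε hε => ?_
  obtain ⟨τ, hτ, hτT, hτε⟩ : ∃ τ, 0 < τ ∧ τ < T ∧ Cg * τ ≤ ε := by
    refine ⟨min (T / 2) (ε / (Cg + 1)), by positivity,
      (min_le_left _ _).trans_lt (by linarith), ?_⟩
    calc Cg * min (T / 2) (ε / (Cg + 1)) ≤ (Cg + 1) * (ε / (Cg + 1)) := by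
          gcongr
          · linarith
          · exact min_le_right _ _
      _ = ε := by field_simp
  refine hpos τ hτ hτT (m + ε) (fun y => ?_) x
  have h1 := hrestart 0 τ le_rfl hτ y
  obtain ⟨C, hC⟩ := hDb 0 le_rfl
  have h2 : semi α (τ - 0) (D 0) y ≤ m := by
    have := semi_mono hα hα1 (hDm 0 le_rfl) measurable_const hC (D := |m|) (fun _ => le_rfl) h0
      (τ - 0) y
    rwa [semi_const hα hα1] at this
  have h3 : ‖∫ s in (0 : ℝ)..τ, semi α (τ - s) (G s) y‖ ≤ Cg * |τ - 0| :=
    intervalIntegral.norm_integral_le_of_norm_le_const fun s hs => by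
      rw [uIoc_of_le hτ.le] at hs
      exact abs_semi_le hα hα1 (hGb s hs.1) _ _
  rw [sub_zero, abs_of_pos hτ] at h3
  linarith [(le_abs_self _).trans h3]

end

/-! ### The potential of a mild solution -/

/-- The tail mass `∫_x^∞ u₀`. -/
noncomputable def tailMass (u₀ : ℝ → ℝ) (x : ℝ) : ℝ := ∫ y in Ioi x, u₀ y

lemma tailMass_sub_tailMass {u₀ : ℝ → ℝ} (h : Integrable u₀) (a b : ℝ) :
    tailMass u₀ b - tailMass u₀ a = ∫ x in a..b, -u₀ x := by
  rw [intervalIntegral.integral_neg, tailMass, tailMass,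
    ← intervalIntegral.integral_Ioi_sub_Ioi' h.integrableOn h.integrableOn]
  ring

lemma continuous_tailMass {u₀ : ℝ → ℝ} (h : Integrable u₀) : Continuous (tailMass u₀) := by
  have h1 : tailMass u₀ = fun x => (∫ y in (0 : ℝ)..x, -u₀ y) + tailMass u₀ 0 := by
    ext x
    rw [← tailMass_sub_tailMass h]
    ring
  rw [h1]
  exact (intervalIntegral.continuous_primitive (fun _ _ => h.neg.intervalIntegrable) 0).add
    continuous_const

lemma tailMass_nonneg {u₀ : ℝ → ℝ} (h0 : ∀ᵐ x, 0 ≤ u₀ x) (x : ℝ) : 0 ≤ tailMass u₀ x :=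
  integral_nonneg_of_ae (ae_restrict_of_ae h0)

lemma tailMass_le {u₀ : ℝ → ℝ} (h : Integrable u₀) (h0 : ∀ᵐ x, 0 ≤ u₀ x) (x : ℝ) :
    tailMass u₀ x ≤ ∫ y, u₀ y :=
  setIntegral_le_integral h h0

lemma tailMass_antitone {u₀ : ℝ → ℝ} (h : Integrable u₀) (h0 : ∀ᵐ x, 0 ≤ u₀ x) :
    Antitone (tailMass u₀) := fun a b hab => by
  have h1 := tailMass_sub_tailMass h a b
  have h2 : ∫ x in a..b, -u₀ x ≤ 0 := by
    rw [intervalIntegral.integral_neg, neg_nonpos]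
    exact intervalIntegral.integral_nonneg_of_ae hab h0
  linarith

lemma abs_tailMass_le {u₀ : ℝ → ℝ} (h : Integrable u₀) (x : ℝ) :
    |tailMass u₀ x| ≤ ∫ y, |u₀ y| :=
  (abs_integral_le_integral_abs).trans
    (setIntegral_le_integral h.abs (ae_of_all _ fun _ => abs_nonneg _))

/-- The potential `Q(t,x) = T_t (∫_x^∞ u₀) + ∫₀ᵗ T_{t-s} F(s) ds`, which solves
`∂ₜ Q = L Q + F` with `Q(0,·)` the tail mass of `u₀`. If `u` solves the mild formulation and `F` is
its flux, then `∂ₓ Q = -u`. No integrability of `u(t,·)` is needed to define it. -/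
noncomputable def potential (α : ℝ) (u₀ : ℝ → ℝ) (F : ℝ → ℝ → ℝ) (t x : ℝ) : ℝ :=
  semi α t (tailMass u₀) x + ∫ s in (0 : ℝ)..t, semi α (t - s) (F s) x

section

variable {α : ℝ} (hα : 0 < α) (hα1 : α < 1)
include hα hα1

lemma semi_sub_semi_of_primitive {P p : ℝ → ℝ} (hP : Measurable P) {C : ℝ} (hPb : ∀ x, |P x| ≤ C)
    (hPp : ∀ a b, P b - P a = ∫ x in a..b, p x) {t a b : ℝ}
    (hint : Integrable (Function.uncurry fun x y => p (x - y))
      ((volume.restrict (uIoc a b)).prod (stable α t))) :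
    semi α t P b - semi α t P a = ∫ x in a..b, semi α t p x := by
  have := isProbabilityMeasure_stable hα hα1 t
  simp only [semi]
  rw [intervalIntegral_integral_swap hint, ← integral_sub (integrable_semi hα hα1 hP hPb t b)
    (integrable_semi hα hα1 hP hPb t a)]
  congr 1
  ext y
  rw [intervalIntegral.integral_comp_sub_right, hPp]

lemma integrable_uncurry_sub_of_integrable {p : ℝ → ℝ} (hpm : Measurable p) (hp : Integrable p)
    (t a b : ℝ) : Integrable (Function.uncurry fun x y => p (x - y))
      ((volume.restrict (uIoc a b)).prod (stable α t)) := by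
  have := isProbabilityMeasure_stable hα hα1 t
  have hm : Measurable (Function.uncurry fun x y => p (x - y)) :=
    hpm.comp (measurable_fst.sub measurable_snd)
  rw [integrable_prod_iff' hm.aestronglyMeasurable]
  refine ⟨ae_of_all _ fun y => (hp.comp_sub_right y).restrict, ?_⟩
  refine Integrable.of_bound (StronglyMeasurable.integral_prod_left'
    hm.stronglyMeasurable.norm).aestronglyMeasurable (∫ x, |p x|) (ae_of_all _ fun y => ?_)
  refine (Real.norm_of_nonneg (integral_nonneg fun x => norm_nonneg _)).trans_le ?_
  rw [← integral_sub_right_eq_self (fun x => |p x|) y]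
  exact setIntegral_le_integral (hp.comp_sub_right y).abs (ae_of_all _ fun x => abs_nonneg _)

lemma integrable_uncurry_sub_of_bounded {p : ℝ → ℝ} (hpm : Measurable p) {C : ℝ}
    (hp : ∀ x, |p x| ≤ C) (t a b : ℝ) : Integrable (Function.uncurry fun x y => p (x - y))
      ((volume.restrict (uIoc a b)).prod (stable α t)) := by
  have := isProbabilityMeasure_stable hα hα1 t
  have : IsFiniteMeasure (volume.restrict (uIoc a b)) := ⟨by simp [uIoc]⟩
  exact Integrable.of_bound (hpm.comp (measurable_fst.sub measurable_snd)).aestronglyMeasurable C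
    (ae_of_all _ fun q => hp _)

variable {F : ℝ → ℝ → ℝ} (hF : Measurable (Function.uncurry F)) {Cf : ℝ}
  (hFb : ∀ s x, |F s x| ≤ Cf)
include hF hFb

omit hα hα1 hFb in
lemma measurable_section (s : ℝ) : Measurable (F s) :=
  hF.comp (by fun_prop : Measurable fun y : ℝ => (s, y))

lemma intervalIntegrable_semi (t x a b : ℝ) :
    IntervalIntegrable (fun s => semi α (t - s) (F s) x) volume a b := by
  have hm := measurable_semi hα hα1 hF (τ := fun s => t - s) (by fun_prop)
  have hm' : Measurable fun s => semi α (t - s) (F s) x :=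
    hm.comp (by fun_prop : Measurable fun s : ℝ => (s, x))
  exact (intervalIntegrable_const (c := Cf)).mono_fun hm'.aestronglyMeasurable
    (ae_of_all _ fun s => by
      change |semi α (t - s) (F s) x| ≤ |Cf|
      exact (abs_semi_le hα hα1 (hFb s) _ _).trans (le_abs_self _))

omit hF in
lemma abs_integral_semi_le {t : ℝ} (r x : ℝ) (ht : 0 ≤ t) :
    |∫ s in (0 : ℝ)..t, semi α (r - s) (F s) x| ≤ Cf * t := by
  have h := intervalIntegral.norm_integral_le_of_norm_le_const (a := 0) (b := t) (C := Cf)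
    (f := fun s => semi α (r - s) (F s) x) fun s _ => abs_semi_le hα hα1 (hFb s) _ _
  rwa [sub_zero, abs_of_nonneg ht] at h

omit hFb in
lemma measurable_integral_semi (t : ℝ) (ht : 0 ≤ t) :
    Measurable fun x => ∫ s in (0 : ℝ)..t, semi α (t - s) (F s) x := by
  have hm := measurable_semi hα hα1 hF (τ := fun s => t - s) (by fun_prop)
  simp only [intervalIntegral.integral_of_le ht]
  have := StronglyMeasurable.integral_prod_left' (μ := volume.restrict (Ioc 0 t))
    hm.stronglyMeasurable
  exact this.measurable

omit hF hFb in
/-- The singularity `(t-s)^(-1/(α+1))` of the Duhamel term is integrable. -/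
lemma integral_duhamel_singularity (h t : ℝ) :
    IntervalIntegrable (fun s => (t - s) ^ (-(1 / (α + 1)))) volume (t - h) t ∧
    ∫ s in (t - h)..t, (t - s) ^ (-(1 / (α + 1))) =
      h ^ (1 - 1 / (α + 1)) / (1 - 1 / (α + 1)) := by
  have hθ : 1 / (α + 1) < 1 := by rw [div_lt_one (by linarith)]; linarith
  have h1 : -1 < -(1 / (α + 1)) := by linarith
  constructor
  · have h2 := (intervalIntegral.intervalIntegrable_rpow' h1 (a := h) (b := 0)).comp_sub_left t
    simpa using h2
  · rw [intervalIntegral.integral_comp_sub_left (fun s => s ^ (-(1 / (α + 1)))), sub_self,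
      sub_sub_cancel, integral_rpow (Or.inl h1), Real.zero_rpow (by linarith)]
    ring_nf

lemma abs_duhamel_sub_le {t₀ t : ℝ} (ht : t₀ ≤ t) (a b : ℝ) :
    |(∫ s in t₀..t, semi α (t - s) (F s) b) - ∫ s in t₀..t, semi α (t - s) (F s) a| ≤
      Cf * (∫ x, |deriv (kernel α 1) x|) * ((t - t₀) ^ (1 - 1 / (α + 1)) / (1 - 1 / (α + 1))) *
        |b - a| := by
  obtain ⟨hi, he⟩ := integral_duhamel_singularity hα hα1 (t - t₀) t
  rw [sub_sub_cancel] at hi he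
  rw [← intervalIntegral.integral_sub (intervalIntegrable_semi hα hα1 hF hFb _ _ _ _)
    (intervalIntegrable_semi hα hα1 hF hFb _ _ _ _), ← he, ← intervalIntegral.integral_const_mul,
    ← intervalIntegral.integral_mul_const]
  rw [← Real.norm_eq_abs]
  refine intervalIntegral.norm_integral_le_of_norm_le ht ?_ ((hi.const_mul _).mul_const _)
  have hne : ∀ᵐ s : ℝ, s ≠ t := by simp [ae_iff]
  filter_upwards [hne] with s hs hs'
  exact abs_semi_sub_semi_le hα hα1 (sub_pos.2 (lt_of_le_of_ne hs'.2 hs))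
    (measurable_section hF s) (hFb s) a b

lemma integrableOn_dsemi (t a b : ℝ) (ht : 0 ≤ t) :
    IntegrableOn (Function.uncurry fun s x => dsemi α (t - s) (F s) x)
      (uIoc 0 t ×ˢ uIoc a b) := by
  have hne : ∀ᵐ s : ℝ, s ≠ t := by simp [ae_iff]
  have hne2 : ∀ᵐ p : ℝ × ℝ, p.1 ≠ t := Measure.quasiMeasurePreserving_fst.ae hne
  have hlt : ∀ᵐ p : ℝ × ℝ ∂(volume.restrict (uIoc 0 t ×ˢ uIoc a b)), p.1 < t := by
    filter_upwards [ae_restrict_mem (measurableSet_uIoc.prod measurableSet_uIoc),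
      ae_restrict_of_ae hne2] with p hp hp'
    rw [uIoc_of_le ht] at hp
    exact lt_of_le_of_ne hp.1.2 hp'
  -- the derivative of the kernel through its scaling formula, to have joint measurability
  set c : ℝ → ℝ := fun r => r ^ (-(1 / (α + 1))) with hc
  have hcm : Measurable c := by fun_prop
  have hk := measurable_deriv (kernel α 1)
  have hm : Measurable fun q : (ℝ × ℝ) × ℝ => c (t - q.1.1) * (c (t - q.1.1) *
      deriv (kernel α 1) (c (t - q.1.1) * (q.1.2 - q.2))) * F q.1.1 q.2 := by
    have h1 : Measurable fun q : (ℝ × ℝ) × ℝ => c (t - q.1.1) :=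
      hcm.comp (by fun_prop)
    refine (h1.mul (h1.mul (hk.comp (h1.mul (by fun_prop))))).mul ?_
    exact hF.comp (by fun_prop : Measurable fun q : (ℝ × ℝ) × ℝ => (q.1.1, q.2))
  have hm2 := StronglyMeasurable.integral_prod_right' (ν := (volume : Measure ℝ))
    hm.stronglyMeasurable
  have hi := (integral_duhamel_singularity hα hα1 t t).1
  rw [sub_self, intervalIntegrable_iff] at hi
  have : IsFiniteMeasure ((volume : Measure ℝ).restrict (uIoc a b)) := ⟨by simp [uIoc]⟩
  have hi2 : Integrable (fun p : ℝ × ℝ => Cf * (∫ x, |deriv (kernel α 1) x|) *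
      (t - p.1) ^ (-(1 / (α + 1)))) (volume.restrict (uIoc 0 t ×ˢ uIoc a b)) := by
    rw [Measure.volume_eq_prod, ← Measure.prod_restrict]
    exact (Integrable.comp_fst hi (volume.restrict (uIoc a b))).const_mul _
  refine hi2.mono' (hm2.aestronglyMeasurable.congr ?_) ?_
  · filter_upwards [hlt] with p hp
    simp only [Function.uncurry, dsemi, deriv_kernel hα hα1 (sub_pos.2 hp), hc]
  · filter_upwards [hlt] with p hp
    exact abs_dsemi_le hα hα1 (sub_pos.2 hp) (measurable_section hF p.1) (hFb p.1) p.2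

lemma duhamel_sub_eq_integral {t : ℝ} (ht : 0 ≤ t) (a b : ℝ) :
    (∫ s in (0 : ℝ)..t, semi α (t - s) (F s) b) - ∫ s in (0 : ℝ)..t, semi α (t - s) (F s) a =
      ∫ x in a..b, ∫ s in (0 : ℝ)..t, dsemi α (t - s) (F s) x := by
  rw [← intervalIntegral.integral_sub (intervalIntegrable_semi hα hα1 hF hFb _ _ _ _)
    (intervalIntegrable_semi hα hα1 hF hFb _ _ _ _),
    ← intervalIntegral_intervalIntegral_swap (integrableOn_dsemi hα hα1 hF hFb t a b ht)]
  refine intervalIntegral.integral_congr_ae ?_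
  have hne : ∀ᵐ s : ℝ, s ≠ t := by simp [ae_iff]
  filter_upwards [hne] with s hs hs'
  rw [uIoc_of_le ht] at hs'
  exact semi_sub_semi_eq_integral_dsemi hα hα1 (sub_pos.2 (lt_of_le_of_ne hs'.2 hs))
    (measurable_section hF s) (hFb s) a b

/-- The Duhamel formula between two times. -/
lemma semi_duhamel {t h : ℝ} (ht : 0 ≤ t) (hh : 0 ≤ h) (x : ℝ) :
    semi α h (fun y => ∫ s in (0 : ℝ)..t, semi α (t - s) (F s) y) x =
      ∫ s in (0 : ℝ)..t, semi α (t + h - s) (F s) x := by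
  have := isProbabilityMeasure_stable hα hα1 h
  have : IsFiniteMeasure ((volume : Measure ℝ).restrict (uIoc 0 t)) := ⟨by simp [uIoc]⟩
  have hm := measurable_semi hα hα1 hF (τ := fun s => t - s) (by fun_prop)
  have hint : Integrable (Function.uncurry fun s y => semi α (t - s) (F s) (x - y))
      ((volume.restrict (uIoc 0 t)).prod (stable α h)) :=
    Integrable.of_bound (hm.comp (by fun_prop : Measurable fun p : ℝ × ℝ =>
      (p.1, x - p.2))).aestronglyMeasurable Cf
      (ae_of_all _ fun p => abs_semi_le hα hα1 (hFb p.1) _ _)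
  change ∫ y, (∫ s in (0 : ℝ)..t, semi α (t - s) (F s) (x - y)) ∂(stable α h) = _
  rw [← intervalIntegral_integral_swap hint]
  refine intervalIntegral.integral_congr fun s hs => ?_
  rw [uIcc_of_le ht] at hs
  have h1 := semi_semi hα hα1 (measurable_section hF s) (hFb s) hh (sub_nonneg.2 hs.2) x
  rw [show h + (t - s) = t + h - s by ring] at h1
  exact h1

variable {u₀ : ℝ → ℝ}

omit hF hFb in
lemma potential_zero (hu₀ : Integrable u₀) (x : ℝ) : potential α u₀ F 0 x = tailMass u₀ x := by
  rw [potential, semi_zero hα hα1 (continuous_tailMass hu₀).measurable,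
    intervalIntegral.integral_same, add_zero]

omit hFb in
lemma measurable_potential (hu₀ : Integrable u₀) {t : ℝ} (ht : 0 ≤ t) :
    Measurable (potential α u₀ F t) :=
  (measurable_semi_apply hα hα1 (continuous_tailMass hu₀).measurable t).add
    (measurable_integral_semi hα hα1 hF t ht)

omit hF in
lemma abs_potential_le (hu₀ : Integrable u₀) {t : ℝ} (ht : 0 ≤ t) (x : ℝ) :
    |potential α u₀ F t x| ≤ (∫ y, |u₀ y|) + Cf * t :=
  (abs_add_le _ _).trans (add_le_add (abs_semi_le hα hα1 (abs_tailMass_le hu₀) _ _)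
    (abs_integral_semi_le hα hα1 hFb _ _ ht))

lemma potential_restart (hu₀ : Integrable u₀) {t t' : ℝ} (ht : 0 ≤ t) (htt' : t ≤ t') (x : ℝ) :
    potential α u₀ F t' x = semi α (t' - t) (potential α u₀ F t) x +
      ∫ s in t..t', semi α (t' - s) (F s) x := by
  have hh : 0 ≤ t' - t := sub_nonneg.2 htt'
  have hQm := (continuous_tailMass hu₀).measurable
  have h1 : semi α (t' - t) (potential α u₀ F t) x = semi α t' (tailMass u₀) x +
      ∫ s in (0 : ℝ)..t, semi α (t' - s) (F s) x := by
    have h2 := semi_add hα hα1 (measurable_semi_apply hα hα1 hQm t)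
      (measurable_integral_semi hα hα1 hF t ht)
      (fun y => abs_semi_le hα hα1 (abs_tailMass_le hu₀) t y)
      (fun y => abs_integral_semi_le hα hα1 hFb t y ht) (t' - t) x
    rw [semi_semi hα hα1 hQm (abs_tailMass_le hu₀) hh ht, semi_duhamel hα hα1 hF hFb ht hh,
      sub_add_cancel, add_sub_cancel] at h2
    exact h2
  rw [h1, potential, add_assoc, intervalIntegral.integral_add_adjacent_intervals
    (intervalIntegrable_semi hα hα1 hF hFb _ _ _ _) (intervalIntegrable_semi hα hα1 hF hFb _ _ _ _)]

lemma continuous_potential (hu₀ : Integrable u₀) {t : ℝ} (ht : 0 < t) :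
    Continuous (potential α u₀ F t) := by
  have h1 := continuous_semi hα hα1 (continuous_tailMass hu₀) (abs_tailMass_le hu₀) t
  have h2 := LipschitzWith.of_dist_le' (K := Cf * (∫ x, |deriv (kernel α 1) x|) *
    ((t - 0) ^ (1 - 1 / (α + 1)) / (1 - 1 / (α + 1))))
    (f := fun x => ∫ s in (0 : ℝ)..t, semi α (t - s) (F s) x) fun x y => by
      rw [dist_comm, dist_comm x y, Real.dist_eq, Real.dist_eq]
      exact abs_duhamel_sub_le hα hα1 hF hFb ht.le x y
  exact h1.add h2.continuous

/-- The potential is a primitive of minus the mild right-hand side. -/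
lemma potential_sub_eq (hu₀ : Integrable u₀) (hu₀m : Measurable u₀) {t : ℝ} (ht : 0 < t)
    (a b : ℝ) :
    potential α u₀ F t b - potential α u₀ F t a =
      ∫ x in a..b, -((∫ y, kernel α t (x - y) * u₀ y) -
        ∫ s in (0 : ℝ)..t, dsemi α (t - s) (F s) x) := by
  have hQ := continuous_tailMass hu₀
  have hint := (integrable_uncurry_sub_of_integrable hα hα1 hu₀m hu₀ t a b).neg
  have := isProbabilityMeasure_stable hα hα1 t
  have h1 := semi_sub_semi_of_primitive hα hα1 hQ.measurable (abs_tailMass_le hu₀)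
    (p := fun x => -u₀ x) (t := t) (a := a) (b := b) (tailMass_sub_tailMass hu₀) hint
  have h2 := duhamel_sub_eq_integral hα hα1 hF hFb ht.le a b
  have hi1 : IntervalIntegrable (semi α t fun x => -u₀ x) volume a b := by
    rw [intervalIntegrable_iff]
    exact hint.integral_prod_left
  have hi2 : IntervalIntegrable (fun x => ∫ s in (0 : ℝ)..t, dsemi α (t - s) (F s) x)
      volume a b := by
    have h3 := integrableOn_dsemi hα hα1 hF hFb t a b ht.le
    rw [IntegrableOn, Measure.volume_eq_prod, ← Measure.prod_restrict] at h3
    rw [intervalIntegrable_iff]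
    simp only [intervalIntegral.integral_of_le ht.le]
    rw [uIoc_of_le ht.le] at h3
    exact h3.integral_prod_right
  rw [potential, potential, add_sub_add_comm, h1, h2, ← intervalIntegral.integral_add hi1 hi2]
  congr 1
  ext x
  rw [neg_sub, sub_eq_add_neg, add_comm, ← semi_eq_integral_kernel hα hα1 ht hu₀m]
  simp only [semi]
  rw [integral_neg]

end

/-! ### Regularity of mild solutions -/

section

variable {α : ℝ} (hα : 0 < α) (hα1 : α < 1)
include hα hα1

lemma continuous_semi_time {g : ℝ → ℝ} (hg : Continuous g) {C : ℝ} (hC : ∀ x, |g x| ≤ C) (x : ℝ) :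
    Continuous fun t => semi α t g x := by
  have := isProbabilityMeasure_stableOne hα hα1
  have hθ : 0 ≤ 1 / (α + 1) := by positivity
  simp only [semi_eq_integral_stableOne hg.measurable]
  refine continuous_of_dominated (bound := fun _ => C) (fun t => ?_)
    (fun t => ae_of_all _ fun y => hC _) (integrable_const C) (ae_of_all _ fun z => ?_)
  · exact (by fun_prop : Continuous fun z => g (x - t ^ (1 / (α + 1)) * z)).aestronglyMeasurable
  · have := Real.continuous_rpow_const hθ
    fun_prop

variable {F : ℝ → ℝ → ℝ} (hF : Measurable (Function.uncurry F)) {Cf : ℝ}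
  (hFb : ∀ s x, |F s x| ≤ Cf) {u₀ : ℝ → ℝ} (hu₀ : Integrable u₀)
include hF hFb hu₀

lemma tendsto_potential_right {t : ℝ} (ht : 0 < t) (x : ℝ) :
    Tendsto (fun t' => potential α u₀ F t' x) (𝓝[>] t) (𝓝 (potential α u₀ F t x)) := by
  have hPm := measurable_potential hα hα1 hF hu₀ ht.le
  have hPc := continuous_potential hα hα1 hF hFb hu₀ ht
  have h1 : Tendsto (fun t' => semi α (t' - t) (potential α u₀ F t) x) (𝓝[>] t)
      (𝓝 (potential α u₀ F t x)) := by
    have h2 := ((continuous_semi_time hα hα1 hPc (abs_potential_le hα hα1 hFb hu₀ ht.le) x).comp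
      (by fun_prop : Continuous fun t' : ℝ => t' - t)).tendsto t
    simp only [Function.comp_def, sub_self, semi_zero hα hα1 hPm] at h2
    exact h2.mono_left nhdsWithin_le_nhds
  have h3 : Tendsto (fun t' => ∫ s in t..t', semi α (t' - s) (F s) x) (𝓝[>] t) (𝓝 0) := by
    have h4 : Tendsto (fun t' => Cf * |t' - t|) (𝓝[>] t) (𝓝 0) := by
      have h5 : Tendsto (fun t' => Cf * |t' - t|) (𝓝 t) (𝓝 (Cf * |t - t|)) :=
        (by fun_prop : Continuous fun t' => Cf * |t' - t|).tendsto t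
      rw [sub_self, abs_zero, mul_zero] at h5
      exact h5.mono_left nhdsWithin_le_nhds
    exact squeeze_zero_norm (fun t' => intervalIntegral.norm_integral_le_of_norm_le_const
      fun s _ => abs_semi_le hα hα1 (hFb s) _ _) h4
  have h6 := h1.add h3
  rw [add_zero] at h6
  refine h6.congr' ?_
  filter_upwards [self_mem_nhdsWithin] with t' ht'
  exact (potential_restart hα hα1 hF hFb hu₀ ht.le (le_of_lt ht') x).symm

variable {u : ℝ → ℝ → ℝ} (hu : ContinuousOn (fun p : ℝ × ℝ => u p.1 p.2) (Ioi 0 ×ˢ univ))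
  {B : ℝ} (hB : ∀ t, 0 < t → ∀ x, |u t x| ≤ B)

omit hα hα1 hF hFb hu₀ in
include hu in
lemma continuous_slice {t : ℝ} (ht : 0 < t) : Continuous (u t) :=
  hu.comp_continuous (by fun_prop : Continuous fun x : ℝ => (t, x)) fun _ => ⟨ht, mem_univ _⟩

include hu hB

/-- A mild solution is minus the space derivative of its potential at every positive time, not
just at almost every one: both sides are right-continuous in time. -/
lemma potential_sub_eq_integral
    (hgood : ∀ᵐ t : ℝ, 0 < t → ∀ a b, potential α u₀ F t b - potential α u₀ F t a =
      ∫ x in a..b, -u t x) {t : ℝ} (ht : 0 < t) (a b : ℝ) :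
    potential α u₀ F t b - potential α u₀ F t a = ∫ x in a..b, -u t x := by
  have h1 : Tendsto (fun t' => ∫ x in a..b, -u t' x) (𝓝[>] t) (𝓝 (∫ x in a..b, -u t x)) := by
    have h2 : ContinuousAt (fun t' => ∫ x in a..b, -u t' x) t := by
      refine intervalIntegral.continuousAt_of_dominated_interval (bound := fun _ => B) ?_ ?_
        intervalIntegrable_const ?_
      · filter_upwards [lt_mem_nhds ht] with t' ht'
        exact (continuous_slice hu ht').neg.aestronglyMeasurable
      · filter_upwards [lt_mem_nhds ht] with t' ht'
        exact ae_of_all _ fun x _ => by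
          rw [norm_neg]
          exact hB t' ht' x
      · refine ae_of_all _ fun x _ => ContinuousAt.neg ?_
        have h3 : ContinuousAt (fun p : ℝ × ℝ => u p.1 p.2) (t, x) :=
          hu.continuousAt ((isOpen_Ioi.prod isOpen_univ).mem_nhds ⟨ht, mem_univ _⟩)
        exact ContinuousAt.comp (f := fun t' : ℝ => (t', x)) h3 (by fun_prop)
    exact h2.tendsto.mono_left nhdsWithin_le_nhds
  have h4 := ((tendsto_potential_right hα hα1 hF hFb hu₀ ht b).sub
    (tendsto_potential_right hα hα1 hF hFb hu₀ ht a)).sub h1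
  have h5 : ∃ᶠ t' in 𝓝[>] t, potential α u₀ F t' b - potential α u₀ F t' a -
      ∫ x in a..b, -u t' x ∈ ({0} : Set ℝ) := by
    rw [frequently_iff]
    intro U hU
    obtain ⟨c, hc, hcU⟩ := mem_nhdsGT_iff_exists_Ioo_subset.1 hU
    obtain ⟨t', ht', htc⟩ := (Measure.dense_of_ae hgood).inter_open_nonempty (Ioo t c) isOpen_Ioo
      (nonempty_Ioo.2 hc)
    exact ⟨t', hcU ht', by simp [htc (ht.trans ht'.1) a b]⟩
  exact sub_eq_zero.1 (isClosed_singleton.mem_of_frequently_of_tendsto h5 h4)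

omit hα hα1 hF hFb hu₀ hB in
lemma hasDerivAt_potential (hgood : ∀ t, 0 < t → ∀ a b,
      potential α u₀ F t b - potential α u₀ F t a = ∫ x in a..b, -u t x) {t : ℝ} (ht : 0 < t)
    (x : ℝ) : HasDerivAt (potential α u₀ F t) (-u t x) x := by
  have hc := (continuous_slice hu ht).neg
  have h1 : potential α u₀ F t = fun y => (∫ z in (0 : ℝ)..y, -u t z) + potential α u₀ F t 0 := by
    ext y
    rw [← hgood t ht]
    ring
  rw [h1]
  exact (hc.integral_hasStrictDerivAt 0 x).hasDerivAt.add_const _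

/-- Over a short time a mild solution stays uniformly close to the linear evolution. -/
lemma abs_sub_semi_le (hgood : ∀ t, 0 < t → ∀ a b,
      potential α u₀ F t b - potential α u₀ F t a = ∫ x in a..b, -u t x) {t t' : ℝ} (ht : 0 < t)
    (htt' : t ≤ t') (x : ℝ) :
    |u t' x - semi α (t' - t) (u t) x| ≤ Cf * (∫ x, |deriv (kernel α 1) x|) *
      ((t' - t) ^ (1 - 1 / (α + 1)) / (1 - 1 / (α + 1))) := by
  have hc := continuous_slice hu ht
  have hPm := measurable_potential hα hα1 hF hu₀ ht.le
  have hPb := abs_potential_le (F := F) hα hα1 hFb hu₀ ht.le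
  have hcs := continuous_semi hα hα1 hc (hB t ht) (t' - t)
  have h1 : ∀ y, semi α (t' - t) (potential α u₀ F t) y =
      (∫ z in (0 : ℝ)..y, -semi α (t' - t) (u t) z) +
        semi α (t' - t) (potential α u₀ F t) 0 := fun y => by
    have h2 := semi_sub_semi_of_primitive hα hα1 hPm hPb (p := fun x => -u t x) (t := t' - t)
      (a := 0) (b := y) (hgood t ht)
      (integrable_uncurry_sub_of_bounded hα hα1 hc.neg.measurable
        (fun x => (abs_neg (u t x)).trans_le (hB t ht x)) _ _ _)
    have h3 : (semi α (t' - t) fun x => -u t x) = fun x => -semi α (t' - t) (u t) x := by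
      ext z
      simp only [semi, integral_neg]
    rw [h3] at h2
    linarith
  have h4 : HasDerivAt (semi α (t' - t) (potential α u₀ F t)) (-semi α (t' - t) (u t) x) x := by
    rw [funext h1]
    exact (hcs.neg.integral_hasStrictDerivAt 0 x).hasDerivAt.add_const _
  have h5 := (hasDerivAt_potential hu hgood (ht.trans_le htt') x).sub h4
  have h6 : |-u t' x - -semi α (t' - t) (u t) x| ≤ Cf * (∫ x, |deriv (kernel α 1) x|) *
      ((t' - t) ^ (1 - 1 / (α + 1)) / (1 - 1 / (α + 1))) := by
    have hθ : 1 / (α + 1) < 1 := by rw [div_lt_one (by linarith)]; linarith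
    have hCf : 0 ≤ Cf := (abs_nonneg _).trans (hFb 0 0)
    have hN : 0 ≤ ∫ x, |deriv (kernel α 1) x| := integral_nonneg fun _ => abs_nonneg _
    have h7 : 0 ≤ (t' - t) ^ (1 - 1 / (α + 1)) / (1 - 1 / (α + 1)) :=
      div_nonneg (Real.rpow_nonneg (by linarith) _) (by linarith)
    refine h5.le_of_lip' (by positivity) (Eventually.of_forall fun y => ?_)
    have h8 := abs_duhamel_sub_le hα hα1 hF hFb htt' x y
    have h9 := potential_restart hα hα1 hF hFb hu₀ ht.le htt' x
    have h10 := potential_restart hα hα1 hF hFb hu₀ ht.le htt' y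
    simp only [Pi.sub_apply, Real.norm_eq_abs]
    rwa [h9, h10, add_sub_cancel_left, add_sub_cancel_left]
  rwa [neg_sub_neg, abs_sub_comm] at h6

/-- Mild solutions are uniformly continuous away from the initial time, by comparison with the
linear evolution over short times. -/
lemma uniformContinuousOn_of_mild (hgood : ∀ t, 0 < t → ∀ a b,
      potential α u₀ F t b - potential α u₀ F t a = ∫ x in a..b, -u t x) {τ : ℝ} (hτ : 0 < τ) :
    UniformContinuousOn (fun p : ℝ × ℝ => u p.1 p.2) (Ici τ ×ˢ univ) := by
  have hθ : 1 / (α + 1) < 1 := by rw [div_lt_one (by linarith)]; linarith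
  have hB0 : 0 ≤ B := (abs_nonneg _).trans (hB 1 one_pos 0)
  set K : ℝ → ℝ := fun h => Cf * (∫ x, |deriv (kernel α 1) x|) *
      (h ^ (1 - 1 / (α + 1)) / (1 - 1 / (α + 1))) with hK
  have hmild : ∀ t t' x, 0 < t → t ≤ t' → |u t' x - semi α (t' - t) (u t) x| ≤ K (t' - t) :=
    fun t t' x ht htt' => abs_sub_semi_le hα hα1 hF hFb hu₀ hu hB hgood ht htt' x
  have hK0 : Tendsto K (𝓝[>] 0) (𝓝 0) := by
    have h1 : Continuous K := by
      have := Real.continuous_rpow_const (q := 1 - 1 / (α + 1)) (by linarith)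
      fun_prop
    have h2 := h1.tendsto 0
    simp only [hK, Real.zero_rpow (by linarith : 1 - 1 / (α + 1) ≠ 0), zero_div, mul_zero] at h2
    exact h2.mono_left nhdsWithin_le_nhds
  rw [Metric.uniformContinuousOn_iff]
  intro ε hε
  obtain ⟨κ, hκ, hκK⟩ : ∃ κ > 0, ∀ h, 0 < h → h ≤ κ → K h < ε / 8 := by
    have h1 := (tendsto_order.1 hK0).2 (ε / 8) (by positivity)
    obtain ⟨c, hc, hcU⟩ := mem_nhdsGT_iff_exists_Ioc_subset.1 h1
    exact ⟨c, hc, fun h h0 h1 => hcU ⟨h0, h1⟩⟩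
  set k := min κ (τ / 2) with hk
  have hk0 : 0 < k := by positivity
  -- space modulus: compare with the linear evolution over the time `k`
  obtain ⟨L, hL0, hL⟩ : ∃ L, 0 ≤ L ∧ ∀ t x y, τ ≤ t → |u t x - u t y| ≤ ε / 4 + L * |x - y| := by
    refine ⟨B * (∫ x, |deriv (kernel α 1) x|) * k ^ (-(1 / (α + 1))),
      mul_nonneg (mul_nonneg hB0 (integral_nonneg fun _ => abs_nonneg _)) (by positivity),
      fun t x y ht => ?_⟩
    have htk : 0 < t - k := by linarith [min_le_right κ (τ / 2)]
    have h1 := hmild (t - k) t x htk (by linarith)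
    have h2 := hmild (t - k) t y htk (by linarith)
    rw [sub_sub_cancel] at h1 h2
    have h3 := hκK k hk0 (min_le_left _ _)
    have h4 := abs_semi_sub_semi_le hα hα1 hk0 (continuous_slice hu htk).measurable
      (hB _ htk) y x
    rw [abs_le] at h1 h2 h4 ⊢
    constructor <;> linarith [h1.1, h1.2, h2.1, h2.2, h4.1, h4.2]
  set δ := ε / (8 * (L + 1)) with hδ
  have hδ0 : 0 < δ := by positivity
  have hspace : ∀ t x y, τ ≤ t → |x - y| < δ → |u t x - u t y| ≤ ε / 4 + ε / 8 :=
    fun t x y ht hxy => (hL t x y ht).trans (by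
      have h1 : L * |x - y| ≤ (L + 1) * δ := by gcongr; linarith
      have h2 : (L + 1) * δ = ε / 8 := by rw [hδ]; field_simp
      linarith)
  -- time modulus: for short times the linear evolution only sees nearby values
  obtain ⟨h₀, hh₀, hnear⟩ := exists_abs_semi_le_of_near hα hα1 hδ0
    (η := ε / (32 * (B + 1))) (by positivity)
  have htime : ∀ t t' x, τ ≤ t → t ≤ t' → t' - t < min κ h₀ → |u t' x - u t x| < 5 * ε / 8 := by
    intro t t' x ht htt' hlt
    rcases htt'.eq_or_lt with rfl | htt'
    · rw [sub_self, abs_zero]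
      linarith
    have ht0 : 0 < t := hτ.trans_le ht
    have h1 := hmild t t' x ht0 htt'.le
    have h2 := hκK (t' - t) (sub_pos.2 htt') (hlt.le.trans (min_le_left _ _))
    have hm := (continuous_slice hu ht0).measurable
    have h3 := hnear (t' - t) (sub_pos.2 htt').le (hlt.le.trans (min_le_right _ _))
      (fun y => u t y - u t x) (2 * B) (ε / 4 + ε / 8) x (hm.sub_const _) (by positivity)
      (fun y => (abs_sub _ _).trans (by linarith [hB t ht0 x, hB t ht0 y]))
      (fun y hy => hspace t _ _ ht (by rwa [sub_sub_cancel_left, abs_neg]))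
    rw [semi_sub hα hα1 hm measurable_const (hB t ht0) (fun _ => hB t ht0 x),
      semi_const hα hα1] at h3
    have h4 : 2 * B * (ε / (32 * (B + 1))) ≤ ε / 16 := by
      rw [mul_div_assoc', div_le_div_iff₀ (by positivity) (by norm_num)]
      nlinarith
    rw [abs_le] at h1 h3
    rw [abs_lt]
    constructor <;> linarith [h1.1, h1.2, h3.1, h3.2]
  refine ⟨min δ (min κ h₀), by positivity, ?_⟩
  have key : ∀ t t' x y, τ ≤ t → t ≤ t' → |t' - t| < min κ h₀ → |x - y| < δ →
      |u t' x - u t y| < ε := fun t t' x y ht htt' h1 h2 => by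
    have h3 := htime t t' x ht htt' ((le_abs_self _).trans_lt h1)
    have h4 := hspace t x y ht h2
    rw [abs_lt] at h3 ⊢
    rw [abs_le] at h4
    constructor <;> linarith [h3.1, h3.2, h4.1, h4.2]
  rintro ⟨t, x⟩ ⟨ht, -⟩ ⟨t', y⟩ ⟨ht', -⟩ hd
  rw [Prod.dist_eq, max_lt_iff, Real.dist_eq, Real.dist_eq] at hd
  have hd1 := hd.1.trans_le (min_le_right _ _)
  have hd2 := hd.2.trans_le (min_le_left _ _)
  rw [Real.dist_eq]
  rcases le_total t t' with h | h
  · rw [abs_sub_comm]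
    exact key t t' y x ht h ((abs_sub_comm _ _).trans_lt hd1) ((abs_sub_comm _ _).trans_lt hd2)
  · exact key t' t x y ht' h hd1 hd2

end

/-! ### The flux -/

lemma abs_rpow_sub_rpow_le {q : ℝ} (hq : 1 < q) {B x y : ℝ} (hx : 0 ≤ x) (hy : 0 ≤ y) (hxB : x ≤ B)
    (hyB : y ≤ B) : |x ^ q - y ^ q| ≤ q * B ^ (q - 1) * |x - y| := by
  refine (convex_Icc (0 : ℝ) B).norm_image_sub_le_of_norm_hasDerivWithin_le
    (f := fun x : ℝ => x ^ q) (f' := fun x => q * x ^ (q - 1))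
    (fun z _ => (Real.hasDerivAt_rpow_const (Or.inr hq.le)).hasDerivWithinAt) (fun z hz => ?_)
    ⟨hy, hyB⟩ ⟨hx, hxB⟩
  rw [Real.norm_of_nonneg (mul_nonneg (by linarith) (Real.rpow_nonneg hz.1 _))]
  have := Real.rpow_le_rpow hz.1 hz.2 (by linarith : 0 ≤ q - 1)
  gcongr

lemma flux_of_nonneg {q v : ℝ} (hq : 1 < q) (hv : 0 ≤ v) : flux q v = v ^ q / q := by
  rw [flux, abs_of_nonneg hv]
  rcases hv.eq_or_lt with rfl | hv
  · simp [(by linarith : q ≠ 0)]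
  · rw [Real.rpow_sub_one hv.ne', div_mul_cancel₀ _ hv.ne']

lemma flux_eq {q : ℝ} (hq : 1 < q) (v : ℝ) :
    flux q v = (max v 0) ^ q / q - (max (-v) 0) ^ q / q := by
  have hq0 : q ≠ 0 := by linarith
  rcases le_total 0 v with hv | hv
  · rw [flux_of_nonneg hq hv, max_eq_left hv, max_eq_right (neg_nonpos.2 hv), Real.zero_rpow hq0,
      zero_div, sub_zero]
  · have h1 : flux q v = -flux q (-v) := by
      rw [flux, flux, abs_neg]
      ring
    rw [h1, flux_of_nonneg hq (neg_nonneg.2 hv), max_eq_right hv,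
      max_eq_left (neg_nonneg.2 hv), Real.zero_rpow hq0, zero_div, zero_sub]

lemma continuous_flux {q : ℝ} (hq : 1 < q) : Continuous (flux q) := by
  have := Real.continuous_rpow_const (q := q - 1) (by linarith)
  unfold flux
  fun_prop

lemma flux_nonneg {q v : ℝ} (hq : 1 < q) (hv : 0 ≤ v) : 0 ≤ flux q v :=
  div_nonneg (mul_nonneg (by positivity) hv) (by linarith)

lemma flux_le_flux {q v w : ℝ} (hq : 1 < q) (hv : 0 ≤ v) (hvw : v ≤ w) : flux q v ≤ flux q w := by
  rw [flux_of_nonneg hq hv, flux_of_nonneg hq (hv.trans hvw)]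
  have : 0 ≤ q := by linarith
  gcongr

/-- The flux is locally Lipschitz. The factor two comes from treating the positive and the negative
parts separately. -/
lemma abs_flux_sub_flux_le {q : ℝ} (hq : 1 < q) {B v w : ℝ} (hv : |v| ≤ B) (hw : |w| ≤ B) :
    |flux q v - flux q w| ≤ 2 * B ^ (q - 1) * |v - w| := by
  have hB : 0 ≤ B := (abs_nonneg _).trans hv
  have h1 := abs_rpow_sub_rpow_le hq (le_max_right v 0) (le_max_right w 0)
    (max_le (abs_le.1 hv).2 hB) (max_le (abs_le.1 hw).2 hB)
  have h2 := abs_rpow_sub_rpow_le hq (le_max_right (-v) 0) (le_max_right (-w) 0)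
    (max_le (neg_le.1 (abs_le.1 hv).1) hB) (max_le (neg_le.1 (abs_le.1 hw).1) hB)
  have h3 := abs_max_sub_max_le_abs v w 0
  have h4 := abs_max_sub_max_le_abs (-v) (-w) 0
  rw [neg_sub_neg, abs_sub_comm w v] at h4
  have hq0 : 0 < q := by linarith
  have hc : 0 ≤ q * B ^ (q - 1) := by positivity
  have h5 := h1.trans (mul_le_mul_of_nonneg_left h3 hc)
  have h6 := h2.trans (mul_le_mul_of_nonneg_left h4 hc)
  rw [flux_eq hq, flux_eq hq]
  calc _ = |((max v 0) ^ q - (max w 0) ^ q) - ((max (-v) 0) ^ q - (max (-w) 0) ^ q)| / q := by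
        rw [← abs_of_pos hq0, ← abs_div, abs_of_pos hq0]
        congr 1
        ring
    _ ≤ (q * B ^ (q - 1) * |v - w| + q * B ^ (q - 1) * |v - w|) / q := by
        gcongr
        exact (abs_sub _ _).trans (add_le_add h5 h6)
    _ = _ := by
        field_simp
        ring

lemma abs_flux_le {q : ℝ} (hq : 1 < q) {B v : ℝ} (hv : |v| ≤ B) :
    |flux q v| ≤ 2 * B ^ (q - 1) * B := by
  have hB : 0 ≤ B := (abs_nonneg _).trans hv
  have h1 := abs_flux_sub_flux_le hq hv (w := 0) (by rwa [abs_zero])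
  rw [flux_of_nonneg hq le_rfl, Real.zero_rpow (by linarith), zero_div, sub_zero, sub_zero] at h1
  exact h1.trans (by gcongr)

/-! ### Existence of the potential -/

/-- `P` is a potential of the solution `u`: a primitive of `-u` at positive times that solves
`∂ₜ P = L P + f(u)` in the mild sense, with the uniform continuity of `u` that the comparison
principle needs. -/
structure IsPotential (α q : ℝ) (u P : ℝ → ℝ → ℝ) : Prop where
  measurable : ∀ t, 0 ≤ t → Measurable (P t)
  bounded : ∀ t, 0 ≤ t → ∃ C, ∀ x, |P t x| ≤ C
  hasDerivAt : ∀ t, 0 < t → ∀ x, HasDerivAt (P t) (-u t x) x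
  continuous_slice : ∀ t, 0 < t → Continuous (u t)
  abs_slice_le : ∃ B, ∀ t, 0 < t → ∀ x, |u t x| ≤ B
  uniformContinuousOn : ∀ τ, 0 < τ →
    UniformContinuousOn (fun p : ℝ × ℝ => u p.1 p.2) (Ici τ ×ˢ univ)
  intervalIntegrable : ∀ t t', 0 ≤ t → t < t' → ∀ x,
    IntervalIntegrable (fun s => semi α (t' - s) (fun y => flux q (u s y)) x) volume t t'
  restart : ∀ t t', 0 ≤ t → t < t' → ∀ x, P t' x = semi α (t' - t) (P t) x +
    ∫ s in t..t', semi α (t' - s) (fun y => flux q (u s y)) x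

lemma exists_isPotential {α q : ℝ} (hα : 0 < α) (hα1 : α < 1) (hq : 1 < q) {u₀ : ℝ → ℝ}
    (hu₀ : Integrable u₀) {u : ℝ → ℝ → ℝ} (hu : IsMildSolution α q u₀ u) :
    ∃ P, IsPotential α q u P ∧ ∀ x, P 0 x = tailMass u₀ x := by
  classical
  obtain ⟨hc, ⟨B, hB⟩, hmild⟩ := hu
  set F : ℝ → ℝ → ℝ := fun s y => if 0 < s then flux q (u s y) else 0 with hFdef
  have hFpos : ∀ s, 0 < s → F s = fun y => flux q (u s y) := fun s hs => by
    ext y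
    simp only [hFdef, if_pos hs]
  have hFm : Measurable (Function.uncurry F) := by
    have h1 := ((continuous_flux hq).comp_continuousOn hc).measurable_piecewise
      (g := fun _ => (0 : ℝ)) continuousOn_const (measurableSet_Ioi.prod MeasurableSet.univ)
    convert h1 using 1
    ext ⟨s, y⟩
    simp [hFdef, Set.piecewise, Function.uncurry]
  have hFb : ∀ s x, |F s x| ≤ 2 * B ^ (q - 1) * B := fun s x => by
    have hB0 : 0 ≤ B := (abs_nonneg _).trans (hB 1 one_pos 0)
    simp only [hFdef]
    split_ifs with hs
    · exact abs_flux_le hq (hB s hs x)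
    · rw [abs_zero]
      positivity
  -- a measurable representative of the initial datum
  set v := hu₀.aestronglyMeasurable.mk u₀
  have hvm : Measurable v := hu₀.aestronglyMeasurable.stronglyMeasurable_mk.measurable
  have hvu : u₀ =ᵐ[volume] v := hu₀.aestronglyMeasurable.ae_eq_mk
  have hv : Integrable v := hu₀.congr hvu
  have hae : ∀ᵐ t : ℝ, 0 < t → ∀ a b, potential α v F t b - potential α v F t a =
      ∫ x in a..b, -u t x := by
    rw [Measure.volume_eq_prod, ← Measure.prod_restrict, Measure.restrict_univ] at hmild
    have h1 := (ae_restrict_iff' measurableSet_Ioi).1 (Measure.ae_ae_of_ae_prod hmild)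
    filter_upwards [h1] with t ht ht0 a b
    rw [potential_sub_eq hα hα1 hFm hFb hv hvm ht0 a b]
    refine intervalIntegral.integral_congr_ae ?_
    filter_upwards [ht ht0] with x hx _
    rw [hx, mildRHS]
    congr 2
    · refine integral_congr_ae ?_
      filter_upwards [hvu] with y hy
      rw [hy]
    · refine intervalIntegral.integral_congr_ae (ae_of_all _ fun s hs => ?_)
      rw [uIoc_of_le ht0.le] at hs
      rw [dsemi, hFpos s hs.1]
  have hgood : ∀ t, 0 < t → ∀ a b, potential α v F t b - potential α v F t a =
      ∫ x in a..b, -u t x := fun t ht a b =>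
    potential_sub_eq_integral hα hα1 hFm hFb hv hc hB hae ht a b
  have hcongr : ∀ t t' x, 0 ≤ t → t < t' →
      EqOn (fun s => semi α (t' - s) (F s) x)
        (fun s => semi α (t' - s) (fun y => flux q (u s y)) x) (uIoc t t') := by
    intro t t' x ht htt' s hs
    rw [uIoc_of_le htt'.le] at hs
    simp only [hFpos s (ht.trans_lt hs.1)]
  refine ⟨potential α v F, ⟨fun t ht => measurable_potential hα hα1 hFm hv ht,
    fun t ht => ⟨_, abs_potential_le hα hα1 hFb hv ht⟩,
    fun t ht x => hasDerivAt_potential hc hgood ht x, fun t ht => continuous_slice hc ht,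
    ⟨B, hB⟩, fun τ hτ => uniformContinuousOn_of_mild hα hα1 hFm hFb hv hc hB hgood hτ,
    fun t t' ht htt' x => ?_, fun t t' ht htt' x => ?_⟩, fun x => ?_⟩
  · exact (intervalIntegrable_semi hα hα1 hFm hFb t' x t t').congr (hcongr t t' x ht htt')
  · rw [potential_restart hα hα1 hFm hFb hv ht htt'.le x]
    congr 1
    exact intervalIntegral.integral_congr_ae (ae_of_all _ (hcongr t t' x ht htt'))
  · rw [potential_zero hα hα1 hv]
    exact integral_congr_ae (ae_restrict_of_ae hvu.symm)

/-! ### Barriers for the potential -/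

lemma uniformContinuousOn_sub {f g : ℝ × ℝ → ℝ} {s : Set (ℝ × ℝ)} (hf : UniformContinuousOn f s)
    (hg : UniformContinuousOn g s) : UniformContinuousOn (fun p => f p - g p) s := by
  rw [uniformContinuousOn_iff_restrict] at *
  exact hf.sub hg

/-- The slope of the barrier `step a r`. -/
noncomputable def stepSlope (a r x : ℝ) : ℝ := deriv Real.smoothTransition ((x - a) / r) / r

lemma continuous_stepSlope (a r : ℝ) : Continuous (stepSlope a r) := by
  have := contDiff_deriv_smoothTransition.continuous
  unfold stepSlope
  fun_prop

lemma stepSlope_nonneg (a : ℝ) {r : ℝ} (hr : 0 < r) (x : ℝ) : 0 ≤ stepSlope a r x :=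
  div_nonneg (deriv_smoothTransition_nonneg _) hr.le

lemma uniformContinuous_stepSlope (a r : ℝ) : UniformContinuous (stepSlope a r) := by
  have h1 : UniformContinuous (deriv Real.smoothTransition) :=
    (HasCompactSupport.intro isCompact_Icc fun x hx =>
      deriv_smoothTransition_eq_zero hx).uniformContinuous_of_continuous
      contDiff_deriv_smoothTransition.continuous
  have h2 : ∀ f : ℝ → ℝ, UniformContinuous f → UniformContinuous fun x => f x / r := by
    intro f hf
    simp only [div_eq_mul_inv, mul_comm _ r⁻¹]
    exact Real.uniformContinuous_const_mul.comp hf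
  exact h2 _ (h1.comp (h2 _ (uniformContinuous_id.sub uniformContinuous_const)))

section

variable {α q : ℝ} (hα : 0 < α) (hα1 : α < 1) (hq : 1 < q) {u P : ℝ → ℝ → ℝ}
  (hP : IsPotential α q u P)
include hα hα1 hq hP

/-- Comparison of the potential with its translates. -/
lemma IsPotential.antitone (h0 : Antitone (P 0)) {t : ℝ} (ht : 0 < t) : Antitone (P t) := by
  obtain ⟨B, hB⟩ := hP.abs_slice_le
  have hB0 : 0 ≤ B := (abs_nonneg _).trans (hB 1 one_pos 0)
  have hfc := continuous_flux hq
  suffices h : ∀ a, 0 ≤ a → ∀ x, P t (x + a) - P t x ≤ 0 by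
    intro x y hxy
    have := h (y - x) (sub_nonneg.2 hxy) x
    rw [add_sub_cancel] at this
    linarith
  intro a ha
  refine comparison (D := fun t x => P t (x + a) - P t x) (w := fun t x => u t x - u t (x + a))
    (G := fun t x => flux q (u t (x + a)) - flux q (u t x)) (Λ := 2 * B ^ (q - 1))
    (Cg := 2 * B ^ (q - 1) * B + 2 * B ^ (q - 1) * B) hα hα1 (by positivity) (by positivity)
    ?_ ?_ ?_ ?_ ?_ ?_ ?_ ?_ ?_ ht
  · exact fun t ht => ((hP.measurable t ht).comp (measurable_add_const a)).sub (hP.measurable t ht)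
  · intro t ht
    obtain ⟨C, hC⟩ := hP.bounded t ht
    exact ⟨C + C, fun x => (abs_sub _ _).trans (add_le_add (hC _) (hC _))⟩
  · intro t ht x
    exact (((hP.hasDerivAt t ht (x + a)).comp_add_const x a).sub
      (hP.hasDerivAt t ht x)).congr_deriv (by ring)
  · intro τ hτ
    refine uniformContinuousOn_sub (hP.uniformContinuousOn τ hτ)
      ((hP.uniformContinuousOn τ hτ).comp (f := fun p : ℝ × ℝ => (p.1, p.2 + a)) ?_ ?_)
    · exact (uniformContinuous_fst.prodMk
        (uniformContinuous_snd.add uniformContinuous_const)).uniformContinuousOn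
    · exact fun p hp => ⟨hp.1, mem_univ _⟩
  · intro t ht
    have := hP.continuous_slice t ht
    exact (by fun_prop : Continuous _).measurable
  · exact fun t ht x => (abs_sub _ _).trans
      (add_le_add (abs_flux_le hq (hB t ht _)) (abs_flux_le hq (hB t ht _)))
  · intro t ht x
    rw [abs_sub_comm (u t x)]
    exact abs_flux_sub_flux_le hq (hB t ht _) (hB t ht _)
  · intro t t' ht htt' x
    obtain ⟨C, hC⟩ := hP.bounded t ht
    have hm := hP.measurable t ht
    rw [semi_sub hα hα1 (f := fun y => P t (y + a)) (hm.comp (measurable_add_const a)) hm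
      (fun _ => hC _) hC,
      semi_translate, hP.restart t t' ht htt' x, hP.restart t t' ht htt' (x + a)]
    have h1 : ∫ s in t..t', semi α (t' - s) (fun y => flux q (u s (y + a)) - flux q (u s y)) x =
        (∫ s in t..t', semi α (t' - s) (fun y => flux q (u s y)) (x + a)) -
          ∫ s in t..t', semi α (t' - s) (fun y => flux q (u s y)) x := by
      rw [← intervalIntegral.integral_sub (hP.intervalIntegrable t t' ht htt' _)
        (hP.intervalIntegrable t t' ht htt' _)]
      refine intervalIntegral.integral_congr_ae (ae_of_all _ fun s hs => ?_)
      rw [uIoc_of_le htt'.le] at hs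
      have hs0 : 0 < s := ht.trans_lt hs.1
      have hus := hP.continuous_slice s hs0
      have hm : Measurable fun y => flux q (u s y) :=
        (by fun_prop : Continuous fun y => flux q (u s y)).measurable
      rw [semi_sub hα hα1 (f := fun y => flux q (u s (y + a))) (hm.comp (measurable_add_const a)) hm
        (fun _ => abs_flux_le hq (hB s hs0 _)) (fun _ => abs_flux_le hq (hB s hs0 _)),
        ← semi_translate]
    rw [h1]
    linarith
  · exact fun x => sub_nonpos.2 (h0 (by linarith))

/-- Comparison of the potential with a barrier `c + β t - N step`, from above for `e = 1` and from
below for `e = -1`. In `hψ`, the number `I` stands for the Duhamel integral of the flux of the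
barrier over a time step `h`. -/
lemma IsPotential.barrier_aux {e c β N A a r : ℝ} (he : |e| = 1) (hN : 0 ≤ N) (hr : 0 < r)
    (hA : ∀ x, deriv Real.smoothTransition x ≤ A)
    (hψ : ∀ h, 0 < h → ∀ x I, 0 ≤ I → I ≤ h * flux q (N * (A / r)) →
      e * (N * (step a r x - semi α h (step a r) x) - β * h + I) ≤ 0)
    (h0 : ∀ x, e * (P 0 x - (c - N * step a r x)) ≤ 0) {t : ℝ} (ht : 0 < t) (x : ℝ) :
    e * (P t x - (c + β * t - N * step a r x)) ≤ 0 := by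
  obtain ⟨B₀, hB₀⟩ := hP.abs_slice_le
  set v : ℝ → ℝ := fun x => N * stepSlope a r x with hv
  have hv0 : ∀ x, 0 ≤ v x := fun x => mul_nonneg hN (stepSlope_nonneg a hr x)
  have hvA : ∀ x, v x ≤ N * (A / r) := fun x => by
    have := hA ((x - a) / r)
    simp only [hv, stepSlope]
    gcongr
  have hvc : Continuous v := continuous_const.mul (continuous_stepSlope a r)
  have hvu : UniformContinuous v :=
    Real.uniformContinuous_const_mul.comp (uniformContinuous_stepSlope a r)
  set B := max B₀ (N * (A / r)) with hBdef
  have hB : ∀ t, 0 < t → ∀ x, |u t x| ≤ B := fun t ht x => (hB₀ t ht x).trans (le_max_left _ _)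
  have hvB : ∀ x, |v x| ≤ B := fun x => by
    rw [abs_of_nonneg (hv0 x)]
    exact (hvA x).trans (le_max_right _ _)
  have hB0 : 0 ≤ B := (abs_nonneg _).trans (hB 1 one_pos 0)
  have hfc := continuous_flux hq
  have hsc := continuous_step a r
  have hsb : ∀ k x, |k - N * step a r x| ≤ |k| + N := fun k x => by
    refine (abs_sub _ _).trans ?_
    rw [abs_mul, abs_of_nonneg hN]
    have := abs_smoothTransition_le ((x - a) / r)
    simp only [step]
    gcongr
    nlinarith
  have hfv0 : ∀ x, 0 ≤ flux q (v x) := fun x => flux_nonneg hq (hv0 x)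
  have hfvA : ∀ x, flux q (v x) ≤ flux q (N * (A / r)) := fun x => flux_le_flux hq (hv0 x) (hvA x)
  have hfvm : Measurable fun y => flux q (v y) := (hfc.comp hvc).measurable
  have hem : ∀ z, |e * z| = |z| := fun z => by rw [abs_mul, he, one_mul]
  refine comparison (D := fun t x => e * (P t x - (c + β * t - N * step a r x)))
    (w := fun t x => e * (v x - u t x)) (G := fun t x => e * (flux q (u t x) - flux q (v x)))
    (Λ := 2 * B ^ (q - 1)) (Cg := 2 * B ^ (q - 1) * B + 2 * B ^ (q - 1) * B) hα hα1
    (by positivity) (by positivity) ?_ ?_ ?_ ?_ ?_ ?_ ?_ ?_ ?_ ht x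
  · exact fun t ht => ((hP.measurable t ht).sub
      (measurable_const.sub (hsc.measurable.const_mul N))).const_mul e
  · intro t ht
    obtain ⟨C, hC⟩ := hP.bounded t ht
    exact ⟨C + (|c + β * t| + N), fun x => by
      rw [hem]
      exact (abs_sub _ _).trans (add_le_add (hC x) (hsb _ x))⟩
  · intro t ht x
    exact (((hP.hasDerivAt t ht x).sub (((hasDerivAt_step a r x).const_mul N).const_sub
      (c + β * t))).const_mul e).congr_deriv (by simp only [hv, stepSlope]; ring)
  · intro τ hτ
    refine Real.uniformContinuous_const_mul.comp_uniformContinuousOn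
      (uniformContinuousOn_sub ?_ (hP.uniformContinuousOn τ hτ))
    exact (hvu.comp uniformContinuous_snd).uniformContinuousOn
  · intro t ht
    have := hP.continuous_slice t ht
    exact (by fun_prop : Continuous _).measurable
  · intro t ht x
    rw [hem]
    exact (abs_sub _ _).trans (add_le_add (abs_flux_le hq (hB t ht _)) (abs_flux_le hq (hvB _)))
  · intro t ht x
    rw [hem, hem, abs_sub_comm (v x)]
    exact abs_flux_sub_flux_le hq (hB t ht _) (hvB _)
  · intro t t' ht htt' x
    obtain ⟨C, hC⟩ := hP.bounded t ht
    have hsm := hsc.measurable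
    have hII : IntervalIntegrable (fun s => semi α (t' - s) (fun y => flux q (v y)) x)
        volume t t' :=
      intervalIntegrable_semi hα hα1 (F := fun _ y => flux q (v y)) (hfvm.comp measurable_snd)
        (fun _ y => abs_flux_le hq (hvB y)) t' x t t'
    have h1 : semi α (t' - t) (fun x => e * (P t x - (c + β * t - N * step a r x))) x =
        e * (semi α (t' - t) (P t) x - (c + β * t - N * semi α (t' - t) (step a r) x)) := by
      rw [semi_const_mul, semi_sub hα hα1 (hP.measurable t ht)
        (g := fun x => c + β * t - N * step a r x) (measurable_const.sub (hsm.const_mul N)) hC (hsb _),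
        semi_sub hα hα1 (f := fun _ => c + β * t) (g := fun x => N * step a r x)
          measurable_const (hsm.const_mul N) (fun _ => le_rfl) (D := N * 1) (fun x => by
            rw [abs_mul, abs_of_nonneg hN]
            exact mul_le_mul_of_nonneg_left (abs_smoothTransition_le _) hN),
        semi_const hα hα1, semi_const_mul]
    have h2 : ∫ s in t..t', semi α (t' - s) (fun y => e * (flux q (u s y) - flux q (v y))) x =
        e * ((∫ s in t..t', semi α (t' - s) (fun y => flux q (u s y)) x) -
          ∫ s in t..t', semi α (t' - s) (fun y => flux q (v y)) x) := by
      rw [← intervalIntegral.integral_sub (hP.intervalIntegrable t t' ht htt' _) hII,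
        ← intervalIntegral.integral_const_mul]
      refine intervalIntegral.integral_congr_ae (ae_of_all _ fun s hs => ?_)
      rw [uIoc_of_le htt'.le] at hs
      have hs0 : 0 < s := ht.trans_lt hs.1
      have hus := hP.continuous_slice s hs0
      rw [semi_const_mul, semi_sub hα hα1
        (by fun_prop : Continuous fun y => flux q (u s y)).measurable hfvm
        (fun _ => abs_flux_le hq (hB s hs0 _)) (fun _ => abs_flux_le hq (hvB _))]
    have h3 : 0 ≤ ∫ s in t..t', semi α (t' - s) (fun y => flux q (v y)) x :=
      intervalIntegral.integral_nonneg htt'.le fun s _ => integral_nonneg fun y => hfv0 _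
    have h4 : ∫ s in t..t', semi α (t' - s) (fun y => flux q (v y)) x ≤
        (t' - t) * flux q (N * (A / r)) := by
      have h5 := intervalIntegral.integral_mono_on htt'.le hII
        (intervalIntegrable_const (c := flux q (N * (A / r)))) fun s _ => by
          have h6 := semi_mono hα hα1 hfvm measurable_const (fun y => abs_flux_le hq (hvB y))
            (fun _ => le_rfl) hfvA (t' - s) x
          rwa [semi_const hα hα1] at h6
      rwa [intervalIntegral.integral_const, smul_eq_mul] at h5
    have h7 := hψ (t' - t) (sub_pos.2 htt') x _ h3 h4
    rw [h1, h2, hP.restart t t' ht htt' x]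
    linarith
  · intro x
    simpa using h0 x

/-- A barrier `c + β t - N step` bounds the potential from above if `β` makes up for the nonlocal
term and the flux of the barrier. -/
lemma IsPotential.le_barrier {c β N A a r : ℝ} (hN : 0 ≤ N) (hr : 0 < r)
    (hA : ∀ x, deriv Real.smoothTransition x ≤ A)
    (hβ : N * (stepConst / r ^ (α + 1)) + flux q (N * (A / r)) ≤ β)
    (h0 : ∀ x, P 0 x ≤ c - N * step a r x) {t : ℝ} (ht : 0 < t) (x : ℝ) :
    P t x ≤ c + β * t - N * step a r x := by
  have h1 := hP.barrier_aux hα hα1 hq (e := 1) (c := c) (β := β) (a := a) abs_one hN hr hA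
    (fun h hh x I _ hI => by
      have h2 := (abs_le.1 (abs_semi_step_sub_le hα hα1 hh.le a hr x)).1
      have h3 := mul_le_mul_of_nonneg_left h2 hN
      have h4 := mul_le_mul_of_nonneg_left hβ hh.le
      have h5 : N * (h / r ^ (α + 1) * stepConst) = h * (N * (stepConst / r ^ (α + 1))) := by ring
      linarith)
    (fun x => by linarith [h0 x]) ht x
  linarith

/-- A barrier `c - β t - N step` bounds the potential from below if `β` makes up for the nonlocal
term; the flux of the barrier has the good sign here. -/
lemma IsPotential.barrier_le {c β N a r : ℝ} (hN : 0 ≤ N) (hr : 0 < r)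
    (hβ : N * (stepConst / r ^ (α + 1)) ≤ β)
    (h0 : ∀ x, c - N * step a r x ≤ P 0 x) {t : ℝ} (ht : 0 < t) (x : ℝ) :
    c - β * t - N * step a r x ≤ P t x := by
  obtain ⟨A, -, hA⟩ := exists_deriv_smoothTransition_le
  have h1 := hP.barrier_aux hα hα1 hq (e := -1) (c := c) (β := -β) (a := a) (by norm_num) hN hr hA
    (fun h hh x I hI _ => by
      have h2 := (abs_le.1 (abs_semi_step_sub_le hα hα1 hh.le a hr x)).2
      have h3 := mul_le_mul_of_nonneg_left h2 hN
      have h4 := mul_le_mul_of_nonneg_left hβ hh.le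
      have h5 : N * (h / r ^ (α + 1) * stepConst) = h * (N * (stepConst / r ^ (α + 1))) := by ring
      linarith)
    (fun x => by linarith [h0 x]) ht x
  linarith

end

/-! ### Tail estimates -/

lemma setOf_lt_abs_eq (r : ℝ) : {y : ℝ | r < |y|} = Iio (-r) ∪ Ioi r := by
  ext y
  simp only [mem_ofPred_eq, lt_abs, mem_union, mem_Iio, mem_Ioi, lt_neg, or_comm]

lemma setIntegral_lt_abs {f : ℝ → ℝ} (hf : Integrable f) {r : ℝ} (hr : 0 ≤ r) :
    ∫ y in {y : ℝ | r < |y|}, f y = (∫ y in Iic (-r), f y) + ∫ y in Ioi r, f y := by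
  rw [setOf_lt_abs_eq r, setIntegral_union _ measurableSet_Ioi hf.integrableOn hf.integrableOn,
    integral_Iic_eq_integral_Iio]
  rw [disjoint_left]
  intro y hy hy'
  rw [mem_Iio] at hy
  rw [mem_Ioi] at hy'
  linarith

section

variable {α q : ℝ} (hα : 0 < α) (hα1 : α < 1) (hq : 1 < q) {u P : ℝ → ℝ → ℝ}
  (hP : IsPotential α q u P) {u₀ : ℝ → ℝ} (hu₀ : Integrable u₀) (hu₀0 : ∀ᵐ x, 0 ≤ u₀ x)
  (hP0 : ∀ x, P 0 x = tailMass u₀ x)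
include hα hα1 hq hP hu₀ hu₀0 hP0

lemma IsPotential.solution_nonneg {t : ℝ} (ht : 0 < t) (x : ℝ) : 0 ≤ u t x := by
  have h1 : P 0 = tailMass u₀ := funext hP0
  have h2 := (hP.hasDerivAt t ht x).nonpos_of_antitone
    (hP.antitone hα hα1 hq (by rw [h1]; exact tailMass_antitone hu₀ hu₀0) ht)
  linarith

omit hu₀ in
lemma IsPotential.nonneg {t : ℝ} (ht : 0 < t) (x : ℝ) : 0 ≤ P t x := by
  have h := hP.barrier_le hα hα1 hq (c := 0) (β := 0) (a := 0) (N := 0) le_rfl one_pos (by simp)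
    (fun x => by simpa [hP0] using tailMass_nonneg hu₀0 x) ht x
  simpa using h

lemma IsPotential.le_mass {t : ℝ} (ht : 0 < t) (x : ℝ) : P t x ≤ ∫ y, u₀ y := by
  obtain ⟨A, -, hA⟩ := exists_deriv_smoothTransition_le
  have h := hP.le_barrier hα hα1 hq (c := ∫ y, u₀ y) (β := 0) (a := 0) (N := 0) le_rfl one_pos hA
    (by simp [flux]) (fun x => by simpa [hP0] using tailMass_le hu₀ hu₀0 x) ht x
  simpa using h

lemma IsPotential.le_tailMass_add {A r : ℝ} (hr : 0 < r)
    (hA : ∀ x, deriv Real.smoothTransition x ≤ A) {t : ℝ} (ht : 0 < t) :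
    P t (2 * r) ≤ tailMass u₀ r + ((∫ y, u₀ y) * (stepConst / r ^ (α + 1)) +
      flux q ((∫ y, u₀ y) * (A / r))) * t := by
  have hM : 0 ≤ ∫ y, u₀ y := integral_nonneg_of_ae hu₀0
  have h := hP.le_barrier hα hα1 hq (c := tailMass u₀ r + ∫ y, u₀ y) (a := r) hM hr hA
    le_rfl (fun x => ?_) ht (2 * r)
  · rw [step, show (2 * r - r) / r = 1 by field_simp; ring,
      Real.smoothTransition.one_of_one_le le_rfl] at h
    linarith
  · rw [hP0]
    rcases le_total x r with hx | hx
    · rw [step, Real.smoothTransition.zero_of_nonpos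
        (div_nonpos_of_nonpos_of_nonneg (by linarith) hr.le)]
      linarith [tailMass_le hu₀ hu₀0 x, tailMass_nonneg hu₀0 r]
    · have h1 := mul_le_mul_of_nonneg_left (Real.smoothTransition.le_one ((x - r) / r)) hM
      rw [step]
      linarith [tailMass_antitone hu₀ hu₀0 hx]

lemma IsPotential.tailMass_sub_le {r : ℝ} (hr : 0 < r) {t : ℝ} (ht : 0 < t) :
    tailMass u₀ (-r) - (∫ y, u₀ y) * (stepConst / r ^ (α + 1)) * t ≤ P t (-(2 * r)) := by
  have hM : 0 ≤ ∫ y, u₀ y := integral_nonneg_of_ae hu₀0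
  have h := hP.barrier_le hα hα1 hq (c := tailMass u₀ (-r)) (a := -(2 * r)) hM hr
    le_rfl (fun x => ?_) ht (-(2 * r))
  · rw [step, sub_self, zero_div, Real.smoothTransition.zero_of_nonpos le_rfl] at h
    linarith
  · rw [hP0]
    rcases le_total x (-r) with hx | hx
    · have h1 := mul_nonneg hM (Real.smoothTransition.nonneg ((x - -(2 * r)) / r))
      rw [step]
      linarith [tailMass_antitone hu₀ hu₀0 hx]
    · rw [step, Real.smoothTransition.one_of_one_le (by rw [le_div_iff₀ hr]; linarith)]
      linarith [tailMass_le hu₀ hu₀0 (-r), tailMass_nonneg hu₀0 x]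

omit hα hα1 hq hu₀ hu₀0 hP0 in
lemma IsPotential.intervalIntegral_eq {t : ℝ} (ht : 0 < t) (a b : ℝ) :
    ∫ x in a..b, u t x = P t a - P t b := by
  have h := intervalIntegral.integral_eq_sub_of_hasDerivAt (a := a) (b := b)
    (fun x _ => hP.hasDerivAt t ht x) ((hP.continuous_slice t ht).fun_neg.intervalIntegrable a b)
  rw [intervalIntegral.integral_neg] at h
  linarith

lemma IsPotential.integrable {t : ℝ} (ht : 0 < t) : Integrable (u t) := by
  refine integrable_of_intervalIntegral_norm_bounded (l := atTop) (a := fun n : ℕ => -(n : ℝ))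
    (b := fun n : ℕ => (n : ℝ)) (∫ y, u₀ y)
    (fun n => ((hP.continuous_slice t ht).integrableOn_Icc).mono_set Ioc_subset_Icc_self)
    (tendsto_neg_atTop_atBot.comp tendsto_natCast_atTop_atTop) tendsto_natCast_atTop_atTop
    (Eventually.of_forall fun n => ?_)
  simp only [Real.norm_of_nonneg (hP.solution_nonneg hα hα1 hq hu₀ hu₀0 hP0 ht _)]
  rw [hP.intervalIntegral_eq ht]
  linarith [hP.le_mass hα hα1 hq hu₀ hu₀0 hP0 ht (-n), hP.nonneg hα hα1 hq hu₀0 hP0 ht n]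

lemma IsPotential.integral_Ioi_le {t : ℝ} (ht : 0 < t) (a : ℝ) : ∫ x in Ioi a, u t x ≤ P t a := by
  refine le_of_tendsto (intervalIntegral_tendsto_integral_Ioi a
    (hP.integrable hα hα1 hq hu₀ hu₀0 hP0 ht).integrableOn tendsto_id)
    (Eventually.of_forall fun b => ?_)
  rw [hP.intervalIntegral_eq ht]
  linarith [hP.nonneg hα hα1 hq hu₀0 hP0 ht (id b)]

lemma IsPotential.integral_Iic_le {t : ℝ} (ht : 0 < t) (a : ℝ) :
    ∫ x in Iic a, u t x ≤ (∫ y, u₀ y) - P t a := by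
  refine le_of_tendsto (intervalIntegral_tendsto_integral_Iic a
    (hP.integrable hα hα1 hq hu₀ hu₀0 hP0 ht).integrableOn tendsto_id)
    (Eventually.of_forall fun b => ?_)
  rw [hP.intervalIntegral_eq ht]
  linarith [hP.le_mass hα hα1 hq hu₀ hu₀0 hP0 ht (id b)]

/-- The tail estimate without rescaling. -/
lemma IsPotential.setIntegral_lt_abs_le {A r : ℝ} (hr : 0 < r) (hA0 : 0 ≤ A)
    (hA : ∀ x, deriv Real.smoothTransition x ≤ A) {t : ℝ} (ht : 0 < t) :
    ∫ x in {x : ℝ | 2 * r < |x|}, u t x ≤ (∫ x in {x : ℝ | r < |x|}, u₀ x) +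
      (2 * (∫ y, u₀ y) * stepConst + ((∫ y, u₀ y) * A) ^ q / q + ∫ y, u₀ y) *
        (t / r ^ (α + 1) + t ^ (1 / q) / r) := by
  have hM : 0 ≤ ∫ y, u₀ y := integral_nonneg_of_ae hu₀0
  have hint := hP.integrable hα hα1 hq hu₀ hu₀0 hP0 ht
  have hR := hP.integral_Ioi_le hα hα1 hq hu₀ hu₀0 hP0 ht (2 * r)
  have hL := hP.integral_Iic_le hα hα1 hq hu₀ hu₀0 hP0 ht (-(2 * r))
  have hR' := hP.le_tailMass_add hα hα1 hq hu₀ hu₀0 hP0 hr hA ht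
  have hL' := hP.tailMass_sub_le hα hα1 hq hu₀ hu₀0 hP0 hr ht
  have hsplit : (∫ y in Iic (-r), u₀ y) + tailMass u₀ (-r) = ∫ y, u₀ y :=
    intervalIntegral.integral_Iic_add_Ioi hu₀.integrableOn hu₀.integrableOn
  have hq0 : 0 < q := by linarith
  have hS := stepConst_nonneg
  set M := ∫ y, u₀ y
  set X := t / r ^ (α + 1) with hX
  set Y := t ^ (1 / q) / r with hY
  have hX0 : 0 ≤ X := by positivity
  have hY0 : 0 ≤ Y := by positivity
  have hA' : 0 ≤ (M * A) ^ q / q := by positivity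
  rw [setIntegral_lt_abs hint (by linarith), setIntegral_lt_abs hu₀ hr.le]
  change _ ≤ (∫ y in Iic (-r), u₀ y) + tailMass u₀ r + _
  rcases le_total Y 1 with hY1 | hY1
  · have h1 : flux q (M * (A / r)) * t = (M * A) ^ q / q * Y ^ q := by
      rw [flux_of_nonneg hq (by positivity), hY, ← mul_div_assoc, Real.div_rpow (by positivity)
        hr.le, Real.div_rpow (by positivity) hr.le, ← Real.rpow_mul ht.le,
        one_div_mul_cancel hq0.ne', Real.rpow_one]
      ring
    have h2 : Y ^ q ≤ Y := Real.rpow_le_self_of_le_one hY0 hY1 hq.le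
    have h3 := mul_le_mul_of_nonneg_left h2 hA'
    have h4 : M * (stepConst / r ^ (α + 1)) * t = M * stepConst * X := by rw [hX]; ring
    have h5 : 0 ≤ M * stepConst * Y := by positivity
    have h6 : 0 ≤ (M * A) ^ q / q * X := by positivity
    have h7 : 0 ≤ M * X := by positivity
    have h8 : 0 ≤ M * Y := by positivity
    linarith
  -- for large `t` the estimate follows from the bound of the mass
  · have h1 : (∫ x in Iic (-(2 * r)), u t x) + ∫ x in Ioi (2 * r), u t x ≤ M := by
      have h2 := hP.antitone hα hα1 hq (by
        rw [funext hP0]; exact tailMass_antitone hu₀ hu₀0) ht (by linarith : -(2 * r) ≤ 2 * r)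
      linarith
    have h2 : 0 ≤ ∫ y in Iic (-r), u₀ y := integral_nonneg_of_ae (ae_restrict_of_ae hu₀0)
    have h3 := tailMass_nonneg hu₀0 r
    have h4 : M ≤ M * Y := le_mul_of_one_le_right hM hY1
    have h5 : 0 ≤ (2 * M * stepConst + (M * A) ^ q / q) * (X + Y) := by positivity
    have h6 : 0 ≤ M * X := by positivity
    linarith

end

end NonlocalCL

theorem lemma8 (q : ℝ) (hq : 1 < q) (M : ℝ) :
    ∃ C : ℝ, 0 < C ∧
      ∀ α : ℝ, 0 < α → α < 1 → q < 1 + α →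
      ∀ u₀ : ℝ → ℝ, MeasureTheory.Integrable u₀ →
        MeasureTheory.MemLp u₀ ⊤ MeasureTheory.volume →
        (∀ᵐ x, 0 ≤ u₀ x) → ∫ x, u₀ x = M →
      ∀ u : ℝ → ℝ → ℝ, NonlocalCL.IsMildSolution α q u₀ u →
      ∀ l : ℝ, 1 < l → ∀ R : ℝ, 0 < R → ∀ s : ℝ, 0 < s →
        MeasureTheory.IntegrableOn (NonlocalCL.rescale q l u s) {y : ℝ | 2 * R < |y|} ∧
        ∫ y in {y : ℝ | 2 * R < |y|}, NonlocalCL.rescale q l u s y ≤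
          (∫ y in {y : ℝ | R < |y|}, u₀ y) +
            C * (s * l ^ (q - 1 - α) / R ^ (α + 1) + s ^ (1 / q) / R) := by
  obtain ⟨A, hA0, hA⟩ := NonlocalCL.exists_deriv_smoothTransition_le
  have hS := NonlocalCL.stepConst_nonneg
  have hq0 : 0 < q := by linarith
  refine ⟨2 * |M| * NonlocalCL.stepConst + (|M| * A) ^ q / q + |M| + 1, by positivity, ?_⟩
  intro α hα hα1 _ u₀ hu₀ _ hu₀0 hM u hu l hl R hR s hs
  have hM0 : 0 ≤ M := hM ▸ integral_nonneg_of_ae hu₀0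
  rw [abs_of_nonneg hM0]
  obtain ⟨P, hP, hP0⟩ := NonlocalCL.exists_isPotential hα hα1 hq hu₀ hu
  have hl0 : 0 < l := by linarith
  have ht : 0 < l ^ q * s := by positivity
  have hint := hP.integrable hα hα1 hq hu₀ hu₀0 hP0 ht
  refine ⟨((hint.comp_mul_left' hl0.ne').const_mul l).integrableOn, ?_⟩
  have h1 := hP.setIntegral_lt_abs_le hα hα1 hq hu₀ hu₀0 hP0 (r := l * R) (by positivity) hA0 hA ht
  rw [hM] at h1
  have hmeas : ∀ r : ℝ, MeasurableSet {y : ℝ | r < |y|} := fun r =>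
    measurableSet_lt measurable_const measurable_abs
  have h2 : ∫ y in {y : ℝ | 2 * R < |y|}, NonlocalCL.rescale q l u s y =
      ∫ x in {x : ℝ | 2 * (l * R) < |x|}, u (l ^ q * s) x := by
    have h3 : ∀ y, {y : ℝ | 2 * R < |y|}.indicator (NonlocalCL.rescale q l u s) y =
        l * {x : ℝ | 2 * (l * R) < |x|}.indicator (u (l ^ q * s)) (l * y) := fun y => by
      have h4 : 2 * (l * R) < |l * y| ↔ 2 * R < |y| := by
        rw [abs_mul, abs_of_pos hl0, mul_left_comm, mul_lt_mul_iff_right₀ hl0]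
      simp only [indicator_apply, mem_ofPred_eq, h4, NonlocalCL.rescale, mul_ite, mul_zero]
    rw [← integral_indicator (hmeas _), ← integral_indicator (hmeas _)]
    simp only [h3]
    rw [integral_const_mul, Measure.integral_comp_mul_left, abs_of_pos (inv_pos.2 hl0), smul_eq_mul,
      mul_inv_cancel_left₀ hl0.ne']
  have h3 : ∫ x in {x : ℝ | l * R < |x|}, u₀ x ≤ ∫ x in {x : ℝ | R < |x|}, u₀ x := by
    refine setIntegral_mono_set hu₀.integrableOn (ae_restrict_of_ae hu₀0)
      (MeasureTheory.ae_of_all _ fun x hx => ?_)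
    exact lt_of_le_of_lt (le_mul_of_one_le_left hR.le hl.le) hx
  have h4 : l ^ q * s / (l * R) ^ (α + 1) = s * l ^ (q - 1 - α) / R ^ (α + 1) := by
    rw [Real.mul_rpow hl0.le hR.le, show q - 1 - α = q - (α + 1) by ring, Real.rpow_sub hl0]
    field_simp
  have h5 : (l ^ q * s) ^ (1 / q) / (l * R) = s ^ (1 / q) / R := by
    rw [Real.mul_rpow (by positivity) hs.le, ← Real.rpow_mul hl0.le, mul_one_div_cancel hq0.ne',
      Real.rpow_one, mul_div_mul_left _ _ hl0.ne']
  rw [h4, h5] at h1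
  rw [h2]
  have h6 : 0 ≤ s * l ^ (q - 1 - α) / R ^ (α + 1) + s ^ (1 / q) / R := by positivity
  linarith
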